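/- Let $n\in\mathbb N$, let $\lambda_1,\lambda_2:[0,1]\to(0,\infty)$ be continuous (for instance continuous and piecewise continuously differentiable), let $A=[A_{ij}]:[0,1]\to\mathbb R^{2\times2}$ be continuous, and let $F\in\mathbb R^{n\times n}$, $b,c\in\mathbb R^n$, $q_0,q_1\in\mathbb R$ with $q_0\neq0$. Put $\Lambda=\operatorname{diag}(\lambda_1,-\lambda_2)$ and consider, for $z\in[0,1]$, the system with input $u$ $$\dot\xi(t)=F\xi(t)+b\,x_1(0,t),\quad x_2(0,t)=q_0x_1(0,t)+c^\top\xi(t),\quad \partial_tx(z,t)=\Lambda(z)\partial_zx(z,t)+A(z)x(z,t),\quad x_1(1,t)=q_1x_2(1,t)+u(t)\qquad(1)$$ with $\xi(0)=\xi_0\in\mathbb R^n$, $x(z,0)=x_0(z)\in\mathbb R^2$. Let $\alpha_i(z)=\int_0^z A_{ii}/\lambda_i\,\mathrm d\zeta$, $E=\operatorname{diag}(e^{\alpha_1},e^{-\alpha_2})$, $\tilde A_{12}=A_{12}e^{\alpha_1+\alpha_2}$, $\tilde A_{21}=A_{21}e^{-\alpha_1-\alpha_2}$, $\tilde A_{11}=\tilde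 A_{22}=0$, and $\bar q_1=q_1e^{\alpha_1(1)+\alpha_2(1)}$. States are bounded measurable functions $[0,1]\to\mathbb R^2$ (e.g. piecewise continuous ones), trajectories $x$ are measurable on $[0,1]\times[0,\infty)$ and bounded on $[0,1]\times[0,T]$ for every $T$; the ODE is understood in integrated form with $\xi$ continuous, and the boundary conditions hold for $t>0$. PDEs are understood along characteristics: a PDE $\partial_tx=\Lambda\partial_zx+f$ means that along every curve $s\mapsto(\gamma(s),s)$ in $[0,1]\times[0,\infty)$ with $\gamma'=-\Lambda_{ii}(\gamma)$ the increment of $x_i$ is the integral of $f_i$, and the kernel PDE below means that along every curve $(p,r)$ in the triangle with $p'=\Lambda_{ii}(p)$, $r'=\Lambda_{jj}(r)$ the function $K_{ij}(p,r)\Lambda_{jj}(r)$ has the derivative $\Lambda_{jj}(r)\,(K(p,r)\tilde A(r))_{ij}$ (for continuously differentiable functions and velocities these are the pointwise equations). Then the kernel equations $$\Lambda(z)\partial_zK(z,\zeta)+\partial_\zeta\big(K(z,\zeta)\Lambda(\zeta)\big)=K(z,\zeta)\tilde A(\zeta),\qquad 0\le\zeta\le z\le1,$$ $$K_{11}(z,0)=\tfrac{q_0\lambda_2(0)}{\lambda_1(0)}K_{12}(z,0),\quad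 K_{12}(z,z)=-\tfrac{\tilde A_{12}(z)}{\lambda_1(z)+\lambda_2(z)},\quad K_{21}(z,z)=\tfrac{\tilde A_{21}(z)}{\lambda_1(z)+\lambda_2(z)},\quad K_{22}(z,0)=\tfrac{\lambda_1(0)}{q_0\lambda_2(0)}K_{21}(z,0)$$ have a continuous solution $K$ with values in $\mathbb R^{2\times2}$. For every such $K$, with $C(z)=K(z,0)\Lambda(0)e_2c^\top$, the transformation $$(\mathcal Tw)(z)=E(z)w(z)-\int_0^zK(z,\zeta)E(\zeta)w(\zeta)\,\mathrm d\zeta$$ is a bijection of the state space onto itself that is bounded in both directions (sup norm), and (1) is equivalent to the transport form $$\dot\xi(t)=F\xi(t)+b\,\bar x_1(0,t),\quad \bar x_2(0,t)=q_0\bar x_1(0,t)+c^\top\xi(t),\quad \partial_t\bar x(z,t)=\Lambda(z)\partial_z\bar x(z,t)+C(z)\xi(t),\quad \bar x_1(1,t)=\bar q_1\bar x_2(1,t)+\bar u(t)\qquad(2)$$ with $\xi(0)=\xi_0$, $\bar x(\cdot,0)=\bar x_0$, in the following sense. If $(\xi,x)$ solves (1) with input $u$ and initial values $(\xi_0,x_0)$,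 then $(\xi,\bar x)$ with $\bar x(\cdot,t)=\mathcal Tx(\cdot,t)$ solves (2) with initial values $(\xi_0,\mathcal Tx_0)$ and input $$\bar u(t)=e^{\alpha_1(1)}u(t)+\int_0^1(\bar q_1e_2^\top-e_1^\top)K(1,z)E(z)x(z,t)\,\mathrm dz.\qquad(3)$$ Conversely, for every solution $(\xi,\bar x)$ of (2) with input $\bar u$ and initial values $(\xi_0,\bar x_0)$ there is exactly one triple of an initial state $x_0$, an input $u$ (on $t>0$) and a trajectory $x$ such that $(\xi,x)$ solves (1) with input $u$ and initial values $(\xi_0,x_0)$, $\mathcal Tx_0=\bar x_0$, $\mathcal Tx(\cdot,t)=\bar x(\cdot,t)$ for all $t\ge0$, and (3) holds for $t>0$. -/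

import Mathlib

open Set MeasureTheory
open scoped Matrix

/-- Data of a linear heterodirectional hyperbolic PDE-ODE system on the spatial domain `[0, 1]` with
ODE state in `ℝⁿ`. Index `0` of `Fin 2` is the component that travels towards `z = 0`, index `1` the
component that travels towards `z = 1`. Functions of `z` only matter on `[0, 1]`. Continuity of the
velocities suffices; continuous, piecewise continuously differentiable velocities are a special
case. -/
structure PDEODESystem (n : ℕ) where
  /-- the two transport velocities -/
  lam : Fin 2 → ℝ → ℝ
  /-- the in-domain coupling matrix -/
  A : ℝ → Matrix (Fin 2) (Fin 2) ℝ
  F : Matrix (Fin n) (Fin n) ℝ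
  b : Fin n → ℝ
  c : Fin n → ℝ
  q0 : ℝ
  q1 : ℝ
  lam_pos : ∀ i, ∀ z ∈ Icc (0 : ℝ) 1, 0 < lam i z
  lam_cont : ∀ i, ContinuousOn (lam i) (Icc 0 1)
  A_cont : ∀ i j, ContinuousOn (fun z => A z i j) (Icc 0 1)

/-- A distributed state: a bounded measurable function `[0, 1] → ℝ²` (for example a piecewise
continuous one). -/
def IsState (w : ℝ → Fin 2 → ℝ) : Prop :=
  Measurable ((Icc (0 : ℝ) 1).domRestrict w) ∧ ∃ M : ℝ, ∀ z ∈ Icc (0 : ℝ) 1, ‖w z‖ ≤ M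

/-- A trajectory `(z, t) ↦ x z t` of distributed states: measurable on `[0, 1] × [0, ∞)` and bounded on
`[0, 1] × [0, T]` for every `T`. -/
def IsStateTrajectory (x : ℝ → ℝ → Fin 2 → ℝ) : Prop :=
  Measurable ((Icc (0 : ℝ) 1 ×ˢ Ici (0 : ℝ)).domRestrict (fun p : ℝ × ℝ => x p.1 p.2)) ∧
    ∀ T : ℝ, ∃ M : ℝ, ∀ z ∈ Icc (0 : ℝ) 1, ∀ t ∈ Icc (0 : ℝ) T, ‖x z t‖ ≤ M

/-- `x` solves `∂ₜ x(z,t) = Λ(z) ∂_z x(z,t) + f(z,t)` with diagonal `Λ` on `[0, 1] × [0, ∞)` in the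
sense of the method of characteristics: along every curve `s ↦ (γ(s), s)` in the domain with
`γ' = -Λᵢᵢ(γ)`, the increment of `xᵢ` is the integral of `fᵢ`. For a continuously differentiable `x`
this is the pointwise equation, because `d/ds xᵢ(γ(s), s) = (∂ₜ xᵢ - Λᵢᵢ ∂_z xᵢ)(γ(s), s)`; it makes
sense for piecewise continuous states as well. -/
def SolvesTransport (Λ : ℝ → Matrix (Fin 2) (Fin 2) ℝ) (f x : ℝ → ℝ → Fin 2 → ℝ) : Prop :=
  ∀ (i : Fin 2) (a b : ℝ) (γ : ℝ → ℝ), 0 ≤ a → a ≤ b →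
    (∀ s ∈ Icc a b, γ s ∈ Icc (0 : ℝ) 1 ∧
      HasDerivWithinAt γ (-(Λ (γ s) i i)) (Icc a b) s) →
    x (γ b) b i - x (γ a) a i = ∫ s in a..b, f (γ s) s i

namespace PDEODESystem

variable {n : ℕ} (S : PDEODESystem n)

/-- The matrix of (signed) transport velocities. -/
def Lam (z : ℝ) : Matrix (Fin 2) (Fin 2) ℝ :=
  !![S.lam 0 z, 0; 0, -S.lam 1 z]

/-- `(ξ, x)` with input `v` and initial values `ξ₀`, `x₀` solves the PDE-ODE system with the
ODE, the boundary condition at `z = 0` and the velocities of `S`, with source term `f` in the PDE and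
with reflection coefficient `q` at the actuated boundary `z = 1`:
`ξ' = F ξ + b x₁(0,t)`, `x₂(0,t) = q₀ x₁(0,t) + cᵀ ξ`, `∂ₜ x = Λ ∂_z x + f`,
`x₁(1,t) = q x₂(1,t) + v`. The ODE is understood in integrated form as `x₁(0,·)` may jump; the boundary
conditions hold for `t > 0`, so no compatibility of the initial values is presupposed. -/
structure SolvesWith (f : ℝ → ℝ → Fin 2 → ℝ) (q : ℝ) (ξ₀ : Fin n → ℝ) (x₀ : ℝ → Fin 2 → ℝ)
    (v : ℝ → ℝ) (ξ : ℝ → Fin n → ℝ) (x : ℝ → ℝ → Fin 2 → ℝ) : Prop where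
  traj : IsStateTrajectory x
  cont : ContinuousOn ξ (Ici 0)
  init : ∀ z ∈ Icc (0 : ℝ) 1, x z 0 = x₀ z
  ode : ∀ t : ℝ, 0 ≤ t → ξ t = ξ₀ + ∫ s in (0 : ℝ)..t, (S.F *ᵥ ξ s + x 0 s 0 • S.b)
  bc0 : ∀ t : ℝ, 0 < t → x 0 t 1 = S.q0 * x 0 t 0 + S.c ⬝ᵥ ξ t
  pde : SolvesTransport S.Lam f x
  bc1 : ∀ t : ℝ, 0 < t → x 1 t 0 = q * x 1 t 1 + v t

/-- Solutions of the original system, with the coupled PDE `∂ₜ x = Λ ∂_z x + A x`. -/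
def IsSolution (ξ₀ : Fin n → ℝ) (x₀ : ℝ → Fin 2 → ℝ) (u : ℝ → ℝ) (ξ : ℝ → Fin n → ℝ)
    (x : ℝ → ℝ → Fin 2 → ℝ) : Prop :=
  S.SolvesWith (fun z t => S.A z *ᵥ x z t) S.q1 ξ₀ x₀ u ξ x

/-- The exponents `αᵢ(z) = ∫₀ᶻ Aᵢᵢ / λᵢ`. -/
noncomputable def alpha (i : Fin 2) (z : ℝ) : ℝ :=
  ∫ ζ in (0 : ℝ)..z, S.A ζ i i / S.lam i ζ

/-- The exponential scaling matrix. -/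
noncomputable def E (z : ℝ) : Matrix (Fin 2) (Fin 2) ℝ :=
  !![Real.exp (S.alpha 0 z), 0; 0, Real.exp (-S.alpha 1 z)]

/-- The coupling matrix after the exponential scaling. -/
noncomputable def Atilde (z : ℝ) : Matrix (Fin 2) (Fin 2) ℝ :=
  !![0, S.A z 0 1 * Real.exp (S.alpha 0 z + S.alpha 1 z);
    S.A z 1 0 * Real.exp (-S.alpha 0 z - S.alpha 1 z), 0]

/-- `K` is a continuous solution of the kernel equations
`Λ(z) ∂_z K(z,ζ) + ∂_ζ (K(z,ζ) Λ(ζ)) = K(z,ζ) Ã(ζ)` on the triangle `0 ≤ ζ ≤ z ≤ 1` with their four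
boundary conditions. As `K` is only continuous, the PDE is meant in the sense of the method of
characteristics: for `N = Kᵢⱼ(z,ζ) Λⱼⱼ(ζ)` it reads
`Λᵢᵢ(z) ∂_z N + Λⱼⱼ(ζ) ∂_ζ N = Λⱼⱼ(ζ) (K Ã)ᵢⱼ`, and the left-hand side is the derivative of `N` along the
curves `(p, r)` with `p' = Λᵢᵢ(p)`, `r' = Λⱼⱼ(r)`. -/
structure IsKernel (K : ℝ → ℝ → Matrix (Fin 2) (Fin 2) ℝ) : Prop where
  cont : ∀ i j, ContinuousOn (fun y : ℝ × ℝ => K y.1 y.2 i j)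
    {y : ℝ × ℝ | 0 ≤ y.2 ∧ y.2 ≤ y.1 ∧ y.1 ≤ 1}
  pde : ∀ (i j : Fin 2) (a b : ℝ) (p r : ℝ → ℝ), a ≤ b →
    (∀ s ∈ Icc a b, (0 ≤ r s ∧ r s ≤ p s ∧ p s ≤ 1) ∧
      HasDerivWithinAt p (S.Lam (p s) i i) (Icc a b) s ∧
      HasDerivWithinAt r (S.Lam (r s) j j) (Icc a b) s) →
    ∀ s ∈ Icc a b, HasDerivWithinAt (fun s => K (p s) (r s) i j * S.Lam (r s) j j)
      (S.Lam (r s) j j * (K (p s) (r s) * S.Atilde (r s)) i j) (Icc a b) s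
  bc11 : ∀ z ∈ Icc (0 : ℝ) 1, K z 0 0 0 = S.q0 * S.lam 1 0 / S.lam 0 0 * K z 0 0 1
  bc12 : ∀ z ∈ Icc (0 : ℝ) 1, K z z 0 1 = -S.Atilde z 0 1 / (S.lam 0 z + S.lam 1 z)
  bc21 : ∀ z ∈ Icc (0 : ℝ) 1, K z z 1 0 = S.Atilde z 1 0 / (S.lam 0 z + S.lam 1 z)
  bc22 : ∀ z ∈ Icc (0 : ℝ) 1, K z 0 1 1 = S.lam 0 0 / (S.q0 * S.lam 1 0) * K z 0 1 0

/-- The state transformation: the scaling `w̃ = E w` followed by the Volterra transformation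
`w̃(z) - ∫₀ᶻ K(z,ζ) w̃(ζ) dζ`. -/
noncomputable def transform (K : ℝ → ℝ → Matrix (Fin 2) (Fin 2) ℝ) (w : ℝ → Fin 2 → ℝ) (z : ℝ) :
    Fin 2 → ℝ :=
  S.E z *ᵥ w z - ∫ ζ in (0 : ℝ)..z, K z ζ *ᵥ (S.E ζ *ᵥ w ζ)

/-- The reflection coefficient `q̄₁` of the transport form. -/
noncomputable def q1bar : ℝ := S.q1 * Real.exp (S.alpha 0 1 + S.alpha 1 1)

/-- The new input `ū(t) = e^{α₁(1)} u(t) + ∫₀¹ (q̄₁ e₂ᵀ - e₁ᵀ) K(1,z) E(z) x(z,t) dz`. -/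
noncomputable def newInput (K : ℝ → ℝ → Matrix (Fin 2) (Fin 2) ℝ) (u : ℝ → ℝ)
    (x : ℝ → ℝ → Fin 2 → ℝ) (t : ℝ) : ℝ :=
  Real.exp (S.alpha 0 1) * u t +
    ∫ z in (0 : ℝ)..1, (![-1, S.q1bar] : Fin 2 → ℝ) ⬝ᵥ (K 1 z *ᵥ (S.E z *ᵥ x z t))

/-- The matrix `C(z) = K(z,0) Λ(0) e₂ cᵀ`. -/
def Cmat (K : ℝ → ℝ → Matrix (Fin 2) (Fin 2) ℝ) (z : ℝ) : Matrix (Fin 2) (Fin n) ℝ :=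
  K z 0 * S.Lam 0 * Matrix.vecMulVec ![0, 1] S.c

/-- Solutions of the transport form, with the PDE `∂ₜ x̄ = Λ ∂_z x̄ + C ξ` and the boundary condition
`x̄₁(1,t) = q̄₁ x̄₂(1,t) + ū(t)`. -/
def IsTransportSolution (K : ℝ → ℝ → Matrix (Fin 2) (Fin 2) ℝ) (ξ₀ : Fin n → ℝ)
    (xb₀ : ℝ → Fin 2 → ℝ) (ub : ℝ → ℝ) (ξ : ℝ → Fin n → ℝ) (xb : ℝ → ℝ → Fin 2 → ℝ) : Prop :=
  S.SolvesWith (fun z t => S.Cmat K z *ᵥ ξ t) S.q1bar ξ₀ xb₀ ub ξ xb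

/-- The initial state, input and trajectory `(xb₀, ub, xb)` are the transforms of `(x₀, u, x)`. -/
def Corresponds (K : ℝ → ℝ → Matrix (Fin 2) (Fin 2) ℝ)
    (x₀ : ℝ → Fin 2 → ℝ) (u : ℝ → ℝ) (x : ℝ → ℝ → Fin 2 → ℝ)
    (xb₀ : ℝ → Fin 2 → ℝ) (ub : ℝ → ℝ) (xb : ℝ → ℝ → Fin 2 → ℝ) : Prop :=
  (∀ z ∈ Icc (0 : ℝ) 1, xb₀ z = S.transform K x₀ z) ∧
  (∀ t : ℝ, 0 < t → ub t = S.newInput K u x t) ∧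
  (∀ z ∈ Icc (0 : ℝ) 1, ∀ t : ℝ, 0 ≤ t → xb z t = S.transform K (fun ζ => x ζ t) z)

end PDEODESystem

/-!
The scaling `y = E x` is an integrating factor: along the characteristics it removes the diagonal of
the coupling, so `y` is transported with the source `Ã y`. When `z` moves along a characteristic,
`∫₀ᶻ K(z, ζ) y(ζ, t) dζ` changes by the flux of `K y` through both ends of the interval and by the
change of `K y` along the characteristics of `y`. Without derivatives this balance is obtained by
labelling the characteristics: each label carries a value whose increments are integrals, and one
integrates over the labels that are present. The kernel equation and the diagonal values of `K`
cancel everything but the flux `K(z, 0) Λ(0) y(0, t)` at the origin, which its values at `ζ = 0`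
turn into `C(z) ξ(t)`.

A Volterra operator is a contraction in a norm with weight `exp (μ z)`, so the transformation is
invertible. If `y - ∫ K y` is transported with the source `K(z, 0) Λ(0) y(0, t)`, compare `y` with
the function `w` that is transported with the source `Ã y` from the same data. For `e = w - y` the
boundary source vanishes, and `e - ∫ K e` is transported with a source that is linear in `e`. As the
characteristics of both families can be followed to their data inside the region below one
characteristic of the first family, a contraction with the same weight gives `e = 0`.

The two entries of a row of `K` solve a Goursat problem: in travel-time coordinates the curves of
the kernel equation are straight; the diagonal entry starts at `ζ = 0` and the other one on the
diagonal. Eliminating the latter leaves a fixed point problem for the former, again contracting in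
an exponentially weighted norm.
-/

theorem intervalIntegrable_of_measurable_of_abs_le {f : ℝ → ℝ} {a b B : ℝ} (hf : Measurable f)
    (hB : ∀ x ∈ uIcc a b, |f x| ≤ B) : IntervalIntegrable f volume a b := by
  rw [intervalIntegrable_iff]
  refine Measure.integrableOn_of_bounded (M := B) (by simp) hf.aestronglyMeasurable ?_
  filter_upwards [ae_restrict_mem measurableSet_uIoc] with x hx
  exact hB x (uIoc_subset_uIcc hx)

theorem measurable_intervalIntegral_param {α : Type*} [MeasurableSpace α] {f : α → ℝ → ℝ}
    (hf : Measurable (Function.uncurry f)) {l u : α → ℝ} (hl : Measurable l) (hu : Measurable u) :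
    Measurable fun x => ∫ ζ in l x..u x, f x ζ := by
  have hIoc : ∀ {l u : α → ℝ}, Measurable l → Measurable u →
      Measurable fun x => ∫ ζ in Ioc (l x) (u x), f x ζ := by
    intro l u hl hu
    have hs : MeasurableSet {p : α × ℝ | l p.1 < p.2 ∧ p.2 ≤ u p.1} :=
      (measurableSet_lt (hl.comp measurable_fst) measurable_snd).inter
        (measurableSet_le measurable_snd (hu.comp measurable_fst))
    have hindicator : ∀ x, ∫ ζ in Ioc (l x) (u x), f x ζ
        = ∫ ζ, ({p : α × ℝ | l p.1 < p.2 ∧ p.2 ≤ u p.1}.indicator (Function.uncurry f)) (x, ζ) :=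
      fun x => (integral_indicator measurableSet_Ioc).symm
    simp_rw [hindicator]
    exact ((hf.indicator hs).stronglyMeasurable.integral_prod_right').measurable
  simp only [intervalIntegral]
  exact (hIoc hl hu).sub (hIoc hu hl)

theorem continuous_intervalIntegral_param {α : Type*} [TopologicalSpace α]
    [FirstCountableTopology α] {f : α → ℝ → ℝ} (hf : Continuous (Function.uncurry f)) {l u : α → ℝ}
    (hl : Continuous l) (hu : Continuous u) : Continuous fun x => ∫ t in l x..u x, f x t := by
  have hzero : ∀ {u : α → ℝ}, Continuous u → Continuous fun x => ∫ t in (0 : ℝ)..u x, f x t :=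
    fun hu => intervalIntegral.continuous_parametric_intervalIntegral_of_continuous hf hu
  have hint : ∀ x a b, IntervalIntegrable (f x) volume a b := fun x a b =>
    (hf.comp (Continuous.prodMk_right x)).intervalIntegrable a b
  refine ((hzero hu).sub (hzero hl)).congr fun x => ?_
  exact intervalIntegral.integral_interval_sub_left (hint x _ _) (hint x _ _)

theorem mul_sub_mul_eq_integral {U V u v : ℝ → ℝ} {a b : ℝ} (hab : a ≤ b)
    (hu : IntervalIntegrable u volume a b) (hv : IntervalIntegrable v volume a b)
    (hU : ∀ s ∈ Icc a b, U s - U a = ∫ t in a..s, u t)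
    (hV : ∀ s ∈ Icc a b, V s - V a = ∫ t in a..s, v t) :
    U b * V b - U a * V a = ∫ s in a..b, (u s * V s + U s * v s) := by
  have ac : ∀ {u : ℝ → ℝ} (c : ℝ), IntervalIntegrable u volume a b →
      AbsolutelyContinuousOnInterval (fun s => c + ∫ t in a..s, u t) a b := fun c hu =>
    (LipschitzWith.const c).lipschitzOnWith.absolutelyContinuousOnInterval.add
      (hu.absolutelyContinuousOnInterval_intervalIntegral (c := a) left_mem_uIcc)
  have hUeq : ∀ s ∈ Icc a b, U a + ∫ t in a..s, u t = U s := fun s hs => by linarith [hU s hs]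
  have hVeq : ∀ s ∈ Icc a b, V a + ∫ t in a..s, v t = V s := fun s hs => by linarith [hV s hs]
  have hparts := (ac (U a) hu).integral_deriv_mul_eq_sub (ac (V a) hv)
  simp only [hUeq b (right_mem_Icc.2 hab), hVeq b (right_mem_Icc.2 hab),
    hUeq a (left_mem_Icc.2 hab), hVeq a (left_mem_Icc.2 hab)] at hparts
  rw [← hparts]
  refine intervalIntegral.integral_congr_ae ?_
  filter_upwards [hu.ae_hasDerivAt_integral, hv.ae_hasDerivAt_integral] with s hus hvs hs
  have hs' := uIoc_subset_uIcc hs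
  rw [((hus hs' a left_mem_uIcc).const_add (U a)).deriv,
    ((hvs hs' a left_mem_uIcc).const_add (V a)).deriv]
  rw [uIcc_of_le hab] at hs'
  rw [hUeq s hs', hVeq s hs']

theorem integral_mul_comp_of_deriv_nonneg {m m' : ℝ → ℝ} {a b : ℝ} (hab : a ≤ b)
    (hm : ContinuousOn m (Icc a b)) (hd : ∀ s ∈ Ioo a b, HasDerivAt m (m' s) s)
    (hm' : ∀ s ∈ Ioo a b, 0 ≤ m' s) (hmab : m a ≤ m b) (G : ℝ → ℝ) :
    ∫ s in a..b, m' s * G (m s) = ∫ η in m a..m b, G η := by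
  rw [intervalIntegral.integral_of_le hab, intervalIntegral.integral_of_le hmab,
    ← integral_Icc_eq_integral_Ioc, ← integral_Icc_eq_integral_Ioc]
  simpa only [smul_eq_mul] using integral_Icc_deriv_smul_of_deriv_nonneg (g := G) hm hd hm' hab

theorem deriv_eq_zero_of_monotoneOn_of_eq {m : ℝ → ℝ} {a b s s' d : ℝ} (hm : MonotoneOn m (Icc a b))
    (hs' : s' ∈ Icc a b) (hs : s ∈ Icc a b) (hlt : s' < s) (heq : m s' = m s)
    (hd : HasDerivAt m d s) : d = 0 := by
  have hconst : ∀ x ∈ Icc s' s, m x = m s := fun x hx => by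
    have hx' : x ∈ Icc a b := ⟨hs'.1.trans hx.1, hx.2.trans hs.2⟩
    exact le_antisymm (hm hx' hs hx.2) (heq ▸ hm hs' hx' hx.1)
  have hflat : HasDerivWithinAt m 0 (Icc s' s) s :=
    (hasDerivWithinAt_const s (Icc s' s) (m s)).congr hconst rfl
  exact (uniqueDiffOn_Icc hlt s (right_mem_Icc.2 hlt.le)).eq_deriv _ hd.hasDerivWithinAt hflat

theorem abs_integral_le_exp {q : ℝ → ℝ} {C μ y z : ℝ} (hyz : y ≤ z) (hμ : 0 < μ) (hC : 0 ≤ C)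
    (hq : ∀ ζ ∈ Icc y z, |q ζ| ≤ C * Real.exp (μ * ζ)) :
    |∫ ζ in y..z, q ζ| ≤ C / μ * Real.exp (μ * z) := by
  have hexp : Continuous fun ζ => C * Real.exp (μ * ζ) := by fun_prop
  have hint : ∫ ζ in y..z, C * Real.exp (μ * ζ)
      = C / μ * Real.exp (μ * z) - C / μ * Real.exp (μ * y) := by
    rw [intervalIntegral.integral_const_mul, intervalIntegral.integral_comp_mul_left _ hμ.ne',
      integral_exp, smul_eq_mul]
    ring
  refine (intervalIntegral.norm_integral_le_of_norm_le (f := q) (μ := volume) hyz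
    (Filter.Eventually.of_forall fun ζ hζ => hq ζ (Ioc_subset_Icc_self hζ))
    (hexp.intervalIntegrable _ _)).trans ?_
  exact hint.trans_le (sub_le_self _ (by positivity))

section WeightedContraction

variable {α E : Type*} [NormedAddCommGroup E] {w : α → ℝ}

theorem exists_norm_sub_le_of_geometric [CompleteSpace E] {F : ℕ → α → E} {M : ℝ}
    (hF : ∀ n x, ‖F (n + 1) x - F n x‖ ≤ M * (1 / 2) ^ n * w x) :
    ∃ f : α → E, ∀ n x, ‖F n x - f x‖ ≤ 2 * M * (1 / 2) ^ n * w x := by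
  have hdist : ∀ x n, dist (F n x) (F (n + 1) x) ≤ M * w x * (1 / 2) ^ n := fun x n => by
    rw [dist_comm, dist_eq_norm]
    exact (hF n x).trans_eq (by ring)
  choose f hf using fun x => cauchySeq_tendsto_of_complete
    (cauchySeq_of_le_geometric (1 / 2 : ℝ) _ (by norm_num) (hdist x))
  refine ⟨f, fun n x => ?_⟩
  rw [← dist_eq_norm]
  refine (dist_le_of_le_geometric_of_tendsto (1 / 2 : ℝ) _ (by norm_num) (hdist x) (hf x)
    n).trans_eq ?_
  ring

theorem eq_of_norm_sub_le_geometric {u v : E} {C : ℝ}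
    (h : ∀ n : ℕ, ‖u - v‖ ≤ C * (1 / 2) ^ n) : u = v := by
  have hlim : Filter.Tendsto (fun n : ℕ => C * (1 / 2 : ℝ) ^ n) Filter.atTop (nhds 0) := by
    simpa only [mul_zero] using (tendsto_pow_atTop_nhds_zero_of_lt_one (r := (1 / 2 : ℝ))
      (by norm_num) (by norm_num)).const_mul C
  exact sub_eq_zero.1 (norm_le_zero_iff.1 (ge_of_tendsto' hlim h))

theorem exists_fixedPoint_of_weighted_contraction [CompleteSpace E] {P : (α → E) → Prop}
    {Φ : (α → E) → α → E} {f₀ : α → E} {M : ℝ} (hM : 0 ≤ M) (hf₀ : P f₀)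
    (hPΦ : ∀ f, P f → P (Φ f)) (hf₀M : ∀ x, ‖Φ f₀ x - f₀ x‖ ≤ M * w x)
    (hΦ : ∀ f h, P f → P h → ∀ B, 0 ≤ B → (∀ x, ‖f x - h x‖ ≤ B * w x) →
      ∀ x, ‖Φ f x - Φ h x‖ ≤ B / 2 * w x)
    (hlim : ∀ (F : ℕ → α → E) (f : α → E) (B : ℝ), (∀ n, P (F n)) →
      (∀ n x, ‖F n x - f x‖ ≤ B * (1 / 2) ^ n * w x) → P f) :
    ∃ f, P f ∧ ∀ x, f x = Φ f x := by
  let F : ℕ → α → E := fun n => Φ^[n] f₀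
  have hsucc : ∀ n, F (n + 1) = Φ (F n) := fun n => Function.iterate_succ_apply' Φ n f₀
  have hFP : ∀ n, P (F n) := fun n => by
    induction n with
    | zero => exact hf₀
    | succ n ih => exact hsucc n ▸ hPΦ _ ih
  have hstep : ∀ n x, ‖F (n + 1) x - F n x‖ ≤ M * (1 / 2) ^ n * w x := fun n => by
    induction n with
    | zero => simpa [hsucc, F] using hf₀M
    | succ n ih =>
      intro x
      have := hΦ _ _ (hFP (n + 1)) (hFP n) _ (by positivity) ih x
      rw [hsucc (n + 1), hsucc n] at *
      exact this.trans_eq (by ring)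
  obtain ⟨f, hf⟩ := exists_norm_sub_le_of_geometric hstep
  have hPf : P f := hlim F f _ hFP hf
  refine ⟨f, hPf, fun x => eq_of_norm_sub_le_geometric (C := 2 * M * w x) fun n => ?_⟩
  have hclose := hf (n + 1) x
  have himage := hΦ _ _ (hFP n) hPf _ (by positivity) (hf n) x
  rw [← hsucc n] at himage
  calc ‖f x - Φ f x‖ ≤ ‖F (n + 1) x - f x‖ + ‖F (n + 1) x - Φ f x‖ := by
        rw [norm_sub_rev (F (n + 1) x) (f x)]; exact norm_sub_le_norm_sub_add_norm_sub _ _ _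
    _ ≤ 2 * M * (1 / 2) ^ (n + 1) * w x + 2 * M * (1 / 2) ^ n / 2 * w x := add_le_add hclose himage
    _ = 2 * M * w x * (1 / 2) ^ n := by ring

theorem norm_le_two_mul_of_contraction {D : Set α} {f : α → E} {M B : ℝ} (hM : 0 ≤ M)
    (hB : 0 ≤ B) (hw : ∀ x ∈ D, 0 ≤ w x) (hfB : ∀ x ∈ D, ‖f x‖ ≤ B * w x)
    (hstep : ∀ B, 0 ≤ B → (∀ x ∈ D, ‖f x‖ ≤ B * w x) → ∀ x ∈ D, ‖f x‖ ≤ (M + B / 2) * w x) :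
    ∀ x ∈ D, ‖f x‖ ≤ 2 * M * w x := by
  have hiterate : ∀ n : ℕ, ∀ x ∈ D, ‖f x‖ ≤ (2 * M + B * (1 / 2) ^ n) * w x := fun n => by
    induction n with
    | zero =>
      intro x hx
      refine (hfB x hx).trans (mul_le_mul_of_nonneg_right ?_ (hw x hx))
      linarith
    | succ n ih => exact fun x hx => (hstep _ (by positivity) ih x hx).trans_eq (by ring)
  intro x hx
  have hlim : Filter.Tendsto (fun n : ℕ => (2 * M + B * (1 / 2 : ℝ) ^ n) * w x) Filter.atTop
      (nhds ((2 * M + B * 0) * w x)) :=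
    (((tendsto_pow_atTop_nhds_zero_of_lt_one (by norm_num) (by norm_num)).const_mul _).const_add
      _).mul_const _
  rw [mul_zero, add_zero] at hlim
  exact ge_of_tendsto' hlim fun n => hiterate n x hx

end WeightedContraction

/-! ### Coefficients and signals -/

/-- Bounded continuous real functions, unbundled. Coefficients and kernels are extended to such
functions on the whole line or plane by retraction. -/
def IsBddCont {α : Type*} [TopologicalSpace α] (f : α → ℝ) : Prop :=
  Continuous f ∧ ∃ M, ∀ x, |f x| ≤ M

section IsBddCont

variable {α β ι : Type*} [TopologicalSpace α] [TopologicalSpace β] {f g : α → ℝ}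

theorem isBddCont_comp_of_isCompact {s : Set β} {h : β → ℝ} (hs : IsCompact s)
    (hh : ContinuousOn h s) {r : α → β} (hr : Continuous r) (hrs : ∀ x, r x ∈ s) :
    IsBddCont fun x => h (r x) := by
  obtain ⟨M, hM⟩ := hs.exists_bound_of_continuousOn hh
  exact ⟨hh.comp_continuous hr hrs, M, fun x => hM _ (hrs x)⟩

theorem IsBddCont.comp (hf : IsBddCont f) {r : β → α} (hr : Continuous r) :
    IsBddCont fun x => f (r x) :=
  ⟨hf.1.comp hr, hf.2.imp fun _ hM x => hM (r x)⟩

theorem IsBddCont.mul (hf : IsBddCont f) (hg : IsBddCont g) : IsBddCont fun x => f x * g x := by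
  obtain ⟨M, hM⟩ := hf.2
  obtain ⟨N, hN⟩ := hg.2
  refine ⟨hf.1.mul hg.1, M * N, fun x => ?_⟩
  rw [abs_mul]
  exact mul_le_mul (hM x) (hN x) (abs_nonneg _) ((abs_nonneg _).trans (hM x))

theorem IsBddCont.add (hf : IsBddCont f) (hg : IsBddCont g) : IsBddCont fun x => f x + g x := by
  obtain ⟨M, hM⟩ := hf.2
  obtain ⟨N, hN⟩ := hg.2
  exact ⟨hf.1.add hg.1, M + N, fun x => (abs_add_le _ _).trans (add_le_add (hM x) (hN x))⟩

theorem exists_forall_abs_le_of_isBddCont [Finite ι] {f : ι → α → ℝ} (hf : ∀ i, IsBddCont (f i)) :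
    ∃ M, 0 ≤ M ∧ ∀ i x, |f i x| ≤ M := by
  choose M hM using fun i => (hf i).2
  obtain ⟨N, hN⟩ := (Set.finite_range M).bddAbove
  exact ⟨max N 0, le_max_right _ _, fun i x =>
    ((hM i x).trans (hN (mem_range_self i))).trans (le_max_left _ _)⟩

end IsBddCont

/-- The retraction of the real line onto the unit interval. -/
noncomputable def unitClamp (z : ℝ) : ℝ := projIcc (0 : ℝ) 1 zero_le_one z

theorem unitClamp_mem (z : ℝ) : unitClamp z ∈ Icc (0 : ℝ) 1 := Subtype.coe_prop _

theorem unitClamp_of_mem {z : ℝ} (hz : z ∈ Icc (0 : ℝ) 1) : unitClamp z = z := by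
  rw [unitClamp, projIcc_of_mem zero_le_one hz]

theorem continuous_unitClamp : Continuous unitClamp :=
  continuous_subtype_val.comp continuous_projIcc

theorem isBddCont_comp_unitClamp {f : ℝ → ℝ} (hf : ContinuousOn f (Icc 0 1)) :
    IsBddCont fun z => f (unitClamp z) :=
  isBddCont_comp_of_isCompact isCompact_Icc hf continuous_unitClamp unitClamp_mem

/-- The triangle `0 ≤ ζ ≤ z ≤ 1` on which the kernel lives; the points are `(z, ζ)`. -/
def triangle : Set (ℝ × ℝ) := {p | 0 ≤ p.2 ∧ p.2 ≤ p.1 ∧ p.1 ≤ 1}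

theorem isCompact_triangle : IsCompact triangle := by
  refine (isCompact_Icc (a := ((0 : ℝ), (0 : ℝ))) (b := (1, 1))).of_isClosed_subset ?_ ?_
  · exact (isClosed_le continuous_const continuous_snd).inter
      ((isClosed_le continuous_snd continuous_fst).inter
        (isClosed_le continuous_fst continuous_const))
  · exact fun p hp => ⟨⟨hp.1.trans hp.2.1, hp.1⟩, hp.2.2, hp.2.1.trans hp.2.2⟩

/-- The retraction of the plane onto the triangle. -/
noncomputable def triangleClamp (p : ℝ × ℝ) : ℝ × ℝ :=
  (unitClamp p.1, max 0 (min p.2 (unitClamp p.1)))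

theorem continuous_triangleClamp : Continuous triangleClamp := by
  have := continuous_unitClamp
  unfold triangleClamp
  fun_prop

theorem triangleClamp_mem (p : ℝ × ℝ) : triangleClamp p ∈ triangle :=
  ⟨le_max_left _ _, max_le (unitClamp_mem _).1 (min_le_right _ _), (unitClamp_mem _).2⟩

theorem triangleClamp_of_mem {p : ℝ × ℝ} (hp : p ∈ triangle) : triangleClamp p = p := by
  rw [triangleClamp, unitClamp_of_mem ⟨hp.1.trans hp.2.1, hp.2.2⟩, min_eq_left hp.2.1,
    max_eq_right hp.1]

/-- Measurable functions `f z t` of a position and a time that are bounded on bounded time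
intervals, uniformly in the position. Both signs of the time are treated alike, so that the class is
invariant under time reversal. -/
def IsSignal (f : ℝ → ℝ → ℝ) : Prop :=
  Measurable (Function.uncurry f) ∧ ∀ T : ℝ, ∃ M : ℝ, ∀ z t, |t| ≤ T → |f z t| ≤ M

namespace IsSignal

variable {ι : Type*} {f g : ℝ → ℝ → ℝ}

theorem of_isBddCont_uncurry {k : ℝ → ℝ → ℝ} (hk : IsBddCont (Function.uncurry k)) : IsSignal k :=
  ⟨hk.1.measurable, fun _ => hk.2.imp fun _ hM z t _ => hM (z, t)⟩

theorem of_isBddCont {k : ℝ → ℝ} (hk : IsBddCont k) : IsSignal fun z _ => k z :=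
  of_isBddCont_uncurry (hk.comp continuous_fst)

theorem of_continuous {q : ℝ → ℝ} (hq : Continuous q) : IsSignal fun _ t => q t := by
  refine ⟨hq.measurable.comp measurable_snd, fun T => ?_⟩
  obtain ⟨M, hM⟩ := (isCompact_Icc (a := -T) (b := T)).exists_bound_of_continuousOn hq.continuousOn
  exact ⟨M, fun _ t ht => hM t (abs_le.1 ht)⟩

theorem add (hf : IsSignal f) (hg : IsSignal g) : IsSignal fun z t => f z t + g z t := by
  refine ⟨hf.1.add hg.1, fun T => ?_⟩
  obtain ⟨M, hM⟩ := hf.2 T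
  obtain ⟨N, hN⟩ := hg.2 T
  exact ⟨M + N, fun z t ht => (abs_add_le _ _).trans (add_le_add (hM z t ht) (hN z t ht))⟩

theorem mul (hf : IsSignal f) (hg : IsSignal g) : IsSignal fun z t => f z t * g z t := by
  refine ⟨hf.1.mul hg.1, fun T => ?_⟩
  obtain ⟨M, hM⟩ := hf.2 T
  obtain ⟨N, hN⟩ := hg.2 T
  refine ⟨M * N, fun z t ht => ?_⟩
  rw [abs_mul]
  exact mul_le_mul (hM z t ht) (hN z t ht) (abs_nonneg _) ((abs_nonneg _).trans (hM z t ht))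

theorem isBddCont_mul {k : ℝ → ℝ} (hk : IsBddCont k) (hf : IsSignal f) :
    IsSignal fun z t => k z * f z t :=
  (of_isBddCont hk).mul hf

theorem const_mul (c : ℝ) (hf : IsSignal f) : IsSignal fun z t => c * f z t :=
  (of_continuous continuous_const).mul hf

theorem sub (hf : IsSignal f) (hg : IsSignal g) : IsSignal fun z t => f z t - g z t := by
  simpa only [neg_one_mul, sub_eq_add_neg] using hf.add (hg.const_mul (-1))

theorem sum [Fintype ι] {f : ι → ℝ → ℝ → ℝ} (hf : ∀ i, IsSignal (f i)) :
    IsSignal fun z t => ∑ i, f i z t := by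
  refine ⟨Finset.measurable_sum _ fun i _ => (hf i).1, fun T => ?_⟩
  choose M hM using fun i => (hf i).2 T
  exact ⟨∑ i, M i, fun z t ht =>
    (Finset.abs_sum_le_sum_abs _ _).trans (Finset.sum_le_sum fun i _ => hM i z t ht)⟩

theorem comp (hf : IsSignal f) {p : ℝ → ℝ → ℝ} (hp : Measurable (Function.uncurry p)) :
    IsSignal fun z t => f (p z t) t :=
  ⟨hf.1.comp (hp.prodMk measurable_snd), fun T => (hf.2 T).imp fun _ hM _ t ht => hM _ t ht⟩

theorem comp_neg (hf : IsSignal f) : IsSignal fun z t => f z (-t) :=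
  ⟨hf.1.comp (measurable_fst.prodMk measurable_snd.neg),
    fun T => (hf.2 T).imp fun _ hM z t ht => hM z (-t) (by rwa [abs_neg])⟩

theorem intervalIntegrable (hf : IsSignal f) {p q : ℝ → ℝ} (hp : Measurable p) (hq : Continuous q)
    (a b : ℝ) : IntervalIntegrable (fun s => f (p s) (q s)) volume a b := by
  obtain ⟨T, hT⟩ := isCompact_uIcc.exists_bound_of_continuousOn (hq.continuousOn (s := uIcc a b))
  obtain ⟨M, hM⟩ := hf.2 T
  exact intervalIntegrable_of_measurable_of_abs_le (hf.1.comp (hp.prodMk hq.measurable))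
    fun s hs => hM _ _ (hT s hs)

theorem intervalIntegral {k : ℝ → ℝ → ℝ} (hk : IsBddCont (Function.uncurry k)) (hf : IsSignal f) :
    IsSignal fun z t => ∫ ζ in (0 : ℝ)..unitClamp z, k z ζ * f ζ t := by
  constructor
  · refine measurable_intervalIntegral_param (f := fun p ζ => k p.1 ζ * f ζ p.2) ?_
      measurable_const (continuous_unitClamp.measurable.comp measurable_fst)
    exact (hk.1.measurable.comp ((measurable_fst.comp measurable_fst).prodMk measurable_snd)).mul
      (hf.1.comp (measurable_snd.prodMk (measurable_snd.comp measurable_fst)))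
  · intro T
    obtain ⟨M, hM⟩ := hk.2
    obtain ⟨N, hN⟩ := hf.2 T
    refine ⟨M * N, fun z t ht => ?_⟩
    have hbound : ∀ ζ, ‖k z ζ * f ζ t‖ ≤ M * N := fun ζ => by
      rw [norm_mul]
      exact mul_le_mul (hM (z, ζ)) (hN ζ t ht) (abs_nonneg _) ((abs_nonneg _).trans (hM (z, ζ)))
    refine (intervalIntegral.norm_integral_le_of_norm_le_const fun ζ _ => hbound ζ).trans ?_
    rw [sub_zero, abs_of_nonneg (unitClamp_mem z).1]
    exact mul_le_of_le_one_right ((norm_nonneg _).trans (hbound 0)) (unitClamp_mem z).2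

end IsSignal

/-- The extension of a trajectory from `[0, 1] × [0, ∞)` to the plane by retraction, with the
component as first argument. -/
noncomputable def extendTrajectory (x : ℝ → ℝ → Fin 2 → ℝ) (i : Fin 2) (z t : ℝ) : ℝ :=
  x (unitClamp z) (max 0 t) i

theorem extendTrajectory_of_mem (x : ℝ → ℝ → Fin 2 → ℝ) (i : Fin 2) {z t : ℝ}
    (hz : z ∈ Icc (0 : ℝ) 1) (ht : 0 ≤ t) : extendTrajectory x i z t = x z t i := by
  rw [extendTrajectory, unitClamp_of_mem hz, max_eq_right ht]

theorem IsStateTrajectory.isSignal {x : ℝ → ℝ → Fin 2 → ℝ} (hx : IsStateTrajectory x) (i : Fin 2) :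
    IsSignal (extendTrajectory x i) := by
  constructor
  · have hclamp : Measurable fun p : ℝ × ℝ =>
        (⟨(unitClamp p.1, max 0 p.2), unitClamp_mem _, mem_Ici.2 (le_max_left _ _)⟩ :
          (Icc (0 : ℝ) 1 ×ˢ Ici (0 : ℝ) : Set (ℝ × ℝ))) :=
      ((continuous_unitClamp.comp continuous_fst).prodMk
        (continuous_const.max continuous_snd)).measurable.subtype_mk
    exact (measurable_pi_apply i).comp (hx.1.comp hclamp)
  · intro T
    obtain ⟨M, hM⟩ := hx.2 (max 0 T)
    refine ⟨M, fun z t ht => (norm_le_pi_norm _ i).trans (hM _ (unitClamp_mem z) _ ?_)⟩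
    exact ⟨le_max_left _ _, max_le_max le_rfl ((le_abs_self t).trans ht)⟩

theorem isStateTrajectory_of_isSignal {y : Fin 2 → ℝ → ℝ → ℝ} (hy : ∀ i, IsSignal (y i))
    {x : ℝ → ℝ → Fin 2 → ℝ} (hxy : ∀ z ∈ Icc (0 : ℝ) 1, ∀ t, 0 ≤ t → ∀ i, x z t i = y i z t) :
    IsStateTrajectory x := by
  constructor
  · refine measurable_pi_iff.2 fun i => ?_
    have heq : (fun p : (Icc (0 : ℝ) 1 ×ˢ Ici (0 : ℝ) : Set (ℝ × ℝ)) =>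
        (Icc (0 : ℝ) 1 ×ˢ Ici (0 : ℝ)).domRestrict (fun p : ℝ × ℝ => x p.1 p.2) p i)
        = fun p => Function.uncurry (y i) p.1 :=
      funext fun p => hxy _ p.2.1 _ p.2.2 i
    rw [heq]
    exact (hy i).1.comp measurable_subtype_coe
  · intro T
    choose M hM using fun i => (hy i).2 T
    refine ⟨∑ i, |M i|, fun z hz t ht => (pi_norm_le_iff_of_nonneg ?_).2 fun i => ?_⟩
    · exact Finset.sum_nonneg fun i _ => abs_nonneg _
    · rw [hxy z hz t ht.1 i]
      exact ((hM i z t ((abs_of_nonneg ht.1).trans_le ht.2)).trans (le_abs_self _)).trans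
        (Finset.single_le_sum (f := fun i => |M i|) (fun _ _ => abs_nonneg _) (Finset.mem_univ i))

theorem IsState.isStateTrajectory {w : ℝ → Fin 2 → ℝ} (hw : IsState w) :
    IsStateTrajectory fun z _ => w z := by
  obtain ⟨M, hM⟩ := hw.2
  refine ⟨?_, fun T => ⟨M, fun z hz t _ => hM z hz⟩⟩
  have hproj : Measurable fun p : (Icc (0 : ℝ) 1 ×ˢ Ici (0 : ℝ) : Set (ℝ × ℝ)) =>
      (⟨p.1.1, p.2.1⟩ : Icc (0 : ℝ) 1) :=
    (measurable_fst.comp measurable_subtype_coe).subtype_mk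
  exact hw.1.comp hproj

theorem IsStateTrajectory.isState {x : ℝ → ℝ → Fin 2 → ℝ} (hx : IsStateTrajectory x) {t : ℝ}
    (ht : 0 ≤ t) : IsState fun z => x z t := by
  obtain ⟨M, hM⟩ := hx.2 t
  refine ⟨?_, M, fun z hz => hM z hz t ⟨ht, le_rfl⟩⟩
  have hslice : Measurable fun z : Icc (0 : ℝ) 1 =>
      (⟨(z.1, t), z.2, ht⟩ : (Icc (0 : ℝ) 1 ×ˢ Ici (0 : ℝ) : Set (ℝ × ℝ))) :=
    (measurable_subtype_coe.prodMk measurable_const).subtype_mk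
  exact hx.1.comp hslice

/-! ### Balance of a population of labels -/

theorem IsSignal.indicator {f : ℝ → ℝ → ℝ} (hf : IsSignal f) {R : Set (ℝ × ℝ)}
    (hR : MeasurableSet R) : IsSignal fun z t => R.indicator (Function.uncurry f) (z, t) := by
  refine ⟨hf.1.indicator hR, fun T => (hf.2 T).imp fun M hM z t ht => ?_⟩
  exact (norm_indicator_le_norm_self (Function.uncurry f) (z, t)).trans (hM z t ht)

theorem IsSignal.exists_forall_mem_uIcc_abs_le {f : ℝ → ℝ → ℝ} (hf : IsSignal f) (a b : ℝ) :
    ∃ M, ∀ z, ∀ t ∈ uIcc a b, |f z t| ≤ M := by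
  obtain ⟨M, hM⟩ := hf.2 (max |a| |b|)
  refine ⟨M, fun z t ht => hM z t ?_⟩
  rw [mem_uIcc] at ht
  exact ht.elim (fun h => abs_le_max_abs_abs h.1 h.2) fun h =>
    (abs_le_max_abs_abs h.1 h.2).trans_eq (max_comm _ _)

theorem IsSignal.intervalIntegrable_integral_time {f : ℝ → ℝ → ℝ} (hf : IsSignal f)
    (a b c d : ℝ) : IntervalIntegrable (fun z => ∫ t in a..b, f z t) volume c d := by
  obtain ⟨M, hM⟩ := hf.exists_forall_mem_uIcc_abs_le a b
  refine intervalIntegrable_of_measurable_of_abs_le (B := M * |b - a|)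
    (measurable_intervalIntegral_param hf.1 measurable_const measurable_const) fun z _ => ?_
  rw [← Real.norm_eq_abs]
  exact intervalIntegral.norm_integral_le_of_norm_le_const fun t ht =>
    hM z t (uIoc_subset_uIcc ht)

theorem IsSignal.intervalIntegrable_integral_space {f : ℝ → ℝ → ℝ} (hf : IsSignal f)
    (a b c d : ℝ) : IntervalIntegrable (fun t => ∫ z in a..b, f z t) volume c d := by
  obtain ⟨M, hM⟩ := hf.exists_forall_mem_uIcc_abs_le c d
  refine intervalIntegrable_of_measurable_of_abs_le (B := M * |b - a|)
    (measurable_intervalIntegral_param (f := fun t z => f z t) (hf.1.comp measurable_swap)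
      measurable_const measurable_const) fun t ht => ?_
  rw [← Real.norm_eq_abs]
  exact intervalIntegral.norm_integral_le_of_norm_le_const fun z _ => hM z t ht

theorem IsSignal.integral_integral_swap {f : ℝ → ℝ → ℝ} (hf : IsSignal f) (a b c d : ℝ) :
    ∫ t in c..d, ∫ z in a..b, f z t = ∫ z in a..b, ∫ t in c..d, f z t := by
  obtain ⟨M, hM⟩ := hf.exists_forall_mem_uIcc_abs_le c d
  refine intervalIntegral_intervalIntegral_swap (F := fun t z => f z t) ?_
  refine Measure.integrableOn_of_bounded (M := M) ?_
    (hf.1.comp measurable_swap).aestronglyMeasurable ?_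
  · rw [Measure.volume_eq_prod, Measure.prod_prod]
    exact (ENNReal.mul_lt_top (by simp [uIoc]) (by simp [uIoc])).ne
  · filter_upwards [ae_restrict_mem (measurableSet_uIoc.prod measurableSet_uIoc)] with p hp
    exact hM p.2 p.1 (uIoc_subset_uIcc hp.1)

/-- A population of labels occupying the interval `[s, m s]` at time `s ∈ [a, b]`: labels enter at
the upper end `m s`, which moves with velocity `m' s ≥ 0`, and leave at the lower end. The quantity
`F η s` carried by the label `η` changes at the rate `H η s` as long as the label is present. -/
structure IsLabelBalance (F H : ℝ → ℝ → ℝ) (m m' : ℝ → ℝ) (a b : ℝ) : Prop where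
  le : a ≤ b
  continuous_upper : Continuous m
  hasDerivAt_upper : ∀ s ∈ Ioo a b, HasDerivAt m (m' s) s
  deriv_nonneg : ∀ s ∈ Ioo a b, 0 ≤ m' s
  le_upper : ∀ s ∈ Icc a b, s ≤ m s
  isSignal : IsSignal F
  isSignal_rate : IsSignal H
  increment : ∀ η, ∀ s₁ ∈ Icc a b, ∀ s₂ ∈ Icc a b, s₁ ≤ s₂ → s₂ ≤ η → η ≤ m s₁ →
    F η s₂ - F η s₁ = ∫ s in s₁..s₂, H η s

namespace IsLabelBalance

/-- The rate `H`, set to zero where the label is absent. -/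
noncomputable def presentRate (H : ℝ → ℝ → ℝ) (m : ℝ → ℝ) (η s : ℝ) : ℝ :=
  {p : ℝ × ℝ | p.2 ≤ p.1 ∧ p.1 ≤ m p.2}.indicator (Function.uncurry H) (η, s)

/-- The last value carried by a label: when it leaves, or at the final time `b`. -/
noncomputable def exitValue (F : ℝ → ℝ → ℝ) (b η : ℝ) : ℝ := F η (min b η)

/-- The total change of the value carried by a label during `[a, b]`. -/
noncomputable def gain (H : ℝ → ℝ → ℝ) (m : ℝ → ℝ) (a b η : ℝ) : ℝ :=
  ∫ s in a..b, presentRate H m η s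

variable {F H : ℝ → ℝ → ℝ} {m m' : ℝ → ℝ} {a b : ℝ}

theorem presentRate_of_mem {η s : ℝ} (h₁ : s ≤ η) (h₂ : η ≤ m s) : presentRate H m η s = H η s :=
  indicator_of_mem (show (η, s) ∈ {p : ℝ × ℝ | p.2 ≤ p.1 ∧ p.1 ≤ m p.2} from ⟨h₁, h₂⟩) _

theorem presentRate_of_notMem {η s : ℝ} (h : ¬(s ≤ η ∧ η ≤ m s)) : presentRate H m η s = 0 :=
  indicator_of_notMem (show (η, s) ∉ {p : ℝ × ℝ | p.2 ≤ p.1 ∧ p.1 ≤ m p.2} from h) _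

theorem exitValue_of_le {s : ℝ} (hs : s ≤ b) : exitValue F b s = F s s := by
  rw [exitValue, min_eq_right hs]

section

variable (h : IsLabelBalance F H m m' a b)
include h

theorem isSignal_presentRate : IsSignal (presentRate H m) :=
  h.isSignal_rate.indicator ((measurableSet_le measurable_snd measurable_fst).inter
    (measurableSet_le measurable_fst (h.continuous_upper.measurable.comp measurable_snd)))

theorem intervalIntegrable_presentRate (η c d : ℝ) :
    IntervalIntegrable (presentRate H m η) volume c d :=
  h.isSignal_presentRate.intervalIntegrable measurable_const continuous_id c d

theorem intervalIntegrable_exitValue (c d : ℝ) :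
    IntervalIntegrable (exitValue F b) volume c d :=
  h.isSignal.intervalIntegrable measurable_id (continuous_const.min continuous_id) c d

theorem intervalIntegrable_gain (c d : ℝ) : IntervalIntegrable (gain H m a b) volume c d :=
  h.isSignal_presentRate.intervalIntegrable_integral_time a b c d

theorem monotoneOn_upper : MonotoneOn m (Icc a b) := by
  refine monotoneOn_of_deriv_nonneg (convex_Icc a b) h.continuous_upper.continuousOn ?_ ?_ <;>
    rw [interior_Icc]
  · exact fun s hs => (h.hasDerivAt_upper s hs).differentiableAt.differentiableWithinAt
  · exact fun s hs => (h.hasDerivAt_upper s hs).deriv ▸ h.deriv_nonneg s hs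

theorem upper_le_upper : m a ≤ m b :=
  h.monotoneOn_upper (left_mem_Icc.2 h.le) (right_mem_Icc.2 h.le) h.le

theorem eq_exitValue_sub_integral {η s : ℝ} (hs : s ∈ Icc a b) (hsη : s ≤ η) (hηm : η ≤ m s) :
    F η s = exitValue F b η - ∫ t in s..b, presentRate H m η t := by
  have hmem : min b η ∈ Icc a b := ⟨le_min h.le (hs.1.trans hsη), min_le_left _ _⟩
  have hpresent : ∫ t in s..min b η, presentRate H m η t = ∫ t in s..min b η, H η t := by
    refine intervalIntegral.integral_congr fun t ht => ?_
    rw [uIcc_of_le (le_min hs.2 hsη)] at ht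
    exact presentRate_of_mem (ht.2.trans (min_le_right _ _))
      (hηm.trans (h.monotoneOn_upper hs ⟨hs.1.trans ht.1, ht.2.trans (min_le_left _ _)⟩ ht.1))
  have habsent : ∫ t in min b η..b, presentRate H m η t = 0 := by
    refine intervalIntegral.integral_zero_ae (Filter.Eventually.of_forall fun t ht => ?_)
    rw [uIoc_of_le (min_le_left _ _)] at ht
    exact presentRate_of_notMem fun hp => absurd (le_min ht.2 hp.1) (not_le.2 ht.1)
  rw [← intervalIntegral.integral_add_adjacent_intervals (h.intervalIntegrable_presentRate η s _)
    (h.intervalIntegrable_presentRate η _ b), hpresent, habsent, add_zero,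
    ← h.increment η s hs _ hmem (le_min hs.2 hsη) (min_le_right _ _) hηm]
  exact (sub_sub_cancel _ _).symm

theorem integral_terminal : ∫ η in b..m b, F η b = ∫ η in b..m b, exitValue F b η := by
  refine intervalIntegral.integral_congr fun η hη => ?_
  rw [uIcc_of_le (h.le_upper b (right_mem_Icc.2 h.le))] at hη
  simp only [exitValue, min_eq_left hη.1]

theorem integral_initial :
    ∫ η in a..m a, F η a = ∫ η in a..m a, (exitValue F b η - gain H m a b η) := by
  have haI : a ∈ Icc a b := left_mem_Icc.2 h.le
  refine intervalIntegral.integral_congr fun η hη => ?_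
  rw [uIcc_of_le (h.le_upper a haI)] at hη
  exact h.eq_exitValue_sub_integral haI hη.1 hη.2

theorem inflow_eq {s : ℝ} (hs : s ∈ Ioo a b) :
    m' s * F (m s) s = m' s * (exitValue F b (m s) - gain H m a b (m s)) := by
  have hsI := Ioo_subset_Icc_self hs
  rcases eq_or_ne (m' s) 0 with h0 | h0
  · rw [h0, zero_mul, zero_mul]
  -- Where the upper end moves, the label `m s` has not been present before `s`.
  have habsent : ∫ t in a..s, presentRate H m (m s) t = 0 := by
    rw [intervalIntegral.integral_of_le hs.1.le, ← integral_Icc_eq_integral_Ioc,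
      integral_Icc_eq_integral_Ioo]
    refine setIntegral_eq_zero_of_forall_eq_zero fun t ht => presentRate_of_notMem fun hp => h0 ?_
    have htI : t ∈ Icc a b := ⟨ht.1.le, ht.2.le.trans hs.2.le⟩
    exact deriv_eq_zero_of_monotoneOn_of_eq h.monotoneOn_upper htI hsI ht.2
      (le_antisymm (h.monotoneOn_upper htI hsI ht.2.le) hp.2) (h.hasDerivAt_upper s hs)
  rw [h.eq_exitValue_sub_integral hsI (h.le_upper s hsI) le_rfl, gain,
    ← intervalIntegral.integral_add_adjacent_intervals (h.intervalIntegrable_presentRate _ a s)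
      (h.intervalIntegrable_presentRate _ s b), habsent, zero_add]

theorem integral_rate_eq {s : ℝ} (hs : s ∈ Icc a b) :
    ∫ η in s..m s, H η s = ∫ η in a..m b, presentRate H m η s := by
  have hint : ∀ c d, IntervalIntegrable (fun η => presentRate H m η s) volume c d := fun c d =>
    h.isSignal_presentRate.intervalIntegrable measurable_id continuous_const c d
  have hbelow : ∫ η in a..s, presentRate H m η s = 0 := by
    rw [intervalIntegral.integral_of_le hs.1, ← integral_Icc_eq_integral_Ioc,
      integral_Icc_eq_integral_Ioo]
    exact setIntegral_eq_zero_of_forall_eq_zero fun η hη => presentRate_of_notMem fun hp =>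
      absurd hp.1 (not_le.2 hη.2)
  have habove : ∫ η in m s..m b, presentRate H m η s = 0 := by
    refine intervalIntegral.integral_zero_ae (Filter.Eventually.of_forall fun η hη => ?_)
    rw [uIoc_of_le (h.monotoneOn_upper hs (right_mem_Icc.2 h.le) hs.2)] at hη
    exact presentRate_of_notMem fun hp => absurd hp.2 (not_le.2 hη.1)
  rw [← intervalIntegral.integral_add_adjacent_intervals (hint a s) (hint s (m b)),
    ← intervalIntegral.integral_add_adjacent_intervals (hint s (m s)) (hint (m s) (m b)),
    hbelow, habove, zero_add, add_zero]
  refine intervalIntegral.integral_congr fun η hη => ?_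
  rw [uIcc_of_le (h.le_upper s hs)] at hη
  exact (presentRate_of_mem hη.1 hη.2).symm

theorem intervalIntegrable_inflow :
    IntervalIntegrable (fun s => m' s * (exitValue F b (m s) - gain H m a b (m s))) volume a b := by
  rw [intervalIntegrable_iff_integrableOn_Icc_of_le h.le]
  have hentry : IntervalIntegrable (fun η => exitValue F b η - gain H m a b η) volume (m a) (m b) :=
    (h.intervalIntegrable_exitValue _ _).sub (h.intervalIntegrable_gain _ _)
  simpa only [smul_eq_mul] using (integrableOn_Icc_deriv_smul_iff_of_deriv_nonneg
    (g := fun η => exitValue F b η - gain H m a b η) h.continuous_upper.continuousOn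
    h.hasDerivAt_upper h.deriv_nonneg h.le).2
    ((intervalIntegrable_iff_integrableOn_Icc_of_le h.upper_le_upper).1 hentry)

theorem integral_sub_eq :
    (∫ η in b..m b, F η b) - ∫ η in a..m a, F η a
      = ∫ s in a..b, (m' s * F (m s) s - F s s + ∫ η in s..m s, H η s) := by
  have hentry : ∀ c d, IntervalIntegrable (fun η => exitValue F b η - gain H m a b η) volume c d :=
    fun c d => (h.intervalIntegrable_exitValue c d).sub (h.intervalIntegrable_gain c d)
  have hrhs : ∫ s in a..b, (m' s * F (m s) s - F s s + ∫ η in s..m s, H η s)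
      = ∫ s in a..b, (m' s * (exitValue F b (m s) - gain H m a b (m s)) - exitValue F b s
        + ∫ η in a..m b, presentRate H m η s) := by
    rw [intervalIntegral.integral_of_le h.le, intervalIntegral.integral_of_le h.le,
      ← integral_Icc_eq_integral_Ioc, ← integral_Icc_eq_integral_Ioc,
      integral_Icc_eq_integral_Ioo, integral_Icc_eq_integral_Ioo]
    refine setIntegral_congr_fun measurableSet_Ioo fun s hs => ?_
    rw [h.inflow_eq hs, h.integral_rate_eq (Ioo_subset_Icc_self hs), exitValue_of_le hs.2.le]
  have hinflow := integral_mul_comp_of_deriv_nonneg h.le h.continuous_upper.continuousOn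
    h.hasDerivAt_upper h.deriv_nonneg h.upper_le_upper fun η => exitValue F b η - gain H m a b η
  rw [hrhs, intervalIntegral.integral_add
    (h.intervalIntegrable_inflow.sub (h.intervalIntegrable_exitValue a b))
    (h.isSignal_presentRate.intervalIntegrable_integral_space a (m b) a b),
    intervalIntegral.integral_sub h.intervalIntegrable_inflow (h.intervalIntegrable_exitValue a b),
    hinflow, h.isSignal_presentRate.integral_integral_swap a (m b) a b, h.integral_terminal,
    h.integral_initial]
  have hexit := intervalIntegral.integral_add_adjacent_intervals
    (h.intervalIntegrable_exitValue a b) (h.intervalIntegrable_exitValue b (m b))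
  have henter := intervalIntegral.integral_add_adjacent_intervals (hentry a (m a))
    (hentry (m a) (m b))
  have htotal := intervalIntegral.integral_sub (h.intervalIntegrable_exitValue a (m b))
    (h.intervalIntegrable_gain a (m b))
  simp only [gain] at *
  linarith

end

end IsLabelBalance

/-! ### Integrals over moving intervals -/

/-- `φ` is the travel time from the origin for a motion of velocity `lam z` at the position `z`. -/
structure IsTravelTime (lam : ℝ → ℝ) (φ : ℝ ≃o ℝ) : Prop where
  isBddCont : IsBddCont lam
  pos : ∀ z, 0 < lam z
  map_zero : φ 0 = 0
  hasDerivAt : ∀ z, HasDerivAt φ (lam z)⁻¹ z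

theorem exists_isTravelTime {lam : ℝ → ℝ} (hlam : IsBddCont lam) (hpos : ∀ z, 0 < lam z) :
    ∃ φ, IsTravelTime lam φ := by
  obtain ⟨Λ, hΛ⟩ := hlam.2
  have hΛpos : 0 < Λ := (hpos 0).trans_le ((le_abs_self _).trans (hΛ 0))
  have hcont : Continuous fun z => (lam z)⁻¹ := hlam.1.inv₀ fun z => (hpos z).ne'
  let T : ℝ → ℝ := fun z => ∫ t in (0 : ℝ)..z, (lam t)⁻¹
  have hT : ∀ z, HasDerivAt T (lam z)⁻¹ z := fun z =>
    (hcont.integral_hasStrictDerivAt 0 z).hasDerivAt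
  have hT0 : T 0 = 0 := intervalIntegral.integral_same
  have hdiff : Differentiable ℝ T := fun z => (hT z).differentiableAt
  have hslope : ∀ ⦃y z⦄, y ≤ z → Λ⁻¹ * (z - y) ≤ T z - T y :=
    mul_sub_le_image_sub_of_le_deriv hdiff fun z => by
      rw [(hT z).deriv]
      exact inv_anti₀ (hpos z) ((le_abs_self _).trans (hΛ z))
  have hmono : StrictMono T := strictMono_of_deriv_pos fun z => by
    rw [(hT z).deriv]
    exact inv_pos.2 (hpos z)
  have hsurj : Function.Surjective T := by
    refine hdiff.continuous.surjective
      (Filter.tendsto_atTop_mono' _ ?_ (Filter.tendsto_id.const_mul_atTop (inv_pos.2 hΛpos)))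
      (Filter.tendsto_atBot_mono' _ ?_ (Filter.tendsto_id.const_mul_atBot (inv_pos.2 hΛpos)))
    · filter_upwards [Filter.eventually_ge_atTop (0 : ℝ)] with z hz
      simpa only [hT0, sub_zero, id] using hslope hz
    · filter_upwards [Filter.eventually_le_atBot (0 : ℝ)] with z hz
      simpa only [hT0, zero_sub, mul_neg, neg_le_neg_iff, id] using hslope hz
  exact ⟨hmono.orderIsoOfSurjective T hsurj, hlam, hpos, hT0, hT⟩

namespace IsTravelTime

variable {lam : ℝ → ℝ} {φ : ℝ ≃o ℝ} (h : IsTravelTime lam φ)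
include h

theorem symm_zero : φ.symm 0 = 0 := φ.symm_apply_eq.2 h.map_zero.symm

theorem hasDerivAt_symm (t : ℝ) : HasDerivAt φ.symm (lam (φ.symm t)) t := by
  simpa using (h.hasDerivAt (φ.symm t)).of_local_left_inverse φ.symm.continuous.continuousAt
    (inv_ne_zero (h.pos _).ne') (Filter.Eventually.of_forall φ.apply_symm_apply)

theorem nonneg {z : ℝ} (hz : 0 ≤ z) : 0 ≤ φ z := h.map_zero ▸ φ.monotone hz

theorem symm_nonneg {t : ℝ} (ht : 0 ≤ t) : 0 ≤ φ.symm t := h.symm_zero ▸ φ.symm.monotone ht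

theorem hasDerivAt_symm_sub_mul (σ c s : ℝ) :
    HasDerivAt (fun s => φ.symm (c - σ * s)) (-(σ * lam (φ.symm (c - σ * s)))) s := by
  have hinner : HasDerivAt (fun s => c - σ * s) (-σ) s := by
    simpa using ((hasDerivAt_id s).const_mul σ).const_sub c
  exact ((h.hasDerivAt_symm _).comp s hinner).congr_deriv (by ring)

theorem apply_eq_of_hasDerivWithinAt {θ a b : ℝ} {p : ℝ → ℝ}
    (hp : ∀ s ∈ Icc a b, HasDerivWithinAt p (θ * lam (p s)) (Icc a b) s) :
    ∀ s ∈ Icc a b, φ (p s) = φ (p a) + θ * (s - a) := by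
  intro s hs
  have hd : ∀ s ∈ Icc a b, HasDerivWithinAt (fun s => φ (p s) - θ * s) 0 (Icc a b) s := by
    intro s hs
    have hsub := ((h.hasDerivAt (p s)).comp_hasDerivWithinAt s (hp s hs)).sub
      (((hasDerivAt_id s).const_mul θ).hasDerivWithinAt (s := Icc a b))
    refine hsub.congr_deriv ?_
    field_simp [(h.pos (p s)).ne']
    ring
  have hconst := constant_of_has_deriv_right_zero (f := fun s => φ (p s) - θ * s)
    (fun s hs => (hd s hs).continuousWithinAt)
    (fun s hs => (hd s (Ico_subset_Icc_self hs)).mono_of_mem_nhdsWithin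
      (Icc_mem_nhdsGE_of_mem hs)) s hs
  linarith

theorem integral_symm_sub (q : ℝ → ℝ) (s : ℝ) {r : ℝ} (hr : 0 ≤ r) :
    ∫ η in s..φ r + s, lam (φ.symm (η - s)) * q (φ.symm (η - s)) = ∫ ζ in (0 : ℝ)..r, q ζ := by
  have hd : ∀ η, HasDerivAt (fun η => φ.symm (η - s)) (lam (φ.symm (η - s))) η := fun η =>
    (h.hasDerivAt_symm (η - s)).comp_sub_const η s
  rw [integral_mul_comp_of_deriv_nonneg (le_add_of_nonneg_left (h.nonneg hr))
    (continuous_iff_continuousAt.2 fun z => (hd z).continuousAt).continuousOn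
    (fun η _ => hd η) (fun η _ => (h.pos _).le)]
  · simp [h.symm_zero]
  · simpa [h.symm_zero] using hr

theorem symm_sub_mem {r s η : ℝ} (hη : η ∈ Icc s (φ r + s)) : φ.symm (η - s) ∈ Icc 0 r :=
  ⟨h.symm_nonneg (sub_nonneg.2 hη.1),
    φ.symm_apply_apply r ▸ φ.symm.monotone (sub_le_iff_le_add.2 hη.2)⟩

theorem isSignal_label {g : ℝ → ℝ → ℝ} (hg : IsSignal g) :
    IsSignal fun η s => lam (φ.symm (η - s)) * g (φ.symm (η - s)) s :=
  (IsSignal.isBddCont_mul h.isBddCont hg).comp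
    (φ.symm.continuous.measurable.comp (measurable_fst.sub measurable_snd))

variable {γ γ' : ℝ → ℝ} {f g : ℝ → ℝ → ℝ} {a b : ℝ}

-- The label of a point is the time at which its characteristic leaves through the origin.
theorem isLabelBalance (hab : a ≤ b) (hγ : ∀ s, HasDerivAt γ (γ' s) s)
    (hγ0 : ∀ s ∈ Icc a b, 0 ≤ γ s) (hin : ∀ s ∈ Icc a b, 0 ≤ lam (γ s) + γ' s)
    (hg : IsSignal g) (hf : IsSignal f)
    (hinc : ∀ c, ∀ s₁ ∈ Icc a b, ∀ s₂ ∈ Icc a b, s₁ ≤ s₂ →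
      (∀ s ∈ Icc s₁ s₂, φ.symm (c - s) ∈ Icc 0 (γ s)) →
      lam (φ.symm (c - s₂)) * g (φ.symm (c - s₂)) s₂
          - lam (φ.symm (c - s₁)) * g (φ.symm (c - s₁)) s₁
        = ∫ s in s₁..s₂, lam (φ.symm (c - s)) * f (φ.symm (c - s)) s) :
    IsLabelBalance (fun η s => lam (φ.symm (η - s)) * g (φ.symm (η - s)) s)
      (fun η s => lam (φ.symm (η - s)) * f (φ.symm (η - s)) s) (fun s => φ (γ s) + s)
      (fun s => (lam (γ s) + γ' s) / lam (γ s)) a b := by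
  have hd : ∀ s, HasDerivAt (fun s => φ (γ s) + s) ((lam (γ s) + γ' s) / lam (γ s)) s := fun s =>
    (((h.hasDerivAt (γ s)).comp s (hγ s)).add (hasDerivAt_id s)).congr_deriv (by
      field_simp [(h.pos (γ s)).ne']
      ring)
  have hd_nonneg : ∀ s ∈ Icc a b, 0 ≤ (lam (γ s) + γ' s) / lam (γ s) := fun s hs =>
    div_nonneg (hin s hs) (h.pos _).le
  have hmono : MonotoneOn (fun s => φ (γ s) + s) (Icc a b) :=
    monotoneOn_of_deriv_nonneg (convex_Icc a b)
      (fun s _ => (hd s).continuousAt.continuousWithinAt)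
      (fun s _ => (hd s).differentiableAt.differentiableWithinAt) fun s hs => by
        rw [(hd s).deriv]
        exact hd_nonneg s (interior_subset hs)
  exact
    { le := hab
      continuous_upper := continuous_iff_continuousAt.2 fun s => (hd s).continuousAt
      hasDerivAt_upper := fun s _ => hd s
      deriv_nonneg := fun s hs => hd_nonneg s (Ioo_subset_Icc_self hs)
      le_upper := fun s hs => le_add_of_nonneg_left (h.nonneg (hγ0 s hs))
      isSignal := h.isSignal_label hg
      isSignal_rate := h.isSignal_label hf
      increment := fun η s₁ h₁ s₂ h₂ h12 hη₂ hη₁ => hinc η s₁ h₁ s₂ h₂ h12 fun s hs =>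
        h.symm_sub_mem ⟨hs.2.trans hη₂,
          hη₁.trans (hmono h₁ ⟨h₁.1.trans hs.1, hs.2.trans h₂.2⟩ hs.1)⟩ }

theorem integral_moving_sub_eq_of_leftward (hab : a ≤ b) (hγ : ∀ s, HasDerivAt γ (γ' s) s)
    (hγ0 : ∀ s ∈ Icc a b, 0 ≤ γ s) (hin : ∀ s ∈ Icc a b, 0 ≤ lam (γ s) + γ' s)
    (hg : IsSignal g) (hf : IsSignal f)
    (hinc : ∀ c, ∀ s₁ ∈ Icc a b, ∀ s₂ ∈ Icc a b, s₁ ≤ s₂ →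
      (∀ s ∈ Icc s₁ s₂, φ.symm (c - s) ∈ Icc 0 (γ s)) →
      lam (φ.symm (c - s₂)) * g (φ.symm (c - s₂)) s₂
          - lam (φ.symm (c - s₁)) * g (φ.symm (c - s₁)) s₁
        = ∫ s in s₁..s₂, lam (φ.symm (c - s)) * f (φ.symm (c - s)) s) :
    (∫ ζ in 0..γ b, g ζ b) - ∫ ζ in 0..γ a, g ζ a
      = ∫ s in a..b, ((lam (γ s) + γ' s) * g (γ s) s - lam 0 * g 0 s
          + ∫ ζ in 0..γ s, f ζ s) := by
  have hbalance := (h.isLabelBalance hab hγ hγ0 hin hg hf hinc).integral_sub_eq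
  rw [h.integral_symm_sub (fun ζ => g ζ b) b (hγ0 b (right_mem_Icc.2 hab)),
    h.integral_symm_sub (fun ζ => g ζ a) a (hγ0 a (left_mem_Icc.2 hab))] at hbalance
  rw [hbalance]
  refine intervalIntegral.integral_congr fun s hs => ?_
  rw [uIcc_of_le hab] at hs
  have hlam := (h.pos (γ s)).ne'
  simp only [h.integral_symm_sub (fun ζ => f ζ s) s (hγ0 s hs), add_sub_cancel_right, sub_self,
    h.symm_zero, φ.symm_apply_apply]
  field_simp

theorem integral_moving_sub_eq {σ : ℝ} (hσ : σ = 1 ∨ σ = -1) (hab : a ≤ b)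
    (hγ : ∀ s, HasDerivAt γ (γ' s) s) (hγ0 : ∀ s ∈ Icc a b, 0 ≤ γ s)
    (hin : ∀ s ∈ Icc a b, 0 ≤ lam (γ s) + σ * γ' s) (hg : IsSignal g) (hf : IsSignal f)
    (hinc : ∀ c, ∀ s₁ ∈ Icc a b, ∀ s₂ ∈ Icc a b, s₁ ≤ s₂ →
      (∀ s ∈ Icc s₁ s₂, φ.symm (c - σ * s) ∈ Icc 0 (γ s)) →
      lam (φ.symm (c - σ * s₂)) * g (φ.symm (c - σ * s₂)) s₂
          - lam (φ.symm (c - σ * s₁)) * g (φ.symm (c - σ * s₁)) s₁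
        = ∫ s in s₁..s₂, lam (φ.symm (c - σ * s)) * f (φ.symm (c - σ * s)) s) :
    (∫ ζ in 0..γ b, g ζ b) - ∫ ζ in 0..γ a, g ζ a
      = ∫ s in a..b, ((σ * lam (γ s) + γ' s) * g (γ s) s - σ * lam 0 * g 0 s
          + ∫ ζ in 0..γ s, f ζ s) := by
  rcases hσ with rfl | rfl
  · simp only [one_mul] at hin hinc ⊢
    exact h.integral_moving_sub_eq_of_leftward hab hγ hγ0 hin hg hf hinc
  -- Time reversal turns the motion into one towards the origin.
  have hneg : ∀ {s}, s ∈ Icc (-b) (-a) → -s ∈ Icc a b := fun hs =>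
    ⟨le_neg_of_le_neg hs.2, neg_le_of_neg_le hs.1⟩
  have hleftward := h.integral_moving_sub_eq_of_leftward (neg_le_neg hab) (γ := fun s => γ (-s))
    (γ' := fun s => -γ' (-s)) (g := fun ζ s => g ζ (-s)) (f := fun ζ s => -1 * f ζ (-s))
    (fun s => by simpa [Function.comp_def] using (hγ (-s)).comp s (hasDerivAt_neg s))
    (fun s hs => hγ0 _ (hneg hs)) (fun s hs => by linarith [hin _ (hneg hs)])
    hg.comp_neg (hf.comp_neg.const_mul (-1)) fun c s₁ h₁ s₂ h₂ h12 hr => by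
      have hrev := hinc c (-s₂) (hneg h₂) (-s₁) (hneg h₁) (neg_le_neg h12) fun s hs => by
        simpa using hr (-s) ⟨le_neg_of_le_neg hs.2, neg_le_of_neg_le hs.1⟩
      simp only [neg_mul, one_mul, sub_neg_eq_add, ← sub_eq_add_neg] at hrev
      rw [← intervalIntegral.integral_comp_neg] at hrev
      simp only [← sub_eq_add_neg] at hrev
      simp only [neg_mul, one_mul, mul_neg, intervalIntegral.integral_neg]
      linarith
  have hflip := intervalIntegral.integral_comp_neg (a := -b) (b := -a)
    fun s => (-1 * lam (γ s) + γ' s) * g (γ s) s - -1 * lam 0 * g 0 s + ∫ ζ in 0..γ s, f ζ s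
  simp only [neg_neg] at hleftward hflip
  rw [← hflip, ← neg_sub (∫ ζ in 0..γ a, g ζ a), hleftward, ← intervalIntegral.integral_neg]
  refine intervalIntegral.integral_congr fun s _ => ?_
  simp only [intervalIntegral.integral_const_mul]
  ring

end IsTravelTime

/-! ### Characteristics -/

/-- The sign of the velocity `Λᵢᵢ`. -/
def travelSign : Fin 2 → ℝ := ![1, -1]

theorem travelSign_eq (i : Fin 2) : travelSign i = 1 ∨ travelSign i = -1 := by
  fin_cases i <;> simp [travelSign]

theorem travelSign_mul_self (i : Fin 2) : travelSign i * travelSign i = 1 := by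
  fin_cases i <;> simp [travelSign]

/-- The product `(a y)ᵢ(z, t) = ∑ⱼ aᵢⱼ(z) yⱼ(z, t)` of a matrix field and a trajectory. -/
noncomputable def mulField (a : Fin 2 → Fin 2 → ℝ → ℝ) (y : Fin 2 → ℝ → ℝ → ℝ) (i : Fin 2)
    (z t : ℝ) : ℝ :=
  ∑ j, a i j z * y j z t

theorem isSignal_mulField {a : Fin 2 → Fin 2 → ℝ → ℝ} {y : Fin 2 → ℝ → ℝ → ℝ}
    (ha : ∀ i j, IsBddCont (a i j)) (hy : ∀ j, IsSignal (y j)) (i : Fin 2) :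
    IsSignal (mulField a y i) :=
  IsSignal.sum fun j => IsSignal.isBddCont_mul (ha i j) (hy j)

theorem mulField_sub (a : Fin 2 → Fin 2 → ℝ → ℝ) (y w : Fin 2 → ℝ → ℝ → ℝ) (i : Fin 2)
    (z t : ℝ) : mulField a (fun j z t => y j z t - w j z t) i z t
      = mulField a y i z t - mulField a w i z t := by
  simp only [mulField, mul_sub, Finset.sum_sub_distrib]

namespace PDEODESystem

variable {n : ℕ} (S : PDEODESystem n)

/-- The velocity `λᵢ`, extended to the real line by retraction. -/
noncomputable def speed (i : Fin 2) (z : ℝ) : ℝ := S.lam i (unitClamp z)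

theorem speed_of_mem (i : Fin 2) {z : ℝ} (hz : z ∈ Icc (0 : ℝ) 1) : S.speed i z = S.lam i z := by
  rw [speed, unitClamp_of_mem hz]

theorem speed_pos (i : Fin 2) (z : ℝ) : 0 < S.speed i z := S.lam_pos i _ (unitClamp_mem z)

theorem isBddCont_speed (i : Fin 2) : IsBddCont (S.speed i) :=
  isBddCont_comp_unitClamp (S.lam_cont i)

theorem Lam_diag (i : Fin 2) {z : ℝ} (hz : z ∈ Icc (0 : ℝ) 1) :
    S.Lam z i i = travelSign i * S.speed i z := by
  fin_cases i <;> simp [Lam, travelSign, S.speed_of_mem _ hz]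

/-- The travel time from the boundary `z = 0` at the velocity `λᵢ`. -/
noncomputable def travelTime (i : Fin 2) : ℝ ≃o ℝ :=
  (exists_isTravelTime (S.isBddCont_speed i) (S.speed_pos i)).choose

theorem isTravelTime (i : Fin 2) : IsTravelTime (S.speed i) (S.travelTime i) :=
  (exists_isTravelTime (S.isBddCont_speed i) (S.speed_pos i)).choose_spec

/-- The characteristic curves `s ↦ (characteristic i c s, s)` of the `i`-th transport equation,
labelled by the value `c` of `travelTime i z + travelSign i * t`, which is constant along them. -/
noncomputable def characteristic (i : Fin 2) (c s : ℝ) : ℝ :=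
  (S.travelTime i).symm (c - travelSign i * s)

theorem hasDerivAt_characteristic (i : Fin 2) (c s : ℝ) : HasDerivAt (S.characteristic i c)
    (-(travelSign i * S.speed i (S.characteristic i c s))) s :=
  (S.isTravelTime i).hasDerivAt_symm_sub_mul _ c s

theorem continuous_characteristic (i : Fin 2) (c : ℝ) : Continuous (S.characteristic i c) :=
  continuous_iff_continuousAt.2 fun s => (S.hasDerivAt_characteristic i c s).continuousAt

/-- One component of a transport equation, along the explicit characteristics:
`y` increases by the integral of the source `f`. -/
def IsTransported (i : Fin 2) (f y : ℝ → ℝ → ℝ) : Prop :=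
  ∀ c a b : ℝ, 0 ≤ a → a ≤ b → (∀ s ∈ Icc a b, S.characteristic i c s ∈ Icc (0 : ℝ) 1) →
    y (S.characteristic i c b) b - y (S.characteristic i c a) a
      = ∫ s in a..b, f (S.characteristic i c s) s

theorem solvesTransport_iff (f x : ℝ → ℝ → Fin 2 → ℝ) : SolvesTransport S.Lam f x ↔
    ∀ i, S.IsTransported i (fun z t => f z t i) (fun z t => x z t i) := by
  constructor
  · intro h i c a b ha hab hc
    refine h i a b _ ha hab fun s hs => ⟨hc s hs, ?_⟩
    rw [S.Lam_diag i (hc s hs)]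
    exact (S.hasDerivAt_characteristic i c s).hasDerivWithinAt
  · intro h i a b γ ha hab hγ
    have htime := (S.isTravelTime i).apply_eq_of_hasDerivWithinAt (θ := -travelSign i) (p := γ)
      fun s hs => ((hγ s hs).2).congr_deriv (by rw [S.Lam_diag i (hγ s hs).1, neg_mul])
    have hchar : ∀ s ∈ Icc a b,
        S.characteristic i (S.travelTime i (γ a) + travelSign i * a) s = γ s := fun s hs => by
      rw [characteristic, OrderIso.symm_apply_eq, htime s hs]
      ring
    have hinc := h i _ a b ha hab fun s hs => (hchar s hs).symm ▸ (hγ s hs).1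
    rw [hchar b (right_mem_Icc.2 hab), hchar a (left_mem_Icc.2 hab)] at hinc
    refine hinc.trans (intervalIntegral.integral_congr fun s hs => ?_)
    rw [uIcc_of_le hab] at hs
    simp only [hchar s hs]

section IsTransported

variable {S} {i : Fin 2} {f g y w : ℝ → ℝ → ℝ}

theorem IsTransported.congr (h : S.IsTransported i f y)
    (hf : ∀ z ∈ Icc (0 : ℝ) 1, ∀ t, 0 < t → g z t = f z t)
    (hy : ∀ z ∈ Icc (0 : ℝ) 1, ∀ t, 0 ≤ t → w z t = y z t) : S.IsTransported i g w := by
  intro c a b ha hab hc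
  rw [hy _ (hc b (right_mem_Icc.2 hab)) b (ha.trans hab), hy _ (hc a (left_mem_Icc.2 hab)) a ha,
    h c a b ha hab hc]
  refine intervalIntegral.integral_congr_ae (Filter.Eventually.of_forall fun s hs => ?_)
  rw [uIoc_of_le hab] at hs
  rw [hf _ (hc s (Ioc_subset_Icc_self hs)) s (ha.trans_lt hs.1)]

theorem intervalIntegrable_along (hf : IsSignal f) (c a b : ℝ) :
    IntervalIntegrable (fun s => f (S.characteristic i c s) s) volume a b :=
  hf.intervalIntegrable (S.continuous_characteristic i c).measurable continuous_id a b

theorem IsTransported.sub (hy : S.IsTransported i f y) (hw : S.IsTransported i g w)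
    (hf : IsSignal f) (hg : IsSignal g) :
    S.IsTransported i (fun z t => f z t - g z t) (fun z t => y z t - w z t) := by
  intro c a b ha hab hc
  rw [intervalIntegral.integral_sub (intervalIntegrable_along hf c a b)
    (intervalIntegrable_along hg c a b), ← hy c a b ha hab hc, ← hw c a b ha hab hc]
  ring

theorem IsTransported.sum {f y : Fin 2 → ℝ → ℝ → ℝ} (h : ∀ j, S.IsTransported i (f j) (y j))
    (hf : ∀ j, IsSignal (f j)) :
    S.IsTransported i (fun z t => ∑ j, f j z t) (fun z t => ∑ j, y j z t) := by
  intro c a b ha hab hc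
  rw [intervalIntegral.integral_finsetSum fun j _ => intervalIntegrable_along (hf j) c a b,
    ← Finset.sum_sub_distrib]
  exact Finset.sum_congr rfl fun j _ => h j c a b ha hab hc

end IsTransported

/-- The coefficient `Aᵢⱼ`, extended to the real line by retraction. -/
noncomputable def coupling (i j : Fin 2) (z : ℝ) : ℝ := S.A (unitClamp z) i j

theorem isBddCont_coupling (i j : Fin 2) : IsBddCont (S.coupling i j) :=
  isBddCont_comp_unitClamp (S.A_cont i j)

/-- The `i`-th diagonal entry `exp (± αᵢ)` of `E`, extended to a differentiable function on the real
line. -/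
noncomputable def scaling (i : Fin 2) (z : ℝ) : ℝ :=
  Real.exp (travelSign i * ∫ ζ in (0 : ℝ)..z, S.coupling i i ζ / S.speed i ζ)

theorem hasDerivAt_scaling (i : Fin 2) (z : ℝ) : HasDerivAt (S.scaling i)
    (S.scaling i z * (travelSign i * (S.coupling i i z / S.speed i z))) z := by
  have hcont : Continuous fun ζ => S.coupling i i ζ / S.speed i ζ :=
    (S.isBddCont_coupling i i).1.div (S.isBddCont_speed i).1 fun z => (S.speed_pos i z).ne'
  exact ((hcont.integral_hasStrictDerivAt 0 z).hasDerivAt.const_mul (travelSign i)).exp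

theorem continuous_scaling (i : Fin 2) : Continuous (S.scaling i) :=
  continuous_iff_continuousAt.2 fun s => (S.hasDerivAt_scaling i s).continuousAt

theorem scaling_pos (i : Fin 2) (z : ℝ) : 0 < S.scaling i z := Real.exp_pos _

theorem scaling_zero (i : Fin 2) : S.scaling i 0 = 1 := by simp [scaling]

theorem exp_alpha (i : Fin 2) {z : ℝ} (hz : z ∈ Icc (0 : ℝ) 1) :
    Real.exp (travelSign i * S.alpha i z) = S.scaling i z := by
  have halpha : S.alpha i z = ∫ ζ in (0 : ℝ)..z, S.coupling i i ζ / S.speed i ζ := by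
    refine intervalIntegral.integral_congr fun ζ hζ => ?_
    rw [uIcc_of_le hz.1] at hζ
    simp only [coupling, speed, unitClamp_of_mem ⟨hζ.1, hζ.2.trans hz.2⟩]
  rw [scaling, halpha]

theorem exp_alpha_zero {z : ℝ} (hz : z ∈ Icc (0 : ℝ) 1) :
    Real.exp (S.alpha 0 z) = S.scaling 0 z := by
  simpa [travelSign] using S.exp_alpha 0 hz

theorem exp_neg_alpha_one {z : ℝ} (hz : z ∈ Icc (0 : ℝ) 1) :
    Real.exp (-S.alpha 1 z) = S.scaling 1 z := by
  simpa [travelSign] using S.exp_alpha 1 hz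

theorem E_mulVec (v : Fin 2 → ℝ) (i : Fin 2) {z : ℝ} (hz : z ∈ Icc (0 : ℝ) 1) :
    (S.E z *ᵥ v) i = S.scaling i z * v i := by
  fin_cases i <;>
    simp [E, S.exp_alpha_zero hz, S.exp_neg_alpha_one hz, Matrix.mulVec, dotProduct,
      Fin.sum_univ_two]

/-- The coefficient `Ãᵢⱼ`, extended to the real line by retraction. -/
noncomputable def scaledCoupling (i j : Fin 2) (z : ℝ) : ℝ := S.Atilde (unitClamp z) i j

theorem scaledCoupling_self (i : Fin 2) (z : ℝ) : S.scaledCoupling i i z = 0 := by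
  fin_cases i <;> simp [scaledCoupling, Atilde]

theorem scaledCoupling_mul_scaling {i j : Fin 2} (hij : i ≠ j) {z : ℝ} (hz : z ∈ Icc (0 : ℝ) 1) :
    S.scaledCoupling i j z * S.scaling j z = S.scaling i z * S.coupling i j z := by
  rw [scaledCoupling, coupling, unitClamp_of_mem hz, ← S.exp_alpha i hz, ← S.exp_alpha j hz]
  fin_cases i <;> fin_cases j <;>
    first
    | exact absurd rfl hij
    | simp only [Atilde, travelSign, Fin.mk_one, Fin.zero_eta, Matrix.of_apply,
        Matrix.cons_val_zero, Matrix.cons_val_one, Matrix.cons_val',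
        Matrix.cons_val_fin_one, one_mul, neg_mul, mul_assoc, ← Real.exp_add]
      rw [mul_comm (Real.exp _)]
      ring_nf

theorem isBddCont_scaledCoupling (i j : Fin 2) : IsBddCont (S.scaledCoupling i j) := by
  refine isBddCont_comp_unitClamp (f := fun z => S.Atilde z i j) ?_
  rcases eq_or_ne i j with rfl | hij
  · refine (continuousOn_const (c := (0 : ℝ))).congr fun z hz => ?_
    simpa only [scaledCoupling, unitClamp_of_mem hz] using S.scaledCoupling_self i z
  · refine (((S.continuous_scaling i).continuousOn.mul (S.A_cont i j)).div
      (S.continuous_scaling j).continuousOn fun z _ => (S.scaling_pos j z).ne').congr fun z hz => ?_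
    rw [Pi.div_apply, eq_div_iff (S.scaling_pos j z).ne']
    simpa only [scaledCoupling, coupling, unitClamp_of_mem hz, Pi.mul_apply]
      using S.scaledCoupling_mul_scaling hij hz

end PDEODESystem

/-! ### The Volterra integral along characteristics -/

/-- The kernel entry `Kᵢⱼ`, extended to the plane by retraction onto the triangle. -/
noncomputable def kernelExt (K : ℝ → ℝ → Matrix (Fin 2) (Fin 2) ℝ) (i j : Fin 2) (z ζ : ℝ) : ℝ :=
  K (triangleClamp (z, ζ)).1 (triangleClamp (z, ζ)).2 i j

theorem kernelExt_of_mem (K : ℝ → ℝ → Matrix (Fin 2) (Fin 2) ℝ) (i j : Fin 2) {z ζ : ℝ}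
    (h0 : 0 ≤ ζ) (h1 : ζ ≤ z) (h2 : z ≤ 1) : kernelExt K i j z ζ = K z ζ i j := by
  rw [kernelExt, triangleClamp_of_mem ⟨h0, h1, h2⟩]

/-- The scalar Volterra integral `∫₀ᶻ k(z,ζ) y(ζ,t) dζ`; its upper limit is retracted to the unit
interval, so that it is again a signal. -/
noncomputable def volterraIntegral (k : ℝ → ℝ → ℝ) (y : ℝ → ℝ → ℝ) (z t : ℝ) : ℝ :=
  ∫ ζ in (0 : ℝ)..unitClamp z, k z ζ * y ζ t

/-- The matrix Volterra integral operator `(k y)ᵢ(z,t) = ∑ⱼ ∫₀ᶻ kᵢⱼ(z,ζ) yⱼ(ζ,t) dζ`. -/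
noncomputable def volterra (k : Fin 2 → Fin 2 → ℝ → ℝ → ℝ) (y : Fin 2 → ℝ → ℝ → ℝ) (i : Fin 2)
    (z t : ℝ) : ℝ :=
  ∑ j, volterraIntegral (k i j) (y j) z t

section Volterra

variable {k : Fin 2 → Fin 2 → ℝ → ℝ → ℝ} {y w : Fin 2 → ℝ → ℝ → ℝ}

theorem isSignal_volterra (hk : ∀ i j, IsBddCont (Function.uncurry (k i j)))
    (hy : ∀ j, IsSignal (y j)) (i : Fin 2) : IsSignal (volterra k y i) :=
  IsSignal.sum fun j => IsSignal.intervalIntegral (hk i j) (hy j)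

theorem intervalIntegrable_kernel_mul {k y : ℝ → ℝ → ℝ} (hk : IsBddCont (Function.uncurry k))
    (hy : IsSignal y) (z t a b : ℝ) :
    IntervalIntegrable (fun ζ => k z ζ * y ζ t) volume a b :=
  ((IsSignal.of_isBddCont (hk.comp (Continuous.prodMk_right z))).mul hy).intervalIntegrable
    measurable_id continuous_const a b

theorem volterra_sub (hk : ∀ i j, IsBddCont (Function.uncurry (k i j)))
    (hy : ∀ j, IsSignal (y j)) (hw : ∀ j, IsSignal (w j)) (i : Fin 2) (z t : ℝ) :
    volterra k (fun j z t => y j z t - w j z t) i z t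
      = volterra k y i z t - volterra k w i z t := by
  rw [volterra, volterra, volterra, ← Finset.sum_sub_distrib]
  refine Finset.sum_congr rfl fun j _ => ?_
  simp only [volterraIntegral, mul_sub]
  exact intervalIntegral.integral_sub (intervalIntegrable_kernel_mul (hk i j) (hy j) z t _ _)
    (intervalIntegrable_kernel_mul (hk i j) (hw j) z t _ _)

end Volterra

namespace PDEODESystem

variable {n : ℕ} {S : PDEODESystem n} {K : ℝ → ℝ → Matrix (Fin 2) (Fin 2) ℝ}

theorem IsKernel.isBddCont_kernelExt (hK : S.IsKernel K) (i j : Fin 2) :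
    IsBddCont (Function.uncurry (kernelExt K i j)) :=
  isBddCont_comp_of_isCompact isCompact_triangle (hK.cont i j) continuous_triangleClamp
    triangleClamp_mem

/-- The entries of the product `K(z,ζ) Ã(ζ)`, extended to the plane. -/
noncomputable def kernelCoupling (S : PDEODESystem n) (K : ℝ → ℝ → Matrix (Fin 2) (Fin 2) ℝ)
    (i j : Fin 2) (z ζ : ℝ) : ℝ :=
  ∑ l, kernelExt K i l z ζ * S.scaledCoupling l j ζ

theorem kernelCoupling_of_mem (S : PDEODESystem n) (K : ℝ → ℝ → Matrix (Fin 2) (Fin 2) ℝ)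
    (i j : Fin 2) {z ζ : ℝ} (h0 : 0 ≤ ζ) (h1 : ζ ≤ z) (h2 : z ≤ 1) :
    S.kernelCoupling K i j z ζ = (K z ζ * S.Atilde ζ) i j := by
  simp only [kernelCoupling, Matrix.mul_apply, kernelExt_of_mem K i _ h0 h1 h2, scaledCoupling,
    unitClamp_of_mem ⟨h0, h1.trans h2⟩]

theorem IsKernel.isBddCont_kernelCoupling (hK : S.IsKernel K) (i j : Fin 2) :
    IsBddCont (Function.uncurry (S.kernelCoupling K i j)) := by
  have hmul : ∀ l, IsBddCont fun p : ℝ × ℝ => kernelExt K i l p.1 p.2 * S.scaledCoupling l j p.2 :=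
    fun l => (hK.isBddCont_kernelExt i l).mul ((S.isBddCont_scaledCoupling l j).comp continuous_snd)
  simpa only [Function.uncurry_def, kernelCoupling, Fin.sum_univ_two] using (hmul 0).add (hmul 1)

theorem IsKernel.volterra_mulField_scaledCoupling (hK : S.IsKernel K) {w : Fin 2 → ℝ → ℝ → ℝ}
    (hw : ∀ j, IsSignal (w j)) (i : Fin 2) (z t : ℝ) :
    volterra (kernelExt K) (mulField S.scaledCoupling w) i z t
      = volterra (S.kernelCoupling K) w i z t := by
  simp only [volterra, volterraIntegral]
  rw [← intervalIntegral.integral_finsetSum fun j _ =>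
      intervalIntegrable_kernel_mul (hK.isBddCont_kernelExt i j)
        (isSignal_mulField S.isBddCont_scaledCoupling hw j) z t _ _,
    ← intervalIntegral.integral_finsetSum fun j _ =>
      intervalIntegrable_kernel_mul (hK.isBddCont_kernelCoupling i j) (hw j) z t _ _]
  refine intervalIntegral.integral_congr fun ζ _ => ?_
  simp only [kernelCoupling, mulField, Fin.sum_univ_two]
  ring

theorem IsKernel.diagonal_eq (hK : S.IsKernel K) (i j : Fin 2) {z : ℝ} (hz : z ∈ Icc (0 : ℝ) 1) :
    (travelSign j * S.speed j z - travelSign i * S.speed i z) * kernelExt K i j z z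
      = S.scaledCoupling i j z := by
  have hne : S.lam 0 z + S.lam 1 z ≠ 0 := (add_pos (S.lam_pos 0 z hz) (S.lam_pos 1 z hz)).ne'
  rw [kernelExt_of_mem K i j hz.1 le_rfl hz.2, S.speed_of_mem i hz, S.speed_of_mem j hz]
  fin_cases i <;> fin_cases j
  · simp [scaledCoupling_self]
  · simp only [Fin.zero_eta, Fin.mk_one, travelSign, Matrix.cons_val_zero, Matrix.cons_val_one,
      scaledCoupling, unitClamp_of_mem hz, hK.bc12 z hz]
    field_simp
    ring
  · simp only [Fin.zero_eta, Fin.mk_one, travelSign, Matrix.cons_val_zero, Matrix.cons_val_one,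
      scaledCoupling, unitClamp_of_mem hz, hK.bc21 z hz]
    field_simp
    ring
  · simp [scaledCoupling_self]

theorem IsKernel.hasDerivWithinAt_characteristic (hK : S.IsKernel K) (i j : Fin 2) {c d a b : ℝ}
    (hab : a ≤ b) (hmem : ∀ s ∈ Icc a b, 0 ≤ S.characteristic j d s ∧
      S.characteristic j d s ≤ S.characteristic i c s ∧ S.characteristic i c s ≤ 1) :
    ∀ s ∈ Icc a b, HasDerivWithinAt (fun s => S.speed j (S.characteristic j d s) *
        kernelExt K i j (S.characteristic i c s) (S.characteristic j d s))
      (-(S.speed j (S.characteristic j d s) *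
        S.kernelCoupling K i j (S.characteristic i c s) (S.characteristic j d s))) (Icc a b) s := by
  have hneg : ∀ {s}, s ∈ Icc (-b) (-a) → -s ∈ Icc a b := fun hs => neg_mem_Icc_iff.2 hs
  have hLam_i : ∀ s ∈ Icc a b, S.Lam (S.characteristic i c s) i i
      = travelSign i * S.speed i (S.characteristic i c s) := fun s hs =>
    S.Lam_diag i ⟨(hmem s hs).1.trans (hmem s hs).2.1, (hmem s hs).2.2⟩
  have hLam_j : ∀ s ∈ Icc a b, S.Lam (S.characteristic j d s) j j
      = travelSign j * S.speed j (S.characteristic j d s) := fun s hs =>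
    S.Lam_diag j ⟨(hmem s hs).1, (hmem s hs).2.1.trans (hmem s hs).2.2⟩
  have hrev : ∀ (k : Fin 2) (e s : ℝ), HasDerivAt (fun s => S.characteristic k e (-s))
      (travelSign k * S.speed k (S.characteristic k e (-s))) s := fun k e s => by
    simpa [Function.comp_def] using
      (S.hasDerivAt_characteristic k e (-s)).comp s (hasDerivAt_neg s)
  -- The curves of the kernel equation are the characteristics run backwards in time.
  have hpde := hK.pde i j (-b) (-a) (fun s => S.characteristic i c (-s))
    (fun s => S.characteristic j d (-s)) (neg_le_neg hab) fun s hs =>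
      ⟨hmem _ (hneg hs), by rw [hLam_i _ (hneg hs)]; exact (hrev i c s).hasDerivWithinAt,
        by rw [hLam_j _ (hneg hs)]; exact (hrev j d s).hasDerivWithinAt⟩
  intro s hs
  have hder := ((hpde (-s) ⟨neg_le_neg hs.2, neg_le_neg hs.1⟩).comp s
    (hasDerivAt_neg s).hasDerivWithinAt (s := Icc a b)
    (fun t ht => ⟨neg_le_neg ht.2, neg_le_neg ht.1⟩)).const_mul (travelSign j)
  simp only [neg_neg, Function.comp_def] at hder
  have hvalue : ∀ t ∈ Icc a b, S.speed j (S.characteristic j d t) *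
        kernelExt K i j (S.characteristic i c t) (S.characteristic j d t)
      = travelSign j * (K (S.characteristic i c t) (S.characteristic j d t) i j *
        S.Lam (S.characteristic j d t) j j) := fun t ht => by
    rw [kernelExt_of_mem K i j (hmem t ht).1 (hmem t ht).2.1 (hmem t ht).2.2, hLam_j t ht]
    linear_combination (-(S.speed j (S.characteristic j d t) *
      K (S.characteristic i c t) (S.characteristic j d t) i j)) * travelSign_mul_self j
  refine (hder.congr hvalue (hvalue s hs)).congr_deriv ?_
  rw [S.kernelCoupling_of_mem K i j (hmem s hs).1 (hmem s hs).2.1 (hmem s hs).2.2, hLam_j s hs]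
  linear_combination (-(S.speed j (S.characteristic j d s) *
    (K (S.characteristic i c s) (S.characteristic j d s) *
      S.Atilde (S.characteristic j d s)) i j)) * travelSign_mul_self j

section Flux

variable {f y : ℝ → ℝ → ℝ} {i j : Fin 2} {c d a b : ℝ}

theorem IsKernel.speed_mul_kernelExt_mul_sub_eq (hK : S.IsKernel K) (hf : IsSignal f)
    (hyf : S.IsTransported j f y) (ha : 0 ≤ a) (hab : a ≤ b)
    (hmem : ∀ s ∈ Icc a b, 0 ≤ S.characteristic j d s ∧
      S.characteristic j d s ≤ S.characteristic i c s ∧ S.characteristic i c s ≤ 1) :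
    S.speed j (S.characteristic j d b) *
        (kernelExt K i j (S.characteristic i c b) (S.characteristic j d b)
          * y (S.characteristic j d b) b)
      - S.speed j (S.characteristic j d a) *
        (kernelExt K i j (S.characteristic i c a) (S.characteristic j d a)
          * y (S.characteristic j d a) a)
      = ∫ s in a..b, S.speed j (S.characteristic j d s) *
        (kernelExt K i j (S.characteristic i c s) (S.characteristic j d s)
            * f (S.characteristic j d s) s
          - S.kernelCoupling K i j (S.characteristic i c s) (S.characteristic j d s)
            * y (S.characteristic j d s) s) := by
  have hcurves : Continuous fun s => (S.characteristic i c s, S.characteristic j d s) :=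
    (S.continuous_characteristic i c).prodMk (S.continuous_characteristic j d)
  have hu : Continuous fun s => -(S.speed j (S.characteristic j d s) *
      S.kernelCoupling K i j (S.characteristic i c s) (S.characteristic j d s)) :=
    (((S.isBddCont_speed j).1.comp (S.continuous_characteristic j d)).mul
      ((hK.isBddCont_kernelCoupling i j).1.comp hcurves)).neg
  have hsub : ∀ s ∈ Icc a b, ∀ t ∈ Icc a s, t ∈ Icc a b := fun s hs t ht =>
    ⟨ht.1, ht.2.trans hs.2⟩
  rw [← mul_assoc, ← mul_assoc]
  refine (mul_sub_mul_eq_integral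
    (U := fun s => S.speed j (S.characteristic j d s) *
      kernelExt K i j (S.characteristic i c s) (S.characteristic j d s))
    (V := fun s => y (S.characteristic j d s) s) hab (hu.intervalIntegrable _ _)
    (intervalIntegrable_along hf d a b) (fun s hs => Eq.symm ?_) fun s hs => ?_).trans
      (intervalIntegral.integral_congr fun s _ => by ring)
  · have hder := hK.hasDerivWithinAt_characteristic i j hs.1 fun t ht => hmem t (hsub s hs t ht)
    exact intervalIntegral.integral_eq_sub_of_hasDerivAt_of_le hs.1
      (fun t ht => (hder t ht).continuousWithinAt)
      (fun t ht => (hder t (Ioo_subset_Icc_self ht)).hasDerivAt (Icc_mem_nhds ht.1 ht.2))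
      (hu.intervalIntegrable _ _)
  · exact hyf d a s ha hs.1 fun t ht =>
      have hm := hmem t (hsub s hs t ht)
      ⟨hm.1, hm.2.1.trans hm.2.2⟩

theorem IsKernel.isTransported_volterraIntegral (hK : S.IsKernel K) (hf : IsSignal f)
    (hy : IsSignal y) (hyf : S.IsTransported j f y) (i : Fin 2) :
    S.IsTransported i
      (fun z t => S.scaledCoupling i j z * y z t
        - travelSign j * S.speed j 0 * (kernelExt K i j z 0 * y 0 t)
        + (volterraIntegral (kernelExt K i j) f z t
          - volterraIntegral (S.kernelCoupling K i j) y z t))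
      (volterraIntegral (kernelExt K i j) y) := by
  intro c a b ha hab hmem
  have hcurve : Continuous fun p : ℝ × ℝ => (S.characteristic i c p.2, p.1) :=
    ((S.continuous_characteristic i c).comp continuous_snd).prodMk continuous_fst
  have hkernel : IsSignal fun ζ s => kernelExt K i j (S.characteristic i c s) ζ :=
    .of_isBddCont_uncurry ((hK.isBddCont_kernelExt i j).comp hcurve)
  have hcoupling : IsSignal fun ζ s => S.kernelCoupling K i j (S.characteristic i c s) ζ :=
    .of_isBddCont_uncurry ((hK.isBddCont_kernelCoupling i j).comp hcurve)
  have hsign : ∀ z, 0 ≤ S.speed j z + travelSign j * -(travelSign i * S.speed i z) := fun z => by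
    have h₀ := S.speed_pos 0 z
    have h₁ := S.speed_pos 1 z
    fin_cases i <;> fin_cases j <;> norm_num [travelSign] <;> linarith
  have hclamp : ∀ s ∈ Icc a b, unitClamp (S.characteristic i c s) = S.characteristic i c s :=
    fun s hs => unitClamp_of_mem (hmem s hs)
  simp only [volterraIntegral, hclamp b (right_mem_Icc.2 hab), hclamp a (left_mem_Icc.2 hab)]
  refine ((S.isTravelTime j).integral_moving_sub_eq (travelSign_eq j) hab
    (S.hasDerivAt_characteristic i c) (fun s hs => (hmem s hs).1) (fun s _ => hsign _)
    (hkernel.mul hy) ((hkernel.mul hf).sub (hcoupling.mul hy))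
    fun d s₁ h₁ s₂ h₂ h12 hin => ?_).trans (intervalIntegral.integral_congr fun s hs => ?_)
  · exact hK.speed_mul_kernelExt_mul_sub_eq hf hyf (ha.trans h₁.1) h12 fun s hs =>
      ⟨(hin s hs).1, (hin s hs).2, (hmem s ⟨h₁.1.trans hs.1, hs.2.trans h₂.2⟩).2⟩
  · rw [uIcc_of_le hab] at hs
    simp only [hclamp s hs]
    rw [intervalIntegral.integral_sub
      (intervalIntegrable_kernel_mul (hK.isBddCont_kernelExt i j) hf _ s _ _)
      (intervalIntegrable_kernel_mul (hK.isBddCont_kernelCoupling i j) hy _ s _ _),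
      ← hK.diagonal_eq i j (hmem s hs)]
    ring

end Flux

/-- The source `K(z,0) Λ(0) y(0,t)` that the boundary `z = 0` contributes to the transport equation
of `y - ∫ K y`. -/
noncomputable def boundarySource (S : PDEODESystem n) (K : ℝ → ℝ → Matrix (Fin 2) (Fin 2) ℝ)
    (y : Fin 2 → ℝ → ℝ → ℝ) (i : Fin 2) (z t : ℝ) : ℝ :=
  ∑ j, travelSign j * S.speed j 0 * (kernelExt K i j z 0 * y j 0 t)

/-- The defect in the transport equation of the transformed state that is caused by an error `e` in
the coupling term. -/
noncomputable def couplingDefect (S : PDEODESystem n) (K : ℝ → ℝ → Matrix (Fin 2) (Fin 2) ℝ)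
    (e : Fin 2 → ℝ → ℝ → ℝ) (i : Fin 2) (z t : ℝ) : ℝ :=
  volterra (S.kernelCoupling K) e i z t - mulField S.scaledCoupling e i z t

theorem IsKernel.isSignal_boundarySource (hK : S.IsKernel K) {y : Fin 2 → ℝ → ℝ → ℝ}
    (hy : ∀ j, IsSignal (y j)) (i : Fin 2) : IsSignal (S.boundarySource K y i) :=
  IsSignal.sum fun j => (IsSignal.isBddCont_mul ((hK.isBddCont_kernelExt i j).comp
    (Continuous.prodMk_left 0)) ((hy j).comp measurable_const)).const_mul _

theorem IsKernel.isSignal_couplingDefect (hK : S.IsKernel K) {e : Fin 2 → ℝ → ℝ → ℝ}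
    (he : ∀ j, IsSignal (e j)) (i : Fin 2) : IsSignal (S.couplingDefect K e i) :=
  (isSignal_volterra hK.isBddCont_kernelCoupling he i).sub
    (isSignal_mulField S.isBddCont_scaledCoupling he i)

theorem IsKernel.isTransported_sub_volterra (hK : S.IsKernel K) {y w : Fin 2 → ℝ → ℝ → ℝ}
    (hy : ∀ j, IsSignal (y j)) (hw : ∀ j, IsSignal (w j))
    (hyw : ∀ j, S.IsTransported j (mulField S.scaledCoupling w j) (y j)) (i : Fin 2) :
    S.IsTransported i
      (fun z t => S.boundarySource K y i z t
        + S.couplingDefect K (fun j z t => y j z t - w j z t) i z t)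
      (fun z t => y i z t - volterra (kernelExt K) y i z t) := by
  have hf : ∀ j, IsSignal (mulField S.scaledCoupling w j) :=
    isSignal_mulField S.isBddCont_scaledCoupling hw
  have hrate : ∀ j, IsSignal fun z t => S.scaledCoupling i j z * y j z t
        - travelSign j * S.speed j 0 * (kernelExt K i j z 0 * y j 0 t)
        + (volterraIntegral (kernelExt K i j) (mulField S.scaledCoupling w j) z t
          - volterraIntegral (S.kernelCoupling K i j) (y j) z t) := fun j =>
    ((IsSignal.isBddCont_mul (S.isBddCont_scaledCoupling i j) (hy j)).sub
      ((IsSignal.isBddCont_mul ((hK.isBddCont_kernelExt i j).comp (Continuous.prodMk_left 0))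
        ((hy j).comp measurable_const)).const_mul _)).add
      ((IsSignal.intervalIntegral (hK.isBddCont_kernelExt i j) (hf j)).sub
        (IsSignal.intervalIntegral (hK.isBddCont_kernelCoupling i j) (hy j)))
  refine ((hyw i).sub (IsTransported.sum (fun j =>
    hK.isTransported_volterraIntegral (hf j) (hy j) (hyw j) i) hrate) (hf i)
    (IsSignal.sum hrate)).congr (fun z _ t _ => ?_) fun z _ t _ => rfl
  have hvolterra := hK.volterra_mulField_scaledCoupling hw i z t
  rw [couplingDefect, volterra_sub hK.isBddCont_kernelCoupling hy hw, mulField_sub, ← hvolterra]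
  simp only [boundarySource, volterra, mulField, Finset.sum_add_distrib, Finset.sum_sub_distrib]
  ring

end PDEODESystem

/-! ### Volterra equations -/

section VolterraEquation

variable {k : Fin 2 → Fin 2 → ℝ → ℝ → ℝ} {y : Fin 2 → ℝ → ℝ → ℝ}

theorem IsSignal.exists_monotone_bound (hy : ∀ i, IsSignal (y i)) :
    ∃ W : ℝ → ℝ, Monotone W ∧ (∀ t, 0 ≤ W t) ∧ ∀ i z t, |y i z t| ≤ W |t| := by
  choose M hM using fun i => (hy i).2
  refine ⟨fun t => ∑ i, ∑ m ∈ Finset.range (⌈t⌉₊ + 1), |M i m|, fun s t hst => ?_,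
    fun t => Finset.sum_nonneg fun _ _ => Finset.sum_nonneg fun _ _ => abs_nonneg _,
    fun i z t => ?_⟩
  · exact Finset.sum_le_sum fun i _ => Finset.sum_le_sum_of_subset_of_nonneg
      (Finset.range_mono (Nat.succ_le_succ (Nat.ceil_mono hst))) fun _ _ _ => abs_nonneg _
  · calc |y i z t| ≤ |M i ⌈|t|⌉₊| := (hM i _ z t (Nat.le_ceil _)).trans (le_abs_self _)
      _ ≤ ∑ m ∈ Finset.range (⌈|t|⌉₊ + 1), |M i m| :=
        Finset.single_le_sum (f := fun m : ℕ => |M i m|) (fun _ _ => abs_nonneg _)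
          (Finset.mem_range.2 (Nat.lt_succ_self _))
      _ ≤ _ := Finset.single_le_sum
          (f := fun i => ∑ m ∈ Finset.range (⌈|t|⌉₊ + 1), |M i m|)
          (fun _ _ => Finset.sum_nonneg fun _ _ => abs_nonneg _) (Finset.mem_univ i)

theorem IsSignal.of_monotone {W : ℝ → ℝ} (hW : Monotone W) (hW0 : ∀ t, 0 ≤ W t) :
    IsSignal fun _ t => W |t| :=
  ⟨hW.measurable.comp measurable_snd.abs, fun T => ⟨W T, fun _ t ht => by
    rw [abs_of_nonneg (hW0 _)]; exact hW ht⟩⟩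

theorem IsSignal.of_abs_sub_le_geometric {F : ℕ → ℝ → ℝ → ℝ} {f w : ℝ → ℝ → ℝ} {B : ℝ}
    (hF : ∀ n, IsSignal (F n)) (hw : IsSignal w)
    (hFf : ∀ n z t, |F n z t - f z t| ≤ B * (1 / 2) ^ n * w z t) : IsSignal f := by
  constructor
  · refine measurable_of_tendsto_metrizable (fun n => (hF n).1) (tendsto_pi_nhds.2 fun p => ?_)
    rw [tendsto_iff_norm_sub_tendsto_zero]
    refine squeeze_zero (fun n => norm_nonneg _) (fun n => hFf n p.1 p.2) ?_
    simpa using ((tendsto_pow_atTop_nhds_zero_of_lt_one (r := (1 / 2 : ℝ)) (by norm_num)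
      (by norm_num)).const_mul B).mul_const (w p.1 p.2)
  · intro T
    obtain ⟨M, hM⟩ := ((hF 0).2 T)
    obtain ⟨N, hN⟩ := (hw.const_mul B).2 T
    refine ⟨M + N, fun z t ht => ?_⟩
    have hclose := hFf 0 z t
    rw [pow_zero, mul_one] at hclose
    have hsplit : |f z t| ≤ |F 0 z t| + |F 0 z t - f z t| := by
      simpa only [sub_sub_cancel] using abs_sub (F 0 z t) (F 0 z t - f z t)
    exact hsplit.trans (add_le_add (hM z t ht) (hclose.trans ((le_abs_self _).trans (hN z t ht))))

theorem abs_volterra_le {M B ε μ : ℝ} (hM : ∀ i j z ζ, |k i j z ζ| ≤ M) (hμ : 0 < μ)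
    (hMμ : 2 * M ≤ ε * μ) (hB : 0 ≤ B) {z t : ℝ}
    (hy : ∀ j, ∀ ζ ∈ Icc 0 (unitClamp z), |y j ζ t| ≤ B * Real.exp (μ * ζ)) (i : Fin 2) :
    |volterra k y i z t| ≤ ε * B * Real.exp (μ * unitClamp z) := by
  have hM0 : 0 ≤ M := (abs_nonneg _).trans (hM 0 0 0 0)
  have hentry : ∀ j, |volterraIntegral (k i j) (y j) z t|
      ≤ M * B / μ * Real.exp (μ * unitClamp z) := fun j =>
    abs_integral_le_exp (unitClamp_mem z).1 hμ (mul_nonneg hM0 hB) fun ζ hζ => by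
      rw [abs_mul, mul_assoc]
      exact mul_le_mul (hM i j z ζ) (hy j ζ hζ) (abs_nonneg _) hM0
  have hfrac : 2 * (M * B / μ) ≤ ε * B := by
    rw [← mul_div_assoc, div_le_iff₀ hμ]
    nlinarith
  calc |volterra k y i z t| ≤ ∑ j, |volterraIntegral (k i j) (y j) z t| :=
        Finset.abs_sum_le_sum_abs _ _
    _ ≤ ∑ _j : Fin 2, M * B / μ * Real.exp (μ * unitClamp z) :=
        Finset.sum_le_sum fun j _ => hentry j
    _ = 2 * (M * B / μ) * Real.exp (μ * unitClamp z) := by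
        rw [Fin.sum_univ_two]; ring
    _ ≤ _ := mul_le_mul_of_nonneg_right hfrac (Real.exp_pos _).le

theorem exists_sub_volterra_eq (hk : ∀ i j, IsBddCont (Function.uncurry (k i j)))
    {v : Fin 2 → ℝ → ℝ → ℝ} (hv : ∀ i, IsSignal (v i)) :
    ∃ y : Fin 2 → ℝ → ℝ → ℝ, (∀ i, IsSignal (y i)) ∧
      ∀ i z t, y i z t - volterra k y i z t = v i z t := by
  obtain ⟨M, hM0, hM⟩ := exists_forall_abs_le_of_isBddCont fun p : Fin 2 × Fin 2 => hk p.1 p.2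
  obtain ⟨W, hWm, hW0, hW⟩ := IsSignal.exists_monotone_bound hv
  set μ : ℝ := 4 * M + 1
  have hμ : 0 < μ := by positivity
  have hweight : IsSignal fun z t => Real.exp (μ * unitClamp z) * W |t| :=
    .isBddCont_mul (isBddCont_comp_unitClamp (f := fun z => Real.exp (μ * z)) (by fun_prop))
      (.of_monotone hWm hW0)
  have hcontract : ∀ (e : Fin 2 → ℝ → ℝ → ℝ) (B : ℝ), 0 ≤ B →
      (∀ i z t, |e i z t| ≤ B * (Real.exp (μ * unitClamp z) * W |t|)) →
      ∀ i z t, |volterra k e i z t| ≤ B / 2 * (Real.exp (μ * unitClamp z) * W |t|) :=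
    fun e B hB he i z t => (abs_volterra_le (fun i j z ζ => hM (i, j) (z, ζ)) hμ (ε := 1 / 2)
      (by linarith) (mul_nonneg hB (hW0 |t|)) (fun j ζ hζ => by
        have hej := he j ζ t
        rw [unitClamp_of_mem ⟨hζ.1, hζ.2.trans (unitClamp_mem z).2⟩] at hej
        exact hej.trans_eq (by ring)) i).trans_eq (by ring)
  obtain ⟨f, hfP, hf⟩ := exists_fixedPoint_of_weighted_contraction (α := Fin 2 × ℝ × ℝ) (E := ℝ)
    (w := fun x => Real.exp (μ * unitClamp x.2.1) * W |x.2.2|)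
    (P := fun f => ∀ i, IsSignal fun z t => f (i, z, t))
    (Φ := fun f x => v x.1 x.2.1 x.2.2 + volterra k (fun i z t => f (i, z, t)) x.1 x.2.1 x.2.2)
    (f₀ := fun x => v x.1 x.2.1 x.2.2) (M := 1 / 2) (by norm_num) hv
    (fun f hf i => (hv i).add (isSignal_volterra hk hf i))
    (fun x => by
      simp only [add_sub_cancel_left]
      refine hcontract v 1 zero_le_one (fun i z t => ?_) x.1 x.2.1 x.2.2
      rw [one_mul]
      exact (hW i z t).trans (le_mul_of_one_le_left (hW0 _)
        (Real.one_le_exp (mul_nonneg hμ.le (unitClamp_mem z).1))))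
    (fun f h hf hh B hB hfh x => by
      simp only [add_sub_add_left_eq_sub, Real.norm_eq_abs]
      rw [← volterra_sub hk hf hh]
      exact hcontract _ B hB (fun i z t => hfh (i, z, t)) x.1 x.2.1 x.2.2)
    (fun F f B hF hFf i => .of_abs_sub_le_geometric (fun n => hF n i) hweight
      fun n z t => hFf n (i, z, t))
  exact ⟨fun i z t => f (i, z, t), hfP, fun i z t => sub_eq_iff_eq_add.2 (hf (i, z, t))⟩

theorem exists_abs_le_of_sub_volterra (hk : ∀ i j, IsBddCont (Function.uncurry (k i j))) :
    ∃ C : ℝ, 0 < C ∧ ∀ y : Fin 2 → ℝ → ℝ → ℝ, (∀ i, IsSignal (y i)) → ∀ t B,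
      (∀ i, ∀ z ∈ Icc (0 : ℝ) 1, |y i z t - volterra k y i z t| ≤ B) →
      ∀ i, ∀ z ∈ Icc (0 : ℝ) 1, |y i z t| ≤ C * B := by
  obtain ⟨M, hM0, hM⟩ := exists_forall_abs_le_of_isBddCont fun p : Fin 2 × Fin 2 => hk p.1 p.2
  set μ : ℝ := 4 * M + 1
  have hμ : 0 < μ := by positivity
  refine ⟨2 * Real.exp μ, by positivity, fun y hy t B hB i z hz => ?_⟩
  have hB0 : 0 ≤ B := (abs_nonneg _).trans (hB 0 0 ⟨le_rfl, zero_le_one⟩)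
  obtain ⟨W, -, hW0, hW⟩ := IsSignal.exists_monotone_bound hy
  have hone : ∀ x ∈ {x : Fin 2 × ℝ | x.2 ∈ Icc (0 : ℝ) 1}, 1 ≤ Real.exp (μ * x.2) := fun x hx =>
    Real.one_le_exp (mul_nonneg hμ.le hx.1)
  have hbound := norm_le_two_mul_of_contraction (w := fun x => Real.exp (μ * x.2))
    (D := {x : Fin 2 × ℝ | x.2 ∈ Icc (0 : ℝ) 1}) (f := fun x => y x.1 x.2 t) hB0 (hW0 |t|)
    (fun _ _ => (Real.exp_pos _).le)
    (fun x hx => (hW x.1 x.2 t).trans (le_mul_of_one_le_right (hW0 _) (hone x hx)))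
    (fun B' hB' hy' x hx => by
      have hvolterra := abs_volterra_le (fun i j z ζ => hM (i, j) (z, ζ)) hμ (ε := 1 / 2)
        (by linarith) hB' (fun j ζ hζ => hy' (j, ζ) ⟨hζ.1, hζ.2.trans (unitClamp_mem x.2).2⟩) x.1
      rw [unitClamp_of_mem hx] at hvolterra
      calc ‖y x.1 x.2 t‖ ≤ |y x.1 x.2 t - volterra k y x.1 x.2 t| + |volterra k y x.1 x.2 t| := by
            simpa only [sub_add_cancel, Real.norm_eq_abs] using
              abs_add_le (y x.1 x.2 t - volterra k y x.1 x.2 t) (volterra k y x.1 x.2 t)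
        _ ≤ B * Real.exp (μ * x.2) + 1 / 2 * B' * Real.exp (μ * x.2) :=
            add_le_add ((hB x.1 x.2 hx).trans (le_mul_of_one_le_right hB0 (hone x hx))) hvolterra
        _ = _ := by ring) (i, z) hz
  refine hbound.trans ?_
  have hexp : Real.exp (μ * z) ≤ Real.exp μ :=
    Real.exp_le_exp.2 (mul_le_of_le_one_right hμ.le hz.2)
  calc 2 * B * Real.exp (μ * z) ≤ 2 * B * Real.exp μ := by gcongr
    _ = 2 * Real.exp μ * B := by ring

end VolterraEquation

/-! ### From the original system to the transport form -/

theorem volterraIntegral_zero (k y : ℝ → ℝ → ℝ) (t : ℝ) : volterraIntegral k y 0 t = 0 := by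
  rw [volterraIntegral, unitClamp_of_mem ⟨le_rfl, zero_le_one⟩, intervalIntegral.integral_same]

theorem volterra_zero (k : Fin 2 → Fin 2 → ℝ → ℝ → ℝ) (y : Fin 2 → ℝ → ℝ → ℝ) (i : Fin 2)
    (t : ℝ) : volterra k y i 0 t = 0 :=
  Finset.sum_eq_zero fun j _ => volterraIntegral_zero (k i j) (y j) t

theorem volterra_eq_integral {k : Fin 2 → Fin 2 → ℝ → ℝ → ℝ} {y : Fin 2 → ℝ → ℝ → ℝ}
    (hk : ∀ i j, IsBddCont (Function.uncurry (k i j))) (hy : ∀ j, IsSignal (y j)) (i : Fin 2)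
    {z : ℝ} (hz : z ∈ Icc (0 : ℝ) 1) (t : ℝ) :
    volterra k y i z t = ∫ ζ in (0 : ℝ)..z, ∑ j, k i j z ζ * y j ζ t := by
  rw [intervalIntegral.integral_finsetSum fun j _ =>
    intervalIntegrable_kernel_mul (hk i j) (hy j) z t 0 z]
  simp only [volterra, volterraIntegral, unitClamp_of_mem hz]

namespace PDEODESystem

variable {n : ℕ} {S : PDEODESystem n} {K : ℝ → ℝ → Matrix (Fin 2) (Fin 2) ℝ}
  {y : Fin 2 → ℝ → ℝ → ℝ}

theorem IsTransported.mul_left {i : Fin 2} {f y : ℝ → ℝ → ℝ} {k k' : ℝ → ℝ}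
    (h : S.IsTransported i f y) (hf : IsSignal f) (hk : ∀ z, HasDerivAt k (k' z) z)
    (hk' : Continuous k') :
    S.IsTransported i (fun z t => k z * f z t - travelSign i * S.speed i z * k' z * y z t)
      (fun z t => k z * y z t) := by
  intro c a b ha hab hc
  have hderiv : ∀ s, HasDerivAt (fun s => k (S.characteristic i c s))
      (k' (S.characteristic i c s) * -(travelSign i * S.speed i (S.characteristic i c s))) s :=
    fun s => (hk _).comp s (S.hasDerivAt_characteristic i c s)
  have hchar := S.continuous_characteristic i c
  have hcont : Continuous fun s => k' (S.characteristic i c s) *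
      -(travelSign i * S.speed i (S.characteristic i c s)) :=
    (hk'.comp hchar).mul (continuous_const.mul ((S.isBddCont_speed i).1.comp hchar)).neg
  rw [mul_sub_mul_eq_integral (U := fun s => k (S.characteristic i c s))
    (V := fun s => y (S.characteristic i c s) s) hab (hcont.intervalIntegrable a b)
    (intervalIntegrable_along hf c a b)
    (fun s _ => (intervalIntegral.integral_eq_sub_of_hasDerivAt (fun r _ => hderiv r)
      (hcont.intervalIntegrable a s)).symm)
    fun s hs => h c a s ha hs.1 fun r hr => hc r ⟨hr.1, hr.2.trans hs.2⟩]
  exact intervalIntegral.integral_congr fun s _ => by ring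

theorem mulField_scaledCoupling_eq {w : Fin 2 → ℝ} {z t : ℝ} (hz : z ∈ Icc (0 : ℝ) 1)
    (hw : ∀ j, S.scaling j z * w j = y j z t) (i : Fin 2) :
    mulField S.scaledCoupling y i z t
      = S.scaling i z * ((S.A z *ᵥ w) i - S.coupling i i z * w i) := by
  have hoff : ∀ j ∈ Finset.univ.erase i, S.scaledCoupling i j z * y j z t
      = S.scaling i z * (S.coupling i j z * w j) := fun j hj => by
    rw [← hw j, ← mul_assoc, S.scaledCoupling_mul_scaling (Finset.ne_of_mem_erase hj).symm hz,
      mul_assoc]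
  have hA : (S.A z *ᵥ w) i = ∑ j, S.coupling i j z * w j := by
    simp only [coupling, unitClamp_of_mem hz, Matrix.mulVec, dotProduct]
  rw [mulField, hA, ← Finset.add_sum_erase _ _ (Finset.mem_univ i),
    ← Finset.add_sum_erase _ (fun j => S.coupling i j z * w j) (Finset.mem_univ i),
    S.scaledCoupling_self, zero_mul, zero_add, add_sub_cancel_left, Finset.mul_sum,
    Finset.sum_congr rfl hoff]

theorem mulField_coupling_extendTrajectory (S : PDEODESystem n) (x : ℝ → ℝ → Fin 2 → ℝ)
    (i : Fin 2) {z : ℝ} (hz : z ∈ Icc (0 : ℝ) 1) {t : ℝ} (ht : 0 ≤ t) :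
    mulField S.coupling (extendTrajectory x) i z t = (S.A z *ᵥ x z t) i := by
  simp only [mulField, coupling, unitClamp_of_mem hz, extendTrajectory_of_mem x _ hz ht,
    Matrix.mulVec, dotProduct]

-- The scaling is an integrating factor: its derivative along a characteristic cancels `Aᵢᵢ`.
theorem solvesTransport_coupling_iff {x : ℝ → ℝ → Fin 2 → ℝ} (hx : IsStateTrajectory x)
    (hy : ∀ i, IsSignal (y i))
    (hxy : ∀ z ∈ Icc (0 : ℝ) 1, ∀ t, 0 ≤ t → ∀ i, S.scaling i z * x z t i = y i z t) :
    SolvesTransport S.Lam (fun z t => S.A z *ᵥ x z t) x ↔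
      ∀ i, S.IsTransported i (mulField S.scaledCoupling y i) (y i) := by
  have hcont : ∀ i, Continuous fun z => travelSign i * (S.coupling i i z / S.speed i z) := fun i =>
    continuous_const.mul ((S.isBddCont_coupling i i).1.div (S.isBddCont_speed i).1
      fun z => (S.speed_pos i z).ne')
  rw [solvesTransport_iff]
  refine forall_congr' fun i => ⟨fun h => ?_, fun h => ?_⟩
  · have hext : S.IsTransported i (mulField S.coupling (extendTrajectory x) i)
        (extendTrajectory x i) := h.congr
      (fun z hz t ht => S.mulField_coupling_extendTrajectory x i hz ht.le)
      fun z hz t ht => extendTrajectory_of_mem x i hz ht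
    refine (hext.mul_left (isSignal_mulField S.isBddCont_coupling hx.isSignal i)
      (S.hasDerivAt_scaling i) ((S.continuous_scaling i).mul (hcont i))).congr
      (fun z hz t ht => ?_)
      fun z hz t ht => by rw [extendTrajectory_of_mem x i hz ht, hxy z hz t ht]
    have hspeed := (S.speed_pos i z).ne'
    rw [mulField_scaledCoupling_eq hz (hxy z hz t ht.le),
      extendTrajectory_of_mem x i hz ht.le, S.mulField_coupling_extendTrajectory x i hz ht.le]
    field_simp
    linear_combination (S.scaling i z * S.coupling i i z * x z t i) * travelSign_mul_self i
  · have hne : ∀ z, S.scaling i z ≠ 0 := fun z => (S.scaling_pos i z).ne'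
    have hscaling := S.continuous_scaling i
    refine (h.mul_left (isSignal_mulField S.isBddCont_scaledCoupling hy i)
      (fun z => (S.hasDerivAt_scaling i z).inv (hne z))
      ((hscaling.mul (hcont i)).neg.div (hscaling.pow 2) fun z => pow_ne_zero 2 (hne z))).congr
      (fun z hz t ht => ?_) fun z hz t ht => ?_
    · have hspeed := (S.speed_pos i z).ne'
      have hscale := hne z
      rw [mulField_scaledCoupling_eq hz (hxy z hz t ht.le), ← hxy z hz t ht.le]
      simp only [Pi.inv_apply]
      field_simp
      linear_combination -(S.coupling i i z * x z t i) * travelSign_mul_self i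
    · rw [← hxy z hz t ht, Pi.inv_apply, inv_mul_cancel_left₀ (hne z)]

theorem mulVec_E_mulVec_apply (K : ℝ → ℝ → Matrix (Fin 2) (Fin 2) ℝ) {w : Fin 2 → ℝ} {z ζ t : ℝ}
    (hζ : ζ ∈ Icc 0 z) (hz : z ≤ 1) (hw : ∀ j, S.scaling j ζ * w j = y j ζ t) (i : Fin 2) :
    (K z ζ *ᵥ (S.E ζ *ᵥ w)) i = ∑ j, kernelExt K i j z ζ * y j ζ t := by
  rw [Matrix.mulVec, dotProduct]
  refine Finset.sum_congr rfl fun j _ => ?_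
  rw [kernelExt_of_mem K i j hζ.1 hζ.2 hz, ← hw j, S.E_mulVec w j ⟨hζ.1, hζ.2.trans hz⟩]

theorem IsKernel.transform_apply (hK : S.IsKernel K) (hy : ∀ i, IsSignal (y i))
    {w : ℝ → Fin 2 → ℝ} {t : ℝ} (hw : ∀ z ∈ Icc (0 : ℝ) 1, ∀ i, S.scaling i z * w z i = y i z t)
    {z : ℝ} (hz : z ∈ Icc (0 : ℝ) 1) (i : Fin 2) :
    S.transform K w z i = y i z t - volterra (kernelExt K) y i z t := by
  have hcoord : ∀ k, EqOn (fun ζ => (K z ζ *ᵥ (S.E ζ *ᵥ w ζ)) k)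
      (fun ζ => ∑ j, kernelExt K k j z ζ * y j ζ t) (Ioc 0 z) := fun k ζ hζ =>
    mulVec_E_mulVec_apply K (Ioc_subset_Icc_self hζ) hz.2 (hw ζ ⟨hζ.1.le, hζ.2.trans hz.2⟩) k
  have hint : ∀ k, IntegrableOn (fun ζ => (K z ζ *ᵥ (S.E ζ *ᵥ w ζ)) k) (Ioc 0 z) := fun k => by
    refine IntegrableOn.congr_fun ?_ (hcoord k).symm measurableSet_Ioc
    exact integrable_finsetSum _ fun j _ =>
      (intervalIntegrable_kernel_mul (hK.isBddCont_kernelExt k j) (hy j) z t 0 z).1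
  rw [transform, Pi.sub_apply, S.E_mulVec _ i hz, hw z hz i,
    volterra_eq_integral hK.isBddCont_kernelExt hy i hz, intervalIntegral.integral_of_le hz.1,
    intervalIntegral.integral_of_le hz.1, eval_integral hint,
    setIntegral_congr_fun measurableSet_Ioc (hcoord i)]

-- `bc11` and `bc22` cancel the reflection `q₀ y₁(0, t)` in the boundary source.
theorem IsKernel.boundarySource_eq (hK : S.IsKernel K) (hq0 : S.q0 ≠ 0) {v : Fin n → ℝ} {z t : ℝ}
    (hz : z ∈ Icc (0 : ℝ) 1) (hy : y 1 0 t = S.q0 * y 0 0 t + S.c ⬝ᵥ v) (i : Fin 2) :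
    S.boundarySource K y i z t = (S.Cmat K z *ᵥ v) i := by
  have hzero : (0 : ℝ) ∈ Icc (0 : ℝ) 1 := ⟨le_rfl, zero_le_one⟩
  have hC : (S.Cmat K z *ᵥ v) i = K z 0 i 1 * -S.lam 1 0 * (S.c ⬝ᵥ v) := by
    rw [Cmat, ← Matrix.mulVec_mulVec, Matrix.vecMulVec_mulVec]
    simp [Matrix.mulVec, dotProduct, Matrix.mul_apply, Fin.sum_univ_two, Lam]
  have hlam0 := (S.lam_pos 0 0 hzero).ne'
  have hlam1 := (S.lam_pos 1 0 hzero).ne'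
  rw [hC, boundarySource, Fin.sum_univ_two, hy, kernelExt_of_mem K i 0 le_rfl hz.1 hz.2,
    kernelExt_of_mem K i 1 le_rfl hz.1 hz.2, S.speed_of_mem 0 hzero, S.speed_of_mem 1 hzero]
  simp only [travelSign, Matrix.cons_val_zero, Matrix.cons_val_one]
  fin_cases i
  · simp only [Fin.zero_eta, hK.bc11 z hz]
    field_simp
    ring
  · simp only [Fin.mk_one, hK.bc22 z hz]
    field_simp
    ring

theorem IsKernel.newInput_eq (hK : S.IsKernel K) (hy : ∀ i, IsSignal (y i))
    {x : ℝ → ℝ → Fin 2 → ℝ} {t : ℝ}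
    (hxy : ∀ z ∈ Icc (0 : ℝ) 1, ∀ i, S.scaling i z * x z t i = y i z t) (u : ℝ → ℝ) :
    S.newInput K u x t = S.scaling 0 1 * u t
      + (S.q1bar * volterra (kernelExt K) y 1 1 t - volterra (kernelExt K) y 0 1 t) := by
  have hone : (1 : ℝ) ∈ Icc (0 : ℝ) 1 := ⟨zero_le_one, le_rfl⟩
  have hint : ∀ i, IntervalIntegrable (fun ζ => ∑ j, kernelExt K i j 1 ζ * y j ζ t) volume 0 1 :=
    fun i => by
      simpa only [Finset.sum_fn] using IntervalIntegrable.sum Finset.univ fun j _ =>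
        intervalIntegrable_kernel_mul (hK.isBddCont_kernelExt i j) (hy j) 1 t 0 1
  rw [newInput, S.exp_alpha_zero hone, volterra_eq_integral hK.isBddCont_kernelExt hy 1 hone,
    volterra_eq_integral hK.isBddCont_kernelExt hy 0 hone, ← intervalIntegral.integral_const_mul,
    ← intervalIntegral.integral_sub ((hint 1).const_mul _) (hint 0)]
  congr 1
  refine intervalIntegral.integral_congr fun z hz => ?_
  rw [uIcc_of_le zero_le_one] at hz
  simp only [dotProduct, Fin.sum_univ_two (f := fun i => (![-1, S.q1bar] : Fin 2 → ℝ) i * _),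
    mulVec_E_mulVec_apply K hz le_rfl (hxy z hz), Matrix.cons_val_zero, Matrix.cons_val_one]
  ring

theorem IsKernel.boundary_residual_eq (hK : S.IsKernel K) (hy : ∀ i, IsSignal (y i))
    {x : ℝ → ℝ → Fin 2 → ℝ} {t : ℝ}
    (hxy : ∀ z ∈ Icc (0 : ℝ) 1, ∀ i, S.scaling i z * x z t i = y i z t) (u : ℝ → ℝ) :
    y 0 1 t - volterra (kernelExt K) y 0 1 t
        - (S.q1bar * (y 1 1 t - volterra (kernelExt K) y 1 1 t) + S.newInput K u x t)
      = S.scaling 0 1 * (x 1 t 0 - (S.q1 * x 1 t 1 + u t)) := by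
  have hone : (1 : ℝ) ∈ Icc (0 : ℝ) 1 := ⟨zero_le_one, le_rfl⟩
  have hq1bar : S.q1bar * S.scaling 1 1 = S.q1 * S.scaling 0 1 := by
    rw [q1bar, ← S.exp_neg_alpha_one hone, mul_assoc, ← Real.exp_add, add_neg_cancel_right,
      S.exp_alpha_zero hone]
  rw [hK.newInput_eq hy hxy, ← hxy 1 hone 0, ← hxy 1 hone 1]
  linear_combination -(x 1 t 1) * hq1bar

theorem couplingDefect_self (S : PDEODESystem n) (K : ℝ → ℝ → Matrix (Fin 2) (Fin 2) ℝ)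
    (y : Fin 2 → ℝ → ℝ → ℝ) (i : Fin 2) (z t : ℝ) :
    S.couplingDefect K (fun j z t => y j z t - y j z t) i z t = 0 := by
  simp [couplingDefect, volterra, volterraIntegral, mulField]

/-- The scaled trajectory `E x`, extended to the plane. -/
noncomputable def scaledTrajectory (S : PDEODESystem n) (x : ℝ → ℝ → Fin 2 → ℝ) (i : Fin 2)
    (z t : ℝ) : ℝ :=
  S.scaling i (unitClamp z) * extendTrajectory x i z t

theorem scaling_mul_eq_scaledTrajectory (S : PDEODESystem n) (x : ℝ → ℝ → Fin 2 → ℝ) {z : ℝ}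
    (hz : z ∈ Icc (0 : ℝ) 1) {t : ℝ} (ht : 0 ≤ t) (i : Fin 2) :
    S.scaling i z * x z t i = S.scaledTrajectory x i z t := by
  rw [scaledTrajectory, unitClamp_of_mem hz, extendTrajectory_of_mem x i hz ht]

theorem isSignal_scaledTrajectory (S : PDEODESystem n) {x : ℝ → ℝ → Fin 2 → ℝ}
    (hx : IsStateTrajectory x) (i : Fin 2) : IsSignal (S.scaledTrajectory x i) :=
  .isBddCont_mul (isBddCont_comp_unitClamp (S.continuous_scaling i).continuousOn) (hx.isSignal i)

theorem IsKernel.isTransportSolution (hK : S.IsKernel K) (hq0 : S.q0 ≠ 0) {ξ₀ : Fin n → ℝ}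
    {x₀ : ℝ → Fin 2 → ℝ} {u : ℝ → ℝ} {ξ : ℝ → Fin n → ℝ} {x : ℝ → ℝ → Fin 2 → ℝ}
    (h : S.IsSolution ξ₀ x₀ u ξ x) :
    S.IsTransportSolution K ξ₀ (S.transform K x₀) (S.newInput K u x) ξ
      (fun z t => S.transform K (fun ζ => x ζ t) z) := by
  have hzero : (0 : ℝ) ∈ Icc (0 : ℝ) 1 := ⟨le_rfl, zero_le_one⟩
  have hone : (1 : ℝ) ∈ Icc (0 : ℝ) 1 := ⟨zero_le_one, le_rfl⟩
  set y := S.scaledTrajectory x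
  have hy : ∀ i, IsSignal (y i) := S.isSignal_scaledTrajectory h.traj
  have hxy : ∀ z ∈ Icc (0 : ℝ) 1, ∀ t, 0 ≤ t → ∀ i, S.scaling i z * x z t i = y i z t :=
    fun z hz t ht i => S.scaling_mul_eq_scaledTrajectory x hz ht i
  have hyT := (solvesTransport_coupling_iff h.traj hy hxy).1 h.pde
  have htransform : ∀ z ∈ Icc (0 : ℝ) 1, ∀ t, 0 ≤ t → ∀ i, S.transform K (fun ζ => x ζ t) z i
      = y i z t - volterra (kernelExt K) y i z t := fun z hz t ht i =>
    hK.transform_apply hy (fun z hz i => hxy z hz t ht i) hz i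
  have hleft : ∀ t, 0 ≤ t → ∀ i, y i 0 t = x 0 t i := fun t ht i => by
    rw [← hxy 0 hzero t ht, scaling_zero, one_mul]
  have htransform_zero : ∀ t, 0 ≤ t → ∀ i, S.transform K (fun ζ => x ζ t) 0 i = x 0 t i :=
    fun t ht i => by rw [htransform 0 hzero t ht, volterra_zero, sub_zero, hleft t ht]
  refine ⟨isStateTrajectory_of_isSignal
    (fun i => (hy i).sub (isSignal_volterra hK.isBddCont_kernelExt hy i)) htransform, h.cont,
    fun z hz => funext fun i => ?_, fun t ht => ?_, fun t ht => ?_, ?_, fun t ht => ?_⟩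
  · rw [htransform z hz 0 le_rfl, hK.transform_apply hy (t := 0) (fun z hz i => ?_) hz i]
    rw [← h.init z hz, hxy z hz 0 le_rfl]
  · rw [h.ode t ht]
    congr 1
    refine intervalIntegral.integral_congr fun s hs => ?_
    rw [uIcc_of_le ht] at hs
    simp only [htransform_zero s hs.1]
  · simp only [htransform_zero t ht.le]
    exact h.bc0 t ht
  · refine (S.solvesTransport_iff _ _).2 fun i => (hK.isTransported_sub_volterra hy hy hyT i).congr
      (fun z hz t ht => ?_) fun z hz t ht => htransform z hz t ht i
    have hbc0 : y 1 0 t = S.q0 * y 0 0 t + S.c ⬝ᵥ ξ t := by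
      rw [hleft t ht.le, hleft t ht.le]
      exact h.bc0 t ht
    rw [hK.boundarySource_eq hq0 hz hbc0, couplingDefect_self, add_zero]
  · simp only [htransform 1 hone t ht.le]
    have hresidual := hK.boundary_residual_eq hy (fun z hz i => hxy z hz t ht.le i) u
    rw [h.bc1 t ht, sub_self, mul_zero] at hresidual
    exact sub_eq_zero.1 hresidual

end PDEODESystem

/-! ### Uniqueness and the converse -/

/-- The time at which the `i`-th characteristic with label `c` is at its data point: the
characteristics of the first family are followed forward in time to `z = 0`, those of the second
family backward in time to `z = 0` or to `t = 0`. -/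
noncomputable def entryTime (i : Fin 2) (c : ℝ) : ℝ := if i = 0 then c else max (-c) 0

theorem measurable_entryTime (i : Fin 2) : Measurable (entryTime i) := by
  unfold entryTime
  split_ifs
  · exact measurable_id
  · exact measurable_neg.max measurable_const

namespace PDEODESystem

variable {n : ℕ} {S : PDEODESystem n} {K : ℝ → ℝ → Matrix (Fin 2) (Fin 2) ℝ} {i : Fin 2}
  {f y : ℝ → ℝ → ℝ}

/-- The label of the `i`-th characteristic through `(z, t)`. -/
noncomputable def label (S : PDEODESystem n) (i : Fin 2) (z t : ℝ) : ℝ :=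
  S.travelTime i z + travelSign i * t

theorem characteristic_label (i : Fin 2) (z t : ℝ) :
    S.characteristic i (S.label i z t) t = z := by
  simp [characteristic, label]

theorem label_characteristic (i : Fin 2) (c s : ℝ) :
    S.label i (S.characteristic i c s) s = c := by
  simp [characteristic, label]

theorem measurable_characteristic (i : Fin 2) {α : Type*} [MeasurableSpace α] {c s : α → ℝ}
    (hc : Measurable c) (hs : Measurable s) : Measurable fun p => S.characteristic i (c p) (s p) :=
  (S.travelTime i).symm.continuous.measurable.comp (hc.sub (measurable_const.mul hs))

theorem entryTime_label_zero (i : Fin 2) {t : ℝ} (ht : 0 ≤ t) :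
    entryTime i (S.label i 0 t) = t := by
  fin_cases i <;> simp [entryTime, label, travelSign, (S.isTravelTime _).map_zero, ht]

/-- The part of the space-time domain below a characteristic of the first family, which reaches
`z = 0` at the time `T`. With a point it contains all points to its left at the same time, and the
characteristics from the point to their data points. -/
def dependenceDomain (S : PDEODESystem n) (T : ℝ) : Set (ℝ × ℝ) :=
  {p | p.1 ∈ Icc (0 : ℝ) 1 ∧ 0 ≤ p.2 ∧ p.2 + S.travelTime 0 p.1 ≤ T}

theorem mem_dependenceDomain_of_mem_Icc {T z ζ t : ℝ} (h : (z, t) ∈ S.dependenceDomain T)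
    (hζ : ζ ∈ Icc 0 z) : (ζ, t) ∈ S.dependenceDomain T :=
  ⟨⟨hζ.1, hζ.2.trans h.1.2⟩, h.2.1,
    (add_le_add le_rfl ((S.travelTime 0).monotone hζ.2)).trans h.2.2⟩

theorem characteristic_mem_dependenceDomain {T z t s : ℝ} (h : (z, t) ∈ S.dependenceDomain T)
    (hs : s ∈ uIcc (entryTime i (S.label i z t)) t) :
    (S.characteristic i (S.label i z t) s, s) ∈ S.dependenceDomain T ∧
      S.characteristic i (S.label i z t) s ≤ z := by
  set γ := S.characteristic i (S.label i z t)
  obtain ⟨⟨hz0, hz1⟩, ht, hT⟩ := h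
  dsimp only at hz0 hz1 ht hT
  have htime : S.travelTime i (γ s) = S.travelTime i z + travelSign i * (t - s) := by
    simp only [γ, characteristic, label, OrderIso.apply_symm_apply]
    ring
  have hnonneg : 0 ≤ S.travelTime i (γ s) → 0 ≤ γ s := fun h =>
    (S.travelTime i).le_iff_le.1 ((S.isTravelTime i).map_zero.trans_le h)
  have hle : S.travelTime i (γ s) ≤ S.travelTime i z → γ s ≤ z := (S.travelTime i).le_iff_le.1
  have hz := (S.isTravelTime i).nonneg hz0
  fin_cases i
  · simp only [entryTime, label, travelSign, Fin.zero_eta, if_true, Matrix.cons_val_zero, one_mul]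
      at hs htime hnonneg hle hz
    rw [uIcc_of_ge (by linarith)] at hs
    have hγz := hle (by linarith [hs.1])
    exact ⟨⟨⟨hnonneg (by linarith [hs.2]), hγz.trans hz1⟩, ht.trans hs.1, by dsimp only; linarith⟩,
      hγz⟩
  · simp only [entryTime, label, travelSign, Fin.mk_one, one_ne_zero, if_false,
      Matrix.cons_val_one, Matrix.cons_val_fin_one, neg_one_mul] at hs htime hnonneg hle hz
    rw [uIcc_of_le (max_le (by linarith) ht)] at hs
    have hγz := hle (by linarith [hs.2])
    have hdelay := (S.travelTime 0).monotone hγz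
    have hentry := max_le_iff.1 hs.1
    exact ⟨⟨⟨hnonneg (by linarith), hγz.trans hz1⟩, hentry.2, by dsimp only; linarith [hs.2]⟩, hγz⟩

theorem mem_dependenceDomain {z t : ℝ} (hz : z ∈ Icc (0 : ℝ) 1) (ht : 0 ≤ t) :
    (z, t) ∈ S.dependenceDomain (t + S.travelTime 0 z) :=
  ⟨hz, ht, le_rfl⟩

/-- The trajectory that is transported with source `f` and coincides with `y` at the data points;
it is extended from the space-time domain to the plane by retraction. -/
noncomputable def transported (S : PDEODESystem n) (i : Fin 2) (y f : ℝ → ℝ → ℝ) (z t : ℝ) : ℝ :=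
  let c := S.label i (unitClamp z) (max 0 t)
  y (S.characteristic i c (entryTime i c)) (entryTime i c)
    + ∫ s in entryTime i c..max 0 t, f (S.characteristic i c s) s

theorem transported_of_mem {z t : ℝ} (hz : z ∈ Icc (0 : ℝ) 1) (ht : 0 ≤ t) :
    S.transported i y f z t
      = y (S.characteristic i (S.label i z t) (entryTime i (S.label i z t)))
          (entryTime i (S.label i z t))
        + ∫ s in entryTime i (S.label i z t)..t, f (S.characteristic i (S.label i z t) s) s := by
  rw [transported, unitClamp_of_mem hz, max_eq_right ht]

theorem transported_eq_of_entryTime_eq {z t : ℝ} (hz : z ∈ Icc (0 : ℝ) 1) (ht : 0 ≤ t)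
    (h : entryTime i (S.label i z t) = t) : S.transported i y f z t = y z t := by
  rw [transported_of_mem hz ht, h, characteristic_label, intervalIntegral.integral_same, add_zero]

theorem isTransported_transported (hf : IsSignal f) :
    S.IsTransported i f (S.transported i y f) := by
  intro c a b ha hab hc
  rw [transported_of_mem (hc b (right_mem_Icc.2 hab)) (ha.trans hab),
    transported_of_mem (hc a (left_mem_Icc.2 hab)) ha, label_characteristic,
    label_characteristic, add_sub_add_left_eq_sub]
  exact intervalIntegral.integral_interval_sub_left (intervalIntegrable_along hf _ _ _)
    (intervalIntegrable_along hf _ _ _)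

theorem measurable_transport_along (hy : IsSignal y) (hf : IsSignal f) {α : Type*}
    [MeasurableSpace α] {c u : α → ℝ} (hc : Measurable c) (hu : Measurable u) :
    Measurable fun a => y (S.characteristic i (c a) (entryTime i (c a))) (entryTime i (c a))
      + ∫ s in entryTime i (c a)..u a, f (S.characteristic i (c a) s) s := by
  have hentry : Measurable fun a => entryTime i (c a) := (measurable_entryTime i).comp hc
  have hsource : Measurable (Function.uncurry fun a s => f (S.characteristic i (c a) s) s) :=
    hf.1.comp ((measurable_characteristic i (hc.comp measurable_fst)
      measurable_snd).prodMk measurable_snd)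
  exact (hy.1.comp ((measurable_characteristic i hc hentry).prodMk hentry)).add
    (measurable_intervalIntegral_param hsource hentry hu)

theorem isSignal_transported (hy : IsSignal y) (hf : IsSignal f) :
    IsSignal (S.transported i y f) := by
  constructor
  · have ht : Measurable fun p : ℝ × ℝ => max 0 p.2 := measurable_const.max measurable_snd
    have hlabel : Measurable fun p : ℝ × ℝ => S.label i (unitClamp p.1) (max 0 p.2) :=
      (((S.travelTime i).continuous.comp continuous_unitClamp).measurable.comp
        measurable_fst).add (measurable_const.mul ht)
    exact measurable_transport_along hy hf hlabel ht
  · intro T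
    set T' := max 0 T + S.travelTime 0 1
    obtain ⟨Y, hY⟩ := hy.2 T'
    obtain ⟨Φ, hΦ⟩ := hf.2 T'
    refine ⟨Y + Φ * (T' - 0), fun z t ht => ?_⟩
    set c := S.label i (unitClamp z) (max 0 t)
    have hmem : ∀ s ∈ uIcc (entryTime i c) (max 0 t), 0 ≤ s ∧ s ≤ T' := fun s hs => by
      obtain ⟨⟨hγ, hs0, hsT⟩, -⟩ := characteristic_mem_dependenceDomain
        (mem_dependenceDomain (unitClamp_mem z) (le_max_left 0 t)) hs
      exact ⟨hs0, (le_add_of_nonneg_right ((S.isTravelTime 0).nonneg hγ.1)).trans (hsT.trans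
        (add_le_add (max_le_max le_rfl ((le_abs_self t).trans ht))
          ((S.travelTime 0).monotone (unitClamp_mem z).2)))⟩
    have habs : ∀ s ∈ uIcc (entryTime i c) (max 0 t), |s| ≤ T' := fun s hs => by
      rw [abs_of_nonneg (hmem s hs).1]
      exact (hmem s hs).2
    have hΦ0 : 0 ≤ Φ := (abs_nonneg _).trans (hΦ 0 _ (habs _ right_mem_uIcc))
    refine (abs_add_le _ _).trans (add_le_add (hY _ _ (habs _ left_mem_uIcc)) ?_)
    refine (intervalIntegral.norm_integral_le_of_norm_le_const
      (f := fun s => f (S.characteristic i c s) s) fun s hs =>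
      hΦ _ _ (habs s (uIoc_subset_uIcc hs))).trans (mul_le_mul_of_nonneg_left ?_ hΦ0)
    exact abs_sub_le_of_nonneg_of_le (hmem _ right_mem_uIcc).1 (hmem _ right_mem_uIcc).2
      (hmem _ left_mem_uIcc).1 (hmem _ left_mem_uIcc).2 |>.trans_eq (sub_zero _).symm

theorem exists_inv_speed_le (S : PDEODESystem n) (i : Fin 2) :
    ∃ Λ : ℝ, ∀ z, (S.speed i z)⁻¹ ≤ Λ := by
  have hinv : IsBddCont fun z => (S.lam i (unitClamp z))⁻¹ :=
    isBddCont_comp_unitClamp ((S.lam_cont i).inv₀ fun z hz => (S.lam_pos i z hz).ne')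
  exact hinv.2.imp fun _ hM z => (le_abs_self _).trans (hM z)

-- `exp (μ γ)` has the derivative `μ γ' exp (μ γ)`, and `|γ'| ≥ 1 / Λ`.
theorem abs_integral_exp_characteristic_le {Λ μ : ℝ} (hΛ : ∀ z, (S.speed i z)⁻¹ ≤ Λ) (hμ : 0 < μ)
    (c a b : ℝ) :
    |∫ s in a..b, Real.exp (μ * S.characteristic i c s)| ≤ Λ / μ *
      |Real.exp (μ * S.characteristic i c b) - Real.exp (μ * S.characteristic i c a)| := by
  set γ := S.characteristic i c
  have hΛ0 : 0 < Λ := (inv_pos.2 (S.speed_pos i 0)).trans_le (hΛ 0)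
  have hcont : Continuous fun s => Real.exp (μ * γ s) :=
    Real.continuous_exp.comp (continuous_const.mul (S.continuous_characteristic i c))
  have hcont' : Continuous fun s => S.speed i (γ s) * Real.exp (μ * γ s) :=
    ((S.isBddCont_speed i).1.comp (S.continuous_characteristic i c)).mul hcont
  have hderiv : ∀ s, HasDerivAt (fun s => -(travelSign i / μ) * Real.exp (μ * γ s))
      (S.speed i (γ s) * Real.exp (μ * γ s)) s := fun s => by
    refine ((((S.hasDerivAt_characteristic i c s).const_mul μ).exp).const_mul _).congr_deriv ?_
    field_simp
    linear_combination Real.exp (μ * γ s) * S.speed i (γ s) * travelSign_mul_self i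
  have hbound : ∀ s, ‖Real.exp (μ * γ s)‖ ≤ Λ * (S.speed i (γ s) * Real.exp (μ * γ s)) :=
    fun s => by
      rw [Real.norm_eq_abs, Real.abs_exp, ← mul_assoc]
      exact le_mul_of_one_le_left (Real.exp_pos _).le
        ((inv_le_iff_one_le_mul₀ (S.speed_pos i _)).1 (hΛ _))
  refine (intervalIntegral.norm_integral_le_abs_of_norm_le (.of_forall hbound)
    ((hcont'.const_mul Λ).intervalIntegrable a b)).trans_eq ?_
  rw [intervalIntegral.integral_const_mul, intervalIntegral.integral_eq_sub_of_hasDerivAt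
    (fun s _ => hderiv s) (hcont'.intervalIntegrable a b), ← mul_sub, abs_mul, abs_mul, abs_neg,
    abs_div, abs_of_pos hΛ0, abs_of_pos hμ]
  rcases travelSign_eq i with h | h <;> rw [h] <;> simp only [abs_neg, abs_one] <;> ring

theorem IsTransported.sub_eq_integral (hy : S.IsTransported i f y) {c a b : ℝ} (ha : 0 ≤ a)
    (hb : 0 ≤ b) (hc : ∀ s ∈ uIcc a b, S.characteristic i c s ∈ Icc (0 : ℝ) 1) :
    y (S.characteristic i c b) b - y (S.characteristic i c a) a
      = ∫ s in a..b, f (S.characteristic i c s) s := by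
  rcases le_total a b with hab | hab
  · exact hy c a b ha hab (by rwa [uIcc_of_le hab] at hc)
  · rw [intervalIntegral.integral_symm, ← hy c b a hb hab (by rwa [uIcc_of_ge hab] at hc), neg_sub]

theorem IsTransported.abs_sub_le (hy : S.IsTransported i f y) {Λ μ C z c a b : ℝ}
    (hΛ : ∀ z, (S.speed i z)⁻¹ ≤ Λ) (hμ : 0 < μ) (hC : 0 ≤ C) (ha : 0 ≤ a) (hb : 0 ≤ b)
    (hz : z ≤ 1) (hc : ∀ s ∈ uIcc a b, S.characteristic i c s ∈ Icc 0 z)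
    (hf : ∀ s ∈ uIcc a b,
      |f (S.characteristic i c s) s| ≤ C * Real.exp (μ * S.characteristic i c s)) :
    |y (S.characteristic i c b) b - y (S.characteristic i c a) a|
      ≤ C * (Λ / μ) * Real.exp (μ * z) := by
  have hΛ0 : 0 < Λ := (inv_pos.2 (S.speed_pos i 0)).trans_le (hΛ 0)
  have hexp : ∀ s ∈ uIcc a b, Real.exp (μ * S.characteristic i c s) ≤ Real.exp (μ * z) :=
    fun s hs => Real.exp_le_exp.2 (mul_le_mul_of_nonneg_left (hc s hs).2 hμ.le)
  have hcont : Continuous fun s => C * Real.exp (μ * S.characteristic i c s) :=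
    (Real.continuous_exp.comp ((S.continuous_characteristic i c).const_mul μ)).const_mul C
  rw [hy.sub_eq_integral ha hb fun s hs => ⟨(hc s hs).1, (hc s hs).2.trans hz⟩]
  calc |∫ s in a..b, f (S.characteristic i c s) s|
      ≤ |∫ s in a..b, C * Real.exp (μ * S.characteristic i c s)| :=
        intervalIntegral.norm_integral_le_abs_of_norm_le
          (f := fun s => f (S.characteristic i c s) s)
          ((ae_restrict_iff' measurableSet_uIoc).2
            (.of_forall fun s hs => hf s (uIoc_subset_uIcc hs)))
          (hcont.intervalIntegrable a b)
    _ = C * |∫ s in a..b, Real.exp (μ * S.characteristic i c s)| := by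
        rw [intervalIntegral.integral_const_mul, abs_mul, abs_of_nonneg hC]
    _ ≤ C * (Λ / μ * |Real.exp (μ * S.characteristic i c b)
          - Real.exp (μ * S.characteristic i c a)|) :=
        mul_le_mul_of_nonneg_left (abs_integral_exp_characteristic_le hΛ hμ c a b) hC
    _ ≤ C * (Λ / μ * Real.exp (μ * z)) := by
        have hdiff := abs_sub_le_of_nonneg_of_le (Real.exp_pos _).le (hexp b right_mem_uIcc)
          (Real.exp_pos _).le (hexp a left_mem_uIcc)
        gcongr
    _ = C * (Λ / μ) * Real.exp (μ * z) := (mul_assoc _ _ _).symm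

section Uniqueness

variable {e : Fin 2 → ℝ → ℝ → ℝ}

theorem abs_couplingDefect_le {N A B μ : ℝ} (hN : ∀ i j z ζ, |S.kernelCoupling K i j z ζ| ≤ N)
    (hA : ∀ i j z, |S.scaledCoupling i j z| ≤ A) (hμ : 0 < μ) (hNμ : 2 * N ≤ μ) (hB : 0 ≤ B)
    {z t : ℝ} (hz : z ∈ Icc (0 : ℝ) 1)
    (he : ∀ j, ∀ ζ ∈ Icc 0 z, |e j ζ t| ≤ B * Real.exp (μ * ζ)) (i : Fin 2) :
    |S.couplingDefect K e i z t| ≤ (2 * A + 1) * B * Real.exp (μ * z) := by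
  have hA0 : 0 ≤ A := (abs_nonneg _).trans (hA 0 0 0)
  have hvolterra := abs_volterra_le hN hμ (ε := 1) (by rwa [one_mul]) hB
    (fun j ζ hζ => he j ζ (by rwa [unitClamp_of_mem hz] at hζ)) i
  rw [unitClamp_of_mem hz, one_mul] at hvolterra
  have hmul : |mulField S.scaledCoupling e i z t| ≤ ∑ _j : Fin 2, A * (B * Real.exp (μ * z)) := by
    refine (Finset.abs_sum_le_sum_abs _ _).trans (Finset.sum_le_sum fun j _ => ?_)
    rw [abs_mul]
    exact mul_le_mul (hA i j z) (he j z ⟨hz.1, le_rfl⟩) (abs_nonneg _) hA0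
  calc |S.couplingDefect K e i z t|
      ≤ B * Real.exp (μ * z) + ∑ _j : Fin 2, A * (B * Real.exp (μ * z)) :=
        (abs_sub _ _).trans (add_le_add hvolterra hmul)
    _ = (2 * A + 1) * B * Real.exp (μ * z) := by rw [Fin.sum_univ_two]; ring

-- As `e` vanishes at the data point of the characteristic through `(z, t)`, only the Volterra term
-- of the transported difference remains there.
theorem abs_le_of_isTransported_couplingDefect {M N A Λ B μ T : ℝ}
    (hM : ∀ i j z ζ, |kernelExt K i j z ζ| ≤ M) (hN : ∀ i j z ζ, |S.kernelCoupling K i j z ζ| ≤ N)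
    (hA : ∀ i j z, |S.scaledCoupling i j z| ≤ A) (hΛ : ∀ i z, (S.speed i z)⁻¹ ≤ Λ) (hμ : 0 < μ)
    (hMμ : 2 * M ≤ 1 / 8 * μ) (hNμ : 2 * N ≤ μ) (hAμ : 4 * ((2 * A + 1) * Λ) ≤ μ)
    (heT : ∀ i, S.IsTransported i (S.couplingDefect K e i)
      fun z t => e i z t - volterra (kernelExt K) e i z t)
    (h0 : ∀ i, ∀ z ∈ Icc (0 : ℝ) 1, ∀ t, 0 ≤ t → entryTime i (S.label i z t) = t → e i z t = 0)
    (hB : 0 ≤ B)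
    (he : ∀ i z t, (z, t) ∈ S.dependenceDomain T → |e i z t| ≤ B * Real.exp (μ * z)) (i : Fin 2)
    {z t : ℝ} (hzt : (z, t) ∈ S.dependenceDomain T) :
    |e i z t| ≤ B / 2 * Real.exp (μ * z) := by
  set c := S.label i z t
  set γ := S.characteristic i c
  set τ := entryTime i c
  have hpath : ∀ s ∈ uIcc τ t, (γ s, s) ∈ S.dependenceDomain T ∧ γ s ≤ z := fun s hs =>
    characteristic_mem_dependenceDomain hzt hs
  have hslice : ∀ {ζ s}, (ζ, s) ∈ S.dependenceDomain T → ∀ j, ∀ η ∈ Icc 0 ζ,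
      |e j η s| ≤ B * Real.exp (μ * η) := fun h j η hη =>
    he j η _ (mem_dependenceDomain_of_mem_Icc h hη)
  have hvolterra : ∀ s ∈ uIcc τ t, |volterra (kernelExt K) e i (γ s) s|
      ≤ 1 / 8 * B * Real.exp (μ * z) := fun s hs => by
    obtain ⟨hD, hγz⟩ := hpath s hs
    have hweighted := abs_volterra_le hM hμ hMμ hB
      (fun j η hη => hslice hD j η (by rwa [unitClamp_of_mem hD.1] at hη)) i
    rw [unitClamp_of_mem hD.1] at hweighted
    exact hweighted.trans (by gcongr)
  have hincrement := (heT i).abs_sub_le (hΛ i) hμ (C := (2 * A + 1) * B) (c := c)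
    (mul_nonneg (by linarith [(abs_nonneg _).trans (hA 0 0 0)]) hB)
    (hpath τ left_mem_uIcc).1.2.1 hzt.2.1 hzt.1.2
    (fun s hs => ⟨(hpath s hs).1.1.1, (hpath s hs).2⟩)
    fun s hs => abs_couplingDefect_le hN hA hμ hNμ hB (hpath s hs).1.1 (hslice (hpath s hs).1) i
  have hfrac : (2 * A + 1) * B * (Λ / μ) ≤ B / 4 := by
    rw [← mul_div_assoc, div_le_iff₀ hμ]
    nlinarith
  have hentry : e i (γ τ) τ = 0 :=
    h0 i _ (hpath τ left_mem_uIcc).1.1 τ (hpath τ left_mem_uIcc).1.2.1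
      (by rw [label_characteristic])
  have hend := hvolterra t right_mem_uIcc
  have hstart := hvolterra τ left_mem_uIcc
  have hincrement' := hincrement.trans (mul_le_mul_of_nonneg_right hfrac (Real.exp_pos _).le)
  simp only [γ, c, characteristic_label] at hend hincrement'
  rw [show e i (S.characteristic i (S.label i z t) τ) τ = 0 from hentry] at hincrement'
  rw [abs_le] at *
  constructor <;> linarith

theorem IsKernel.eq_zero_of_isTransported_couplingDefect (hK : S.IsKernel K)
    (he : ∀ i, IsSignal (e i))
    (heT : ∀ i, S.IsTransported i (S.couplingDefect K e i)
      fun z t => e i z t - volterra (kernelExt K) e i z t)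
    (h0 : ∀ i, ∀ z ∈ Icc (0 : ℝ) 1, ∀ t, 0 ≤ t → entryTime i (S.label i z t) = t → e i z t = 0)
    (i : Fin 2) {z t : ℝ} (hz : z ∈ Icc (0 : ℝ) 1) (ht : 0 ≤ t) : e i z t = 0 := by
  obtain ⟨M, hM0, hM⟩ := exists_forall_abs_le_of_isBddCont fun p : Fin 2 × Fin 2 =>
    hK.isBddCont_kernelExt p.1 p.2
  obtain ⟨N, hN0, hN⟩ := exists_forall_abs_le_of_isBddCont fun p : Fin 2 × Fin 2 =>
    hK.isBddCont_kernelCoupling p.1 p.2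
  obtain ⟨A, hA0, hA⟩ := exists_forall_abs_le_of_isBddCont fun p : Fin 2 × Fin 2 =>
    S.isBddCont_scaledCoupling p.1 p.2
  choose Λ hΛ using S.exists_inv_speed_le
  have hΛ' : ∀ i z, (S.speed i z)⁻¹ ≤ max (Λ 0) (Λ 1) := Fin.forall_fin_two.2
    ⟨fun z => (hΛ 0 z).trans (le_max_left _ _), fun z => (hΛ 1 z).trans (le_max_right _ _)⟩
  have hΛ0 : 0 < max (Λ 0) (Λ 1) := (inv_pos.2 (S.speed_pos 0 0)).trans_le (hΛ' 0 0)
  set L := max (Λ 0) (Λ 1)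
  set μ : ℝ := 16 * M + 2 * N + 4 * ((2 * A + 1) * L)
  have hμ : 0 < μ := by positivity
  have hAL : 0 < 4 * ((2 * A + 1) * L) := by positivity
  set T := t + S.travelTime 0 z
  obtain ⟨W, hWm, hW0, hW⟩ := IsSignal.exists_monotone_bound he
  have hbound : ∀ i ζ s, (ζ, s) ∈ S.dependenceDomain T →
      |e i ζ s| ≤ W T * Real.exp (μ * ζ) := fun i ζ s hζs => by
    have hs : |s| ≤ T := by
      rw [abs_of_nonneg hζs.2.1]
      exact (le_add_of_nonneg_right ((S.isTravelTime 0).nonneg hζs.1.1)).trans hζs.2.2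
    exact ((hW i ζ s).trans (hWm hs)).trans
      (le_mul_of_one_le_right (hW0 T) (Real.one_le_exp (mul_nonneg hμ.le hζs.1.1)))
  have hzero := norm_le_two_mul_of_contraction
    (D := {x : Fin 2 × ℝ × ℝ | x.2 ∈ S.dependenceDomain T})
    (f := fun x => e x.1 x.2.1 x.2.2) (w := fun x => Real.exp (μ * x.2.1)) (M := 0) le_rfl
    (hW0 T) (fun _ _ => (Real.exp_pos _).le) (fun x hx => hbound x.1 x.2.1 x.2.2 hx)
    (fun B hB hBe x hx => by
      rw [zero_add]
      exact abs_le_of_isTransported_couplingDefect (fun i j z ζ => hM (i, j) (z, ζ))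
        (fun i j z ζ => hN (i, j) (z, ζ)) (fun i j z => hA (i, j) z) hΛ' hμ (by linarith)
        (by linarith) (by linarith) heT h0 hB (fun i z t hzt => hBe (i, z, t) hzt) x.1 hx)
    (i, z, t) (mem_dependenceDomain hz ht)
  simpa using hzero

end Uniqueness

-- The trajectory transported with the source `Ã y` from the values of `y` at the data points
-- coincides with `y`, because their difference solves a homogeneous problem.
theorem IsKernel.isTransported_of_sub_volterra (hK : S.IsKernel K) {y : Fin 2 → ℝ → ℝ → ℝ}
    (hy : ∀ i, IsSignal (y i))
    (hyT : ∀ i, S.IsTransported i (S.boundarySource K y i)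
      fun z t => y i z t - volterra (kernelExt K) y i z t) (i : Fin 2) :
    S.IsTransported i (mulField S.scaledCoupling y i) (y i) := by
  have hf : ∀ i, IsSignal (mulField S.scaledCoupling y i) :=
    isSignal_mulField S.isBddCont_scaledCoupling hy
  set w : Fin 2 → ℝ → ℝ → ℝ := fun i => S.transported i (y i) (mulField S.scaledCoupling y i)
  have hw : ∀ i, IsSignal (w i) := fun i => isSignal_transported (hy i) (hf i)
  have hwT : ∀ i, S.IsTransported i (mulField S.scaledCoupling y i) (w i) := fun i =>
    isTransported_transported (hf i)
  have hwy : ∀ i, ∀ z ∈ Icc (0 : ℝ) 1, ∀ t, 0 ≤ t → entryTime i (S.label i z t) = t →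
      w i z t = y i z t := fun i z hz t ht h => transported_eq_of_entryTime_eq hz ht h
  have he : ∀ i, IsSignal fun z t => w i z t - y i z t := fun i => (hw i).sub (hy i)
  have heT : ∀ i, S.IsTransported i (S.couplingDefect K (fun j z t => w j z t - y j z t) i)
      fun z t => (w i z t - y i z t)
        - volterra (kernelExt K) (fun j z t => w j z t - y j z t) i z t := fun i => by
    refine ((hK.isTransported_sub_volterra hw hy hwT i).sub (hyT i)
      ((hK.isSignal_boundarySource hw i).add (hK.isSignal_couplingDefect he i))
      (hK.isSignal_boundarySource hy i)).congr (fun z _ t ht => ?_) fun z _ t _ => ?_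
    · have hboundary : S.boundarySource K w i z t = S.boundarySource K y i z t := by
        simp only [boundarySource, hwy _ 0 ⟨le_rfl, zero_le_one⟩ t ht.le
          (entryTime_label_zero _ ht.le)]
      rw [hboundary, add_sub_cancel_left]
    · rw [volterra_sub hK.isBddCont_kernelExt hw hy]
      ring
  refine (hwT i).congr (fun _ _ _ _ => rfl) fun z hz t ht => (sub_eq_zero.1 ?_).symm
  exact hK.eq_zero_of_isTransported_couplingDefect he heT
    (fun i z hz t ht h => sub_eq_zero.2 (hwy i z hz t ht h)) i hz ht

end PDEODESystem

/-! ### Goursat problems on the triangle -/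

/-- A row of the kernel equations in travel-time form, a Goursat problem on the triangle. The
unknown `a` starts from `κ * b` at `ζ = 0` and has the rate `rateA ζ * b` along the curves on which
`φ z - φ ζ` is constant; the unknown `b` starts from `diagonalValue` on the diagonal and has the
rate `rateB ζ * a` along the curves on which `φ z + ψ ζ` is constant. -/
structure GoursatProblem where
  φ : ℝ ≃o ℝ
  ψ : ℝ ≃o ℝ
  φ_zero : φ 0 = 0
  ψ_zero : ψ 0 = 0
  κ : ℝ
  rateA : ℝ → ℝ
  rateB : ℝ → ℝ
  diagonalValue : ℝ → ℝ
  continuous_rateA : Continuous rateA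
  continuous_rateB : Continuous rateB
  continuous_diagonalValue : Continuous diagonalValue

theorem continuous_of_norm_sub_le_geometric {α E : Type*} [TopologicalSpace α]
    [NormedAddCommGroup E] {F : ℕ → α → E} {f : α → E} {C : ℝ} (hF : ∀ n, Continuous (F n))
    (hFf : ∀ n x, ‖F n x - f x‖ ≤ C * (1 / 2) ^ n) : Continuous f := by
  have hlim : Filter.Tendsto (fun n : ℕ => C * (1 / 2 : ℝ) ^ n) Filter.atTop (nhds 0) := by
    simpa only [mul_zero] using (tendsto_pow_atTop_nhds_zero_of_lt_one (r := (1 / 2 : ℝ))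
      (by norm_num) (by norm_num)).const_mul C
  have hunif : TendstoUniformly F f Filter.atTop := by
    rw [Metric.tendstoUniformly_iff]
    intro ε hε
    filter_upwards [hlim.eventually_lt_const hε] with n hn x
    rw [dist_comm, dist_eq_norm]
    exact (hFf n x).trans_lt hn
  exact hunif.continuous (Filter.Frequently.of_forall hF)

theorem hasDerivWithinAt_integral_comp {h : ℝ → ℝ} (hh : Continuous h) {u : ℝ → ℝ} {u' s k : ℝ}
    {t : Set ℝ} (hu : HasDerivWithinAt u u' t s) :
    HasDerivWithinAt (fun s => ∫ σ in k..u s, h σ) (h (u s) * u') t s :=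
  (hh.integral_hasStrictDerivAt k (u s)).hasDerivAt.comp_hasDerivWithinAt s hu

theorem hasDerivWithinAt_add_mul_sub (c θ a s : ℝ) (t : Set ℝ) :
    HasDerivWithinAt (fun s => c + θ * (s - a)) θ t s := by
  simpa using ((((hasDerivAt_id s).sub_const a).const_mul θ).const_add c).hasDerivWithinAt

namespace GoursatProblem

variable (D : GoursatProblem) {a b : ℝ × ℝ → ℝ}

theorem φ_nonneg {z : ℝ} (hz : 0 ≤ z) : 0 ≤ D.φ z := D.φ_zero ▸ D.φ.monotone hz

theorem ψ_nonneg {z : ℝ} (hz : 0 ≤ z) : 0 ≤ D.ψ z := D.ψ_zero ▸ D.ψ.monotone hz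

theorem φ_symm_nonneg {s : ℝ} (hs : 0 ≤ s) : 0 ≤ D.φ.symm s :=
  D.φ.le_symm_apply.2 (by rwa [D.φ_zero])

theorem ψ_symm_nonneg {s : ℝ} (hs : 0 ≤ s) : 0 ≤ D.ψ.symm s :=
  D.ψ.le_symm_apply.2 (by rwa [D.ψ_zero])

/-- The sum of the two travel times, whose inverse locates the points of the diagonal. -/
noncomputable def totalTime : ℝ ≃o ℝ :=
  (D.φ.strictMono.add D.ψ.strictMono).orderIsoOfSurjective _
    ((D.φ.continuous.add D.ψ.continuous).surjective
      (D.φ.tendsto_atTop.atTop_add_atTop D.ψ.tendsto_atTop)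
      (D.φ.tendsto_atBot.atBot_add_atBot D.ψ.tendsto_atBot))

/-- The coordinate `z` of the point `(z, 0)` at which the curve `φ z - φ ζ = const` through `p`
starts. -/
noncomputable def foot (p : ℝ × ℝ) : ℝ := D.φ.symm (D.φ p.1 - D.φ p.2)

/-- The coordinate `z` of the point `(z, z)` at which the curve `φ z + ψ ζ = const` through `p`
starts. -/
noncomputable def diagonalPoint (p : ℝ × ℝ) : ℝ := D.totalTime.symm (D.φ p.1 + D.ψ p.2)

/-- The increment of `a` along the curve `φ z - φ ζ = const` from `ζ = 0` to `p`. -/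
noncomputable def parallelIntegral (b : ℝ × ℝ → ℝ) (p : ℝ × ℝ) : ℝ :=
  ∫ σ in (0 : ℝ)..D.φ p.2,
    D.rateA (D.φ.symm σ) * b (D.φ.symm (D.φ p.1 - D.φ p.2 + σ), D.φ.symm σ)

/-- The increment of `b` along the curve `φ z + ψ ζ = const` from the diagonal to `p`. -/
noncomputable def transversalIntegral (a : ℝ × ℝ → ℝ) (p : ℝ × ℝ) : ℝ :=
  ∫ τ in D.φ (D.diagonalPoint p)..D.φ p.1,
    D.rateB (D.ψ.symm (D.φ p.1 + D.ψ p.2 - τ))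
      * a (D.φ.symm τ, D.ψ.symm (D.φ p.1 + D.ψ p.2 - τ))

/-- The unknown `a` on the triangle, expressed by `b`. -/
noncomputable def solveA (b : ℝ × ℝ → ℝ) (p : ℝ × ℝ) : ℝ :=
  D.κ * b (D.foot p, 0) + D.parallelIntegral b p

/-- The unknown `b` on the triangle, expressed by `a`. -/
noncomputable def solveB (a : ℝ × ℝ → ℝ) (p : ℝ × ℝ) : ℝ :=
  D.diagonalValue (D.diagonalPoint p) + D.transversalIntegral a p

theorem continuous_foot : Continuous D.foot := by
  have := D.φ.continuous
  have := D.φ.symm.continuous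
  unfold foot
  fun_prop

theorem continuous_diagonalPoint : Continuous D.diagonalPoint := by
  have := D.φ.continuous
  have := D.ψ.continuous
  have := D.totalTime.symm.continuous
  unfold diagonalPoint
  fun_prop

theorem foot_mem {p : ℝ × ℝ} (hp : p ∈ triangle) : (D.foot p, (0 : ℝ)) ∈ triangle := by
  have hle : D.foot p ≤ p.1 :=
    D.φ.symm_apply_le.2 (sub_le_self _ (D.φ_nonneg hp.1))
  exact ⟨le_rfl, D.φ_symm_nonneg (sub_nonneg.2 (D.φ.monotone hp.2.1)), hle.trans hp.2.2⟩

theorem diagonalPoint_le {p : ℝ × ℝ} (hp : p ∈ triangle) : D.diagonalPoint p ≤ p.1 :=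
  D.totalTime.symm_apply_le.2 (add_le_add_right (D.ψ.monotone hp.2.1) _)

theorem φ_add_ψ_diagonalPoint (p : ℝ × ℝ) :
    D.φ (D.diagonalPoint p) + D.ψ (D.diagonalPoint p) = D.φ p.1 + D.ψ p.2 :=
  D.totalTime.apply_symm_apply _

theorem parallel_mem {p : ℝ × ℝ} (hp : p ∈ triangle) {σ : ℝ} (hσ : σ ∈ Icc 0 (D.φ p.2)) :
    (D.φ.symm (D.φ p.1 - D.φ p.2 + σ), D.φ.symm σ) ∈ triangle :=
  ⟨D.φ_symm_nonneg hσ.1,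
    D.φ.symm.monotone (le_add_of_nonneg_left (sub_nonneg.2 (D.φ.monotone hp.2.1))),
    (D.φ.symm_apply_le.2 (by linarith [hσ.2])).trans hp.2.2⟩

theorem transversal_mem {p : ℝ × ℝ} (hp : p ∈ triangle) {τ : ℝ}
    (hτ : τ ∈ Icc (D.φ (D.diagonalPoint p)) (D.φ p.1)) :
    (D.φ.symm τ, D.ψ.symm (D.φ p.1 + D.ψ p.2 - τ)) ∈ triangle := by
  have hsum := D.φ_add_ψ_diagonalPoint p
  have hψ : D.ψ.symm (D.φ p.1 + D.ψ p.2 - τ) ≤ D.diagonalPoint p :=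
    D.ψ.symm_apply_le.2 (by linarith [hτ.1])
  exact ⟨D.ψ_symm_nonneg (by linarith [hτ.2, D.ψ_nonneg hp.1]),
    hψ.trans (D.φ.le_symm_apply.2 hτ.1), (D.φ.symm_apply_le.2 hτ.2).trans hp.2.2⟩

theorem continuous_parallel_integrand (hb : Continuous b) :
    Continuous fun x : (ℝ × ℝ) × ℝ => D.rateA (D.φ.symm x.2)
      * b (D.φ.symm (D.φ x.1.1 - D.φ x.1.2 + x.2), D.φ.symm x.2) := by
  have := D.φ.continuous
  have := D.φ.symm.continuous
  have := D.continuous_rateA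
  fun_prop

theorem continuous_transversal_integrand (ha : Continuous a) :
    Continuous fun x : (ℝ × ℝ) × ℝ => D.rateB (D.ψ.symm (D.φ x.1.1 + D.ψ x.1.2 - x.2))
      * a (D.φ.symm x.2, D.ψ.symm (D.φ x.1.1 + D.ψ x.1.2 - x.2)) := by
  have := D.φ.continuous
  have := D.φ.symm.continuous
  have := D.ψ.continuous
  have := D.ψ.symm.continuous
  have := D.continuous_rateB
  fun_prop

theorem continuous_solveA (hb : Continuous b) : Continuous (D.solveA b) :=
  (continuous_const.mul (hb.comp (D.continuous_foot.prodMk continuous_const))).add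
    (continuous_intervalIntegral_param (D.continuous_parallel_integrand hb) continuous_const
      (D.φ.continuous.comp continuous_snd))

theorem continuous_solveB (ha : Continuous a) : Continuous (D.solveB a) :=
  (D.continuous_diagonalValue.comp D.continuous_diagonalPoint).add
    (continuous_intervalIntegral_param (D.continuous_transversal_integrand ha)
      (D.φ.continuous.comp D.continuous_diagonalPoint) (D.φ.continuous.comp continuous_fst))

theorem solveA_sub_solveA {b' : ℝ × ℝ → ℝ} (hb : Continuous b) (hb' : Continuous b')
    (p : ℝ × ℝ) : D.solveA b p - D.solveA b' p = D.solveA (b - b') p := by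
  have hint : ∀ b : ℝ × ℝ → ℝ, Continuous b → ∀ l u, IntervalIntegrable (fun σ =>
      D.rateA (D.φ.symm σ) * b (D.φ.symm (D.φ p.1 - D.φ p.2 + σ), D.φ.symm σ)) volume l u :=
    fun b hb l u => ((D.continuous_parallel_integrand hb).comp
      (Continuous.prodMk_right p)).intervalIntegrable l u
  simp only [solveA, parallelIntegral, Pi.sub_apply, mul_sub]
  rw [intervalIntegral.integral_sub (hint b hb _ _) (hint b' hb' _ _)]
  ring

theorem solveB_sub_solveB {a' : ℝ × ℝ → ℝ} (ha : Continuous a) (ha' : Continuous a')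
    (p : ℝ × ℝ) : D.solveB a p - D.solveB a' p = D.transversalIntegral (a - a') p := by
  have hint : ∀ a : ℝ × ℝ → ℝ, Continuous a → ∀ l u, IntervalIntegrable (fun τ =>
      D.rateB (D.ψ.symm (D.φ p.1 + D.ψ p.2 - τ))
        * a (D.φ.symm τ, D.ψ.symm (D.φ p.1 + D.ψ p.2 - τ))) volume l u :=
    fun a ha l u => ((D.continuous_transversal_integrand ha).comp
      (Continuous.prodMk_right p)).intervalIntegrable l u
  simp only [solveB, transversalIntegral, Pi.sub_apply, mul_sub]
  rw [intervalIntegral.integral_sub (hint a ha _ _) (hint a' ha' _ _)]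
  ring

variable {G B μ : ℝ}

theorem abs_parallelIntegral_le (hG : ∀ z ∈ Icc (0 : ℝ) 1, |D.rateA z| ≤ G) (hB : 0 ≤ B)
    (hμ : 0 < μ) (hb : ∀ p ∈ triangle, |b p| ≤ B * Real.exp (μ * D.φ p.1)) {p : ℝ × ℝ}
    (hp : p ∈ triangle) : |D.parallelIntegral b p| ≤ G * B / μ * Real.exp (μ * D.φ p.1) := by
  have hG0 : 0 ≤ G := (abs_nonneg _).trans (hG 0 ⟨le_rfl, zero_le_one⟩)
  set k := D.φ p.1 - D.φ p.2
  have hbound : ∀ σ ∈ Icc 0 (D.φ p.2),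
      |D.rateA (D.φ.symm σ) * b (D.φ.symm (k + σ), D.φ.symm σ)|
        ≤ G * B * Real.exp (μ * k) * Real.exp (μ * σ) := fun σ hσ => by
    have hmem := D.parallel_mem hp hσ
    have hbσ := hb _ hmem
    rw [D.φ.apply_symm_apply] at hbσ
    rw [abs_mul, mul_assoc, mul_assoc, ← Real.exp_add, ← mul_add]
    exact mul_le_mul (hG _ ⟨hmem.1, hmem.2.1.trans hmem.2.2⟩) hbσ (abs_nonneg _) hG0
  refine (abs_integral_le_exp (D.φ_nonneg hp.1) hμ (by positivity) hbound).trans_eq ?_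
  rw [mul_div_right_comm, mul_assoc, ← Real.exp_add, ← mul_add, sub_add_cancel]

theorem abs_transversalIntegral_le (hG : ∀ z ∈ Icc (0 : ℝ) 1, |D.rateB z| ≤ G) (hB : 0 ≤ B)
    (hμ : 0 < μ) (ha : ∀ p ∈ triangle, |a p| ≤ B * Real.exp (μ * D.φ p.1)) {p : ℝ × ℝ}
    (hp : p ∈ triangle) : |D.transversalIntegral a p| ≤ G * B / μ * Real.exp (μ * D.φ p.1) := by
  have hG0 : 0 ≤ G := (abs_nonneg _).trans (hG 0 ⟨le_rfl, zero_le_one⟩)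
  refine abs_integral_le_exp (D.φ.monotone (D.diagonalPoint_le hp)) hμ (by positivity)
    fun τ hτ => ?_
  have hmem := D.transversal_mem hp hτ
  have haτ := ha _ hmem
  rw [D.φ.apply_symm_apply] at haτ
  rw [abs_mul, mul_assoc]
  exact mul_le_mul (hG _ ⟨hmem.1, hmem.2.1.trans hmem.2.2⟩) haτ (abs_nonneg _) hG0

theorem abs_solveA_le (hG : ∀ z ∈ Icc (0 : ℝ) 1, |D.rateA z| ≤ G) (hB : 0 ≤ B)
    (hμ : 0 < μ) (hb : ∀ p ∈ triangle, |b p| ≤ B * Real.exp (μ * D.φ p.1)) {p : ℝ × ℝ}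
    (hp : p ∈ triangle) : |D.solveA b p| ≤ (|D.κ| + G / μ) * B * Real.exp (μ * D.φ p.1) := by
  have hfoot : |b (D.foot p, 0)| ≤ B * Real.exp (μ * D.φ p.1) := by
    refine (hb _ (D.foot_mem hp)).trans ?_
    have hle : D.φ (D.foot p) ≤ D.φ p.1 :=
      (D.φ.apply_symm_apply _).trans_le (sub_le_self _ (D.φ_nonneg hp.1))
    dsimp only
    gcongr
  calc |D.solveA b p| ≤ |D.κ| * |b (D.foot p, 0)| + |D.parallelIntegral b p| :=
        (abs_add_le _ _).trans_eq (by rw [abs_mul])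
    _ ≤ |D.κ| * (B * Real.exp (μ * D.φ p.1)) + G * B / μ * Real.exp (μ * D.φ p.1) := by
        gcongr
        exact D.abs_parallelIntegral_le hG hB hμ hb hp
    _ = (|D.κ| + G / μ) * B * Real.exp (μ * D.φ p.1) := by ring

theorem abs_solveA_solveB_sub_le {a' : ℝ × ℝ → ℝ} (ha : Continuous a) (ha' : Continuous a')
    (hGa : ∀ z ∈ Icc (0 : ℝ) 1, |D.rateA z| ≤ G) (hGb : ∀ z ∈ Icc (0 : ℝ) 1, |D.rateB z| ≤ G)
    (hμ : 0 < μ) (hGμ : 2 * ((|D.κ| + 1) * G) ≤ μ) (hB : 0 ≤ B)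
    (haa' : ∀ p ∈ triangle, |a p - a' p| ≤ B * Real.exp (μ * D.φ p.1)) {p : ℝ × ℝ}
    (hp : p ∈ triangle) :
    |D.solveA (D.solveB a) p - D.solveA (D.solveB a') p| ≤ B / 2 * Real.exp (μ * D.φ p.1) := by
  have hG0 : 0 ≤ G := (abs_nonneg _).trans (hGa 0 ⟨le_rfl, zero_le_one⟩)
  have hκG := mul_nonneg (abs_nonneg D.κ) hG0
  have hratio : G / μ ≤ 1 := (div_le_one hμ).2 (by linarith)
  have hfactor : (|D.κ| + G / μ) * (G / μ) ≤ 1 / 2 := by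
    calc (|D.κ| + G / μ) * (G / μ) ≤ (|D.κ| + 1) * (G / μ) := by gcongr
      _ = (|D.κ| + 1) * G / μ := (mul_div_assoc _ _ _).symm
      _ ≤ 1 / 2 := (div_le_div_iff₀ hμ two_pos).2 (by linarith)
  rw [D.solveA_sub_solveA (D.continuous_solveB ha) (D.continuous_solveB ha')]
  refine (D.abs_solveA_le (B := G * B / μ) hGa (by positivity) hμ (fun p hp => ?_) hp).trans ?_
  · rw [Pi.sub_apply, D.solveB_sub_solveB ha ha']
    exact D.abs_transversalIntegral_le hGb hB hμ haa' hp
  · calc (|D.κ| + G / μ) * (G * B / μ) * Real.exp (μ * D.φ p.1)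
        = (|D.κ| + G / μ) * (G / μ) * (B * Real.exp (μ * D.φ p.1)) := by ring
      _ ≤ 1 / 2 * (B * Real.exp (μ * D.φ p.1)) := by gcongr
      _ = B / 2 * Real.exp (μ * D.φ p.1) := by ring

/-- Continuous solutions of a Goursat problem, in integrated form. -/
structure IsSolution (a b : ℝ × ℝ → ℝ) : Prop where
  continuous_left : Continuous a
  continuous_right : Continuous b
  left_eq : ∀ p ∈ triangle, a p = D.solveA b p
  right_eq : ∀ p ∈ triangle, b p = D.solveB a p

theorem exists_abs_rate_le : ∃ G : ℝ, 0 ≤ G ∧ (∀ z ∈ Icc (0 : ℝ) 1, |D.rateA z| ≤ G) ∧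
    ∀ z ∈ Icc (0 : ℝ) 1, |D.rateB z| ≤ G := by
  obtain ⟨G₁, h₁⟩ := isCompact_Icc.exists_bound_of_continuousOn
    (D.continuous_rateA.continuousOn (s := Icc (0 : ℝ) 1))
  obtain ⟨G₂, h₂⟩ := isCompact_Icc.exists_bound_of_continuousOn
    (D.continuous_rateB.continuousOn (s := Icc (0 : ℝ) 1))
  exact ⟨max G₁ G₂,
    ((norm_nonneg _).trans (h₁ 0 ⟨le_rfl, zero_le_one⟩)).trans (le_max_left _ _),
    fun z hz => (h₁ z hz).trans (le_max_left _ _), fun z hz => (h₂ z hz).trans (le_max_right _ _)⟩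

theorem exists_isSolution : ∃ a b, D.IsSolution a b := by
  obtain ⟨G, hG0, hGa, hGb⟩ := D.exists_abs_rate_le
  set μ : ℝ := 2 * ((|D.κ| + 1) * G) + 1
  have hμ : 0 < μ := by positivity
  set w : ℝ × ℝ → ℝ := fun p => Real.exp (μ * D.φ (triangleClamp p).1)
  have hw1 : ∀ p, 1 ≤ w p := fun p => Real.one_le_exp
    (mul_nonneg hμ.le (D.φ_nonneg ((triangleClamp_mem p).1.trans (triangleClamp_mem p).2.1)))
  have hwM : ∀ p, w p ≤ Real.exp (μ * D.φ 1) := fun p => Real.exp_le_exp.2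
    (mul_le_mul_of_nonneg_left (D.φ.monotone (triangleClamp_mem p).2.2) hμ.le)
  have hcont : ∀ a, Continuous a → Continuous fun p => D.solveA (D.solveB a) (triangleClamp p) :=
    fun a ha => (D.continuous_solveA (D.continuous_solveB ha)).comp continuous_triangleClamp
  obtain ⟨M, hM⟩ := isCompact_triangle.exists_bound_of_continuousOn
    (D.continuous_solveA (D.continuous_solveB (continuous_const (y := 0)))).continuousOn
  have hM0 : 0 ≤ M := (norm_nonneg _).trans (hM _ (triangleClamp_mem (0, 0)))
  obtain ⟨a, ha, hfix⟩ := exists_fixedPoint_of_weighted_contraction (P := Continuous) (w := w)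
    (Φ := fun a p => D.solveA (D.solveB a) (triangleClamp p)) (f₀ := fun _ => 0) hM0
    continuous_const hcont
    (fun p => by
      rw [sub_zero]
      exact (hM _ (triangleClamp_mem p)).trans (le_mul_of_one_le_right hM0 (hw1 p)))
    (fun a a' ha ha' B hB haa' p => D.abs_solveA_solveB_sub_le ha ha' hGa hGb hμ
      (le_add_of_nonneg_right zero_le_one) hB
      (fun q hq => by simpa only [w, triangleClamp_of_mem hq, Real.norm_eq_abs] using haa' q)
      (triangleClamp_mem p))
    (fun F f B hF hFf => continuous_of_norm_sub_le_geometric (C := |B| * Real.exp (μ * D.φ 1)) hF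
      fun n p => (hFf n p).trans (by
        rw [mul_right_comm]
        gcongr
        · exact le_abs_self B
        · exact hwM p))
  exact ⟨a, D.solveB a, ha, D.continuous_solveB ha,
    fun p hp => by rw [hfix p, triangleClamp_of_mem hp], fun _ _ => rfl⟩

namespace IsSolution

variable {D} (h : D.IsSolution a b) {α β θ : ℝ} {p r : ℝ → ℝ}
include h

theorem left_zero {z : ℝ} (hz : z ∈ Icc (0 : ℝ) 1) : a (z, 0) = D.κ * b (z, 0) := by
  rw [h.left_eq (z, 0) ⟨le_rfl, hz.1, hz.2⟩]
  simp [solveA, foot, parallelIntegral, D.φ_zero]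

theorem right_diagonal {z : ℝ} (hz : z ∈ Icc (0 : ℝ) 1) : b (z, z) = D.diagonalValue z := by
  have hpoint : D.diagonalPoint (z, z) = z := D.totalTime.symm_apply_apply z
  rw [h.right_eq (z, z) ⟨hz.1, le_rfl, hz.2⟩, solveB, transversalIntegral, hpoint,
    intervalIntegral.integral_same, add_zero]

theorem hasDerivWithinAt_left (hpr : ∀ s ∈ Icc α β, (p s, r s) ∈ triangle)
    (hp : ∀ s ∈ Icc α β, D.φ (p s) = D.φ (p α) + θ * (s - α))
    (hr : ∀ s ∈ Icc α β, D.φ (r s) = D.φ (r α) + θ * (s - α)) {s : ℝ} (hs : s ∈ Icc α β) :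
    HasDerivWithinAt (fun s => a (p s, r s)) (D.rateA (r s) * b (p s, r s) * θ) (Icc α β) s := by
  set k := D.φ (p α) - D.φ (r α)
  have hk : ∀ s ∈ Icc α β, D.φ (p s) - D.φ (r s) = k := fun s hs => by
    rw [hp s hs, hr s hs, add_sub_add_right_eq_sub]
  set H : ℝ → ℝ := fun σ => D.rateA (D.φ.symm σ) * b (D.φ.symm (k + σ), D.φ.symm σ) with hH
  have hHcont : Continuous H := by
    have := D.φ.symm.continuous
    have := D.continuous_rateA
    have := h.continuous_right
    fun_prop
  have hval : ∀ s ∈ Icc α β, a (p s, r s)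
      = D.κ * b (D.φ.symm k, 0) + ∫ σ in (0 : ℝ)..D.φ (r α) + θ * (s - α), H σ := fun s hs => by
    rw [h.left_eq _ (hpr s hs), ← hr s hs]
    simp only [solveA, foot, parallelIntegral, hk s hs, hH]
  have hderiv := (hasDerivWithinAt_integral_comp (k := 0) hHcont
    (hasDerivWithinAt_add_mul_sub (D.φ (r α)) θ α s (Icc α β))).const_add (D.κ * b (D.φ.symm k, 0))
  refine (hderiv.congr hval (hval s hs)).congr_deriv ?_
  simp only [hH, ← hr s hs, D.φ.symm_apply_apply, ← hk s hs, sub_add_cancel]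

theorem hasDerivWithinAt_right (hpr : ∀ s ∈ Icc α β, (p s, r s) ∈ triangle)
    (hp : ∀ s ∈ Icc α β, D.φ (p s) = D.φ (p α) + θ * (s - α))
    (hr : ∀ s ∈ Icc α β, D.ψ (r s) = D.ψ (r α) + -θ * (s - α)) {s : ℝ} (hs : s ∈ Icc α β) :
    HasDerivWithinAt (fun s => b (p s, r s)) (D.rateB (r s) * a (p s, r s) * θ) (Icc α β) s := by
  set c := D.φ (p α) + D.ψ (r α)
  have hc : ∀ s ∈ Icc α β, D.φ (p s) + D.ψ (r s) = c := fun s hs => by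
    rw [hp s hs, hr s hs]
    ring
  set H : ℝ → ℝ := fun τ => D.rateB (D.ψ.symm (c - τ)) * a (D.φ.symm τ, D.ψ.symm (c - τ)) with hH
  have hHcont : Continuous H := by
    have := D.φ.symm.continuous
    have := D.ψ.symm.continuous
    have := D.continuous_rateB
    have := h.continuous_left
    fun_prop
  have hval : ∀ s ∈ Icc α β, b (p s, r s) = D.diagonalValue (D.totalTime.symm c)
      + ∫ τ in D.φ (D.totalTime.symm c)..D.φ (p α) + θ * (s - α), H τ := fun s hs => by
    rw [h.right_eq _ (hpr s hs), ← hp s hs]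
    simp only [solveB, diagonalPoint, transversalIntegral, hc s hs, hH]
  have hderiv := (hasDerivWithinAt_integral_comp (k := D.φ (D.totalTime.symm c)) hHcont
    (hasDerivWithinAt_add_mul_sub (D.φ (p α)) θ α s (Icc α β))).const_add
      (D.diagonalValue (D.totalTime.symm c))
  refine (hderiv.congr hval (hval s hs)).congr_deriv ?_
  simp only [hH, ← hp s hs, D.φ.symm_apply_apply, ← hc s hs, add_sub_cancel_left,
    D.ψ.symm_apply_apply]

end IsSolution

end GoursatProblem

/-! ### Existence of the kernel -/

namespace PDEODESystem

variable {n : ℕ} (S : PDEODESystem n)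

theorem travelSign_rev (i : Fin 2) : travelSign i.rev = -travelSign i := by
  fin_cases i <;> simp [travelSign]

/-- The Goursat problem of row `i` of the kernel for `a = |Λᵢᵢ| Kᵢᵢ` and `b = |Λⱼⱼ| Kᵢⱼ`, where
`j = i.rev` is the other index. -/
noncomputable def kernelRow (i : Fin 2) : GoursatProblem where
  φ := S.travelTime i
  ψ := S.travelTime i.rev
  φ_zero := (S.isTravelTime i).map_zero
  ψ_zero := (S.isTravelTime i.rev).map_zero
  κ := ![S.q0, S.q0⁻¹] i
  rateA z := travelSign i * S.speed i z / S.speed i.rev z * S.scaledCoupling i.rev i z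
  rateB z := travelSign i * S.speed i.rev z / S.speed i z * S.scaledCoupling i i.rev z
  diagonalValue z :=
    -(travelSign i * S.speed i.rev z * S.scaledCoupling i i.rev z
      / (S.speed i z + S.speed i.rev z))
  continuous_rateA := ((continuous_const.mul (S.isBddCont_speed i).1).div
    (S.isBddCont_speed i.rev).1 fun z => (S.speed_pos _ z).ne').mul
    (S.isBddCont_scaledCoupling _ _).1
  continuous_rateB := ((continuous_const.mul (S.isBddCont_speed i.rev).1).div
    (S.isBddCont_speed i).1 fun z => (S.speed_pos _ z).ne').mul
    (S.isBddCont_scaledCoupling _ _).1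
  continuous_diagonalValue := (((continuous_const.mul (S.isBddCont_speed i.rev).1).mul
    (S.isBddCont_scaledCoupling _ _).1).div
      ((S.isBddCont_speed i).1.add (S.isBddCont_speed i.rev).1)
      fun z => (add_pos (S.speed_pos _ z) (S.speed_pos _ z)).ne').neg

/-- The kernel whose rows are given by solutions `a i`, `b i` of the Goursat problems. -/
noncomputable def kernelOfRows (a b : Fin 2 → ℝ × ℝ → ℝ) (z ζ : ℝ) : Matrix (Fin 2) (Fin 2) ℝ :=
  .of fun i j => (if j = i then a i (z, ζ) else b i (z, ζ)) / S.speed j ζ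

section

variable {S} {a b : Fin 2 → ℝ × ℝ → ℝ} (h : ∀ i, (S.kernelRow i).IsSolution (a i) (b i))

theorem kernelOfRows_self (i : Fin 2) (z ζ : ℝ) :
    S.kernelOfRows a b z ζ i i = a i (z, ζ) / S.speed i ζ := by
  simp [kernelOfRows]

theorem kernelOfRows_rev (i : Fin 2) (z ζ : ℝ) :
    S.kernelOfRows a b z ζ i i.rev = b i (z, ζ) / S.speed i.rev ζ := by
  fin_cases i <;> simp [kernelOfRows]

theorem mul_Atilde_apply (M : Matrix (Fin 2) (Fin 2) ℝ) (i j : Fin 2) {z : ℝ}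
    (hz : z ∈ Icc (0 : ℝ) 1) : (M * S.Atilde z) i j = M i j.rev * S.scaledCoupling j.rev j z := by
  rw [scaledCoupling, unitClamp_of_mem hz]
  fin_cases j <;> simp [Matrix.mul_apply, Atilde]

include h

theorem continuousOn_kernelOfRows (i j : Fin 2) :
    ContinuousOn (fun y : ℝ × ℝ => S.kernelOfRows a b y.1 y.2 i j) triangle := by
  have hspeed := (S.isBddCont_speed j).1.comp (continuous_snd (X := ℝ))
  refine (Continuous.div ?_ hspeed fun y => (S.speed_pos j y.2).ne').continuousOn
  split_ifs
  · exact (h i).continuous_left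
  · exact (h i).continuous_right

theorem hasDerivWithinAt_kernelOfRows (i j : Fin 2) {α β : ℝ} {p r : ℝ → ℝ}
    (hpr : ∀ s ∈ Icc α β, (p s, r s) ∈ triangle ∧
      HasDerivWithinAt p (S.Lam (p s) i i) (Icc α β) s ∧
      HasDerivWithinAt r (S.Lam (r s) j j) (Icc α β) s) {s : ℝ} (hs : s ∈ Icc α β) :
    HasDerivWithinAt (fun s => S.kernelOfRows a b (p s) (r s) i j * S.Lam (r s) j j)
      (S.Lam (r s) j j * (S.kernelOfRows a b (p s) (r s) * S.Atilde (r s)) i j) (Icc α β) s := by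
  have hmem : ∀ s ∈ Icc α β, (p s, r s) ∈ triangle := fun s hs => (hpr s hs).1
  have hp01 : ∀ s ∈ Icc α β, p s ∈ Icc (0 : ℝ) 1 := fun s hs =>
    ⟨(hmem s hs).1.trans (hmem s hs).2.1, (hmem s hs).2.2⟩
  have hr01 : ∀ s ∈ Icc α β, r s ∈ Icc (0 : ℝ) 1 := fun s hs =>
    ⟨(hmem s hs).1, (hmem s hs).2.1.trans (hmem s hs).2.2⟩
  have hp := (S.isTravelTime i).apply_eq_of_hasDerivWithinAt fun s hs =>
    S.Lam_diag i (hp01 s hs) ▸ (hpr s hs).2.1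
  have hr := (S.isTravelTime j).apply_eq_of_hasDerivWithinAt fun s hs =>
    S.Lam_diag j (hr01 s hs) ▸ (hpr s hs).2.2
  have hsign := travelSign_mul_self i
  rw [mul_Atilde_apply _ _ _ (hr01 s hs), S.Lam_diag j (hr01 s hs)]
  rcases (by fin_cases i <;> fin_cases j <;> simp : j = i ∨ j = i.rev) with rfl | rfl
  · have hderiv := ((h j).hasDerivWithinAt_left hmem hp hr hs).const_mul (travelSign j)
    have heq : ∀ s ∈ Icc α β, S.kernelOfRows a b (p s) (r s) j j * S.Lam (r s) j j
        = travelSign j * a j (p s, r s) := fun s hs => by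
      rw [kernelOfRows_self, S.Lam_diag j (hr01 s hs)]
      field [(S.speed_pos j (r s)).ne']
    refine (hderiv.congr heq (heq s hs)).congr_deriv ?_
    rw [kernelOfRows_rev]
    simp only [kernelRow]
    linear_combination (travelSign j * S.speed j (r s) / S.speed j.rev (r s)
      * S.scaledCoupling j.rev j (r s) * b j (p s, r s)) * hsign
  · rw [travelSign_rev] at hr ⊢
    have hderiv := ((h i).hasDerivWithinAt_right hmem hp hr hs).const_mul (-travelSign i)
    have heq : ∀ s ∈ Icc α β, S.kernelOfRows a b (p s) (r s) i i.rev * S.Lam (r s) i.rev i.rev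
        = -travelSign i * b i (p s, r s) := fun s hs => by
      rw [kernelOfRows_rev, S.Lam_diag _ (hr01 s hs), travelSign_rev]
      field [(S.speed_pos i.rev (r s)).ne']
    refine (hderiv.congr heq (heq s hs)).congr_deriv ?_
    rw [Fin.rev_rev, kernelOfRows_self]
    simp only [kernelRow]
    linear_combination (-travelSign i * S.speed i.rev (r s) / S.speed i (r s)
      * S.scaledCoupling i i.rev (r s) * a i (p s, r s)) * hsign

theorem kernelOfRows_zero (i : Fin 2) {z : ℝ} (hz : z ∈ Icc (0 : ℝ) 1) :
    S.kernelOfRows a b z 0 i i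
      = ![S.q0, S.q0⁻¹] i * S.lam i.rev 0 / S.lam i 0 * S.kernelOfRows a b z 0 i i.rev := by
  have h0 : (0 : ℝ) ∈ Icc (0 : ℝ) 1 := ⟨le_rfl, zero_le_one⟩
  have hrev := (S.lam_pos i.rev 0 h0).ne'
  rw [kernelOfRows_self, kernelOfRows_rev, (h i).left_zero hz, S.speed_of_mem _ h0,
    S.speed_of_mem _ h0]
  simp only [kernelRow]
  field

theorem kernelOfRows_diagonal (i : Fin 2) {z : ℝ} (hz : z ∈ Icc (0 : ℝ) 1) :
    S.kernelOfRows a b z z i i.rev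
      = -(travelSign i * S.Atilde z i i.rev) / (S.lam i z + S.lam i.rev z) := by
  have hrev := S.lam_pos i.rev z hz
  have hsum := (add_pos (S.lam_pos i z hz) hrev).ne'
  rw [kernelOfRows_rev, (h i).right_diagonal hz]
  simp only [kernelRow, S.speed_of_mem _ hz, scaledCoupling, unitClamp_of_mem hz]
  field

theorem isKernel_kernelOfRows : S.IsKernel (S.kernelOfRows a b) where
  cont := continuousOn_kernelOfRows h
  pde i j _ _ _ _ _ hpr _ hs := hasDerivWithinAt_kernelOfRows h i j hpr hs
  bc11 _ hz := kernelOfRows_zero h 0 hz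
  bc12 z hz := by simpa [travelSign] using kernelOfRows_diagonal h 0 hz
  bc21 z hz := by simpa [travelSign, add_comm] using kernelOfRows_diagonal h 1 hz
  bc22 z hz := by
    have hcoeff : S.lam 0 0 / (S.q0 * S.lam 1 0) = S.q0⁻¹ * S.lam 0 0 / S.lam 1 0 := by
      rw [div_mul_eq_div_div, div_eq_inv_mul _ S.q0]
    exact hcoeff ▸ kernelOfRows_zero h 1 hz

end

theorem exists_isKernel : ∃ K, S.IsKernel K := by
  choose a b h using fun i => (S.kernelRow i).exists_isSolution
  exact ⟨_, isKernel_kernelOfRows h⟩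

end PDEODESystem

/-! ### Inversion of the transformation -/

theorem exists_abs_volterra_le {k : Fin 2 → Fin 2 → ℝ → ℝ → ℝ}
    (hk : ∀ i j, IsBddCont (Function.uncurry (k i j))) :
    ∃ C : ℝ, 0 < C ∧ ∀ (y : Fin 2 → ℝ → ℝ → ℝ) (t B : ℝ),
      (∀ i, ∀ z ∈ Icc (0 : ℝ) 1, |y i z t| ≤ B) → ∀ i z, |volterra k y i z t| ≤ C * B := by
  obtain ⟨M, hM0, hM⟩ := exists_forall_abs_le_of_isBddCont fun p : Fin 2 × Fin 2 => hk p.1 p.2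
  set μ : ℝ := 2 * M + 1
  have hμ : 0 < μ := by positivity
  refine ⟨Real.exp μ, Real.exp_pos _, fun y t B hB i z => ?_⟩
  have hB0 : 0 ≤ B := (abs_nonneg _).trans (hB 0 0 ⟨le_rfl, zero_le_one⟩)
  have hexp : ∀ j, ∀ ζ ∈ Icc 0 (unitClamp z), |y j ζ t| ≤ B * Real.exp (μ * ζ) := fun j ζ hζ =>
    (hB j ζ ⟨hζ.1, hζ.2.trans (unitClamp_mem z).2⟩).trans
      (le_mul_of_one_le_right hB0 (Real.one_le_exp (mul_nonneg hμ.le hζ.1)))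
  calc |volterra k y i z t| ≤ 1 * B * Real.exp (μ * unitClamp z) :=
        abs_volterra_le (fun i j z ζ => hM (i, j) (z, ζ)) hμ (by linarith) hB0 hexp i
    _ ≤ 1 * B * Real.exp (μ * 1) := by
        gcongr
        exact (unitClamp_mem z).2
    _ = Real.exp μ * B := by ring_nf

namespace PDEODESystem

variable {n : ℕ} {S : PDEODESystem n} {K : ℝ → ℝ → Matrix (Fin 2) (Fin 2) ℝ}
  {x : ℝ → ℝ → Fin 2 → ℝ} {y : Fin 2 → ℝ → ℝ → ℝ} {w w' : ℝ → Fin 2 → ℝ}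

theorem isBddCont_inv_scaling (S : PDEODESystem n) (i : Fin 2) :
    IsBddCont fun z => (S.scaling i (unitClamp z))⁻¹ :=
  isBddCont_comp_unitClamp (f := fun z => (S.scaling i z)⁻¹)
    ((S.continuous_scaling i).inv₀ fun z => (S.scaling_pos i z).ne').continuousOn

theorem exists_scaling_le (S : PDEODESystem n) : ∃ D : ℝ, 0 < D ∧ ∀ i, ∀ z ∈ Icc (0 : ℝ) 1,
    S.scaling i z ≤ D ∧ (S.scaling i z)⁻¹ ≤ D := by
  obtain ⟨M, hM0, hM⟩ := exists_forall_abs_le_of_isBddCont fun i =>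
    isBddCont_comp_unitClamp (S.continuous_scaling i).continuousOn
  obtain ⟨N, hN0, hN⟩ := exists_forall_abs_le_of_isBddCont S.isBddCont_inv_scaling
  refine ⟨M + N + 1, by positivity, fun i z hz => ?_⟩
  have hscaling := (le_abs_self _).trans (hM i z)
  have hinv := (le_abs_self _).trans (hN i z)
  rw [unitClamp_of_mem hz] at hscaling hinv
  constructor <;> linarith

theorem isStateTrajectory_of_scaling_mul_eq (hy : ∀ i, IsSignal (y i))
    (hxy : ∀ z ∈ Icc (0 : ℝ) 1, ∀ t, 0 ≤ t → ∀ i, S.scaling i z * x z t i = y i z t) :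
    IsStateTrajectory x :=
  isStateTrajectory_of_isSignal
    (fun i => (hy i).isBddCont_mul (S.isBddCont_inv_scaling i))
    fun z hz t ht i => by
      rw [unitClamp_of_mem hz, ← hxy z hz t ht, inv_mul_cancel_left₀ (S.scaling_pos i z).ne']

theorem IsKernel.transform_eq_sub_volterra (hK : S.IsKernel K) (hx : IsStateTrajectory x) {t : ℝ}
    (ht : 0 ≤ t) {z : ℝ} (hz : z ∈ Icc (0 : ℝ) 1) (i : Fin 2) :
    S.transform K (fun ζ => x ζ t) z i = S.scaledTrajectory x i z t
      - volterra (kernelExt K) (S.scaledTrajectory x) i z t :=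
  hK.transform_apply (S.isSignal_scaledTrajectory hx)
    (fun _ hz i => S.scaling_mul_eq_scaledTrajectory x hz ht i) hz i

theorem IsKernel.isState_transform (hK : S.IsKernel K) (hw : IsState w) :
    IsState (S.transform K w) := by
  have hy := S.isSignal_scaledTrajectory hw.isStateTrajectory
  exact (isStateTrajectory_of_isSignal (x := fun z _ => S.transform K w z)
    (fun i => ((hy i).sub (isSignal_volterra hK.isBddCont_kernelExt hy i)).comp measurable_fst)
    fun z hz t ht i => hK.transform_eq_sub_volterra hw.isStateTrajectory ht hz i).isState le_rfl

theorem IsKernel.exists_norm_transform_le (hK : S.IsKernel K) : ∃ C : ℝ, 0 < C ∧ ∀ w, IsState w →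
    ∀ M : ℝ, (∀ z ∈ Icc (0 : ℝ) 1, ‖w z‖ ≤ M) →
      ∀ z ∈ Icc (0 : ℝ) 1, ‖S.transform K w z‖ ≤ C * M := by
  obtain ⟨N, hN0, hN⟩ := exists_abs_volterra_le hK.isBddCont_kernelExt
  obtain ⟨D, hD0, hD⟩ := S.exists_scaling_le
  refine ⟨D + N * D, by positivity, fun w hw M hM z hz => ?_⟩
  have hM0 : 0 ≤ M := (norm_nonneg _).trans (hM z hz)
  set y := S.scaledTrajectory fun z _ => w z
  have hwy : ∀ i, ∀ ζ ∈ Icc (0 : ℝ) 1, S.scaling i ζ * w ζ i = y i ζ 0 := fun i ζ hζ =>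
    S.scaling_mul_eq_scaledTrajectory (fun z _ => w z) hζ le_rfl i
  have hy : ∀ i, ∀ ζ ∈ Icc (0 : ℝ) 1, |y i ζ 0| ≤ D * M := fun i ζ hζ => by
    rw [← hwy i ζ hζ, abs_mul, abs_of_pos (S.scaling_pos i ζ)]
    exact mul_le_mul (hD i ζ hζ).1 ((norm_le_pi_norm (w ζ) i).trans (hM ζ hζ)) (abs_nonneg _)
      hD0.le
  refine (pi_norm_le_iff_of_nonneg (by positivity)).2 fun i => ?_
  calc ‖S.transform K w z i‖ = |y i z 0 - volterra (kernelExt K) y i z 0| := by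
        rw [← hK.transform_eq_sub_volterra hw.isStateTrajectory le_rfl hz, Real.norm_eq_abs]
    _ ≤ D * M + N * (D * M) := (abs_sub _ _).trans (add_le_add (hy i z hz) (hN y 0 _ hy i z))
    _ = (D + N * D) * M := by ring

theorem IsKernel.exists_norm_le_transform (hK : S.IsKernel K) : ∃ C : ℝ, 0 < C ∧ ∀ w, IsState w →
    ∀ M : ℝ, (∀ z ∈ Icc (0 : ℝ) 1, ‖S.transform K w z‖ ≤ M) →
      ∀ z ∈ Icc (0 : ℝ) 1, ‖w z‖ ≤ C * M := by
  obtain ⟨N, hN0, hN⟩ := exists_abs_le_of_sub_volterra hK.isBddCont_kernelExt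
  obtain ⟨D, hD0, hD⟩ := S.exists_scaling_le
  refine ⟨D * N, mul_pos hD0 hN0, fun w hw M hM z hz => ?_⟩
  have hM0 : 0 ≤ M := (norm_nonneg _).trans (hM z hz)
  set y := S.scaledTrajectory fun z _ => w z
  have hwy : ∀ i, ∀ ζ ∈ Icc (0 : ℝ) 1, S.scaling i ζ * w ζ i = y i ζ 0 := fun i ζ hζ =>
    S.scaling_mul_eq_scaledTrajectory (fun z _ => w z) hζ le_rfl i
  have hy : ∀ i, ∀ ζ ∈ Icc (0 : ℝ) 1, |y i ζ 0| ≤ N * M :=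
    hN y (S.isSignal_scaledTrajectory hw.isStateTrajectory) 0 M fun i ζ hζ => by
      rw [← hK.transform_eq_sub_volterra hw.isStateTrajectory le_rfl hζ]
      exact (norm_le_pi_norm _ i).trans (hM ζ hζ)
  refine (pi_norm_le_iff_of_nonneg (by positivity)).2 fun i => ?_
  calc ‖w z i‖ = (S.scaling i z)⁻¹ * |y i z 0| := by
        rw [← hwy i z hz, abs_mul, abs_of_pos (S.scaling_pos i z),
          inv_mul_cancel_left₀ (S.scaling_pos i z).ne', Real.norm_eq_abs]
    _ ≤ D * (N * M) := mul_le_mul (hD i z hz).2 (hy i z hz) (abs_nonneg _) hD0.le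
    _ = D * N * M := (mul_assoc _ _ _).symm

theorem IsKernel.exists_norm_transform_le_and_norm_le_transform (hK : S.IsKernel K) :
    ∃ C : ℝ, 0 < C ∧ ∀ w, IsState w → ∀ M : ℝ,
      ((∀ z ∈ Icc (0 : ℝ) 1, ‖w z‖ ≤ M) → ∀ z ∈ Icc (0 : ℝ) 1, ‖S.transform K w z‖ ≤ C * M) ∧
      ((∀ z ∈ Icc (0 : ℝ) 1, ‖S.transform K w z‖ ≤ M) → ∀ z ∈ Icc (0 : ℝ) 1, ‖w z‖ ≤ C * M) := by
  obtain ⟨C, hC0, hC⟩ := hK.exists_norm_transform_le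
  obtain ⟨C', -, hC'⟩ := hK.exists_norm_le_transform
  exact ⟨max C C', hC0.trans_le (le_max_left _ _), fun w hw M =>
    ⟨fun hM z hz => (hC w hw M hM z hz).trans
      (mul_le_mul_of_nonneg_right (le_max_left _ _) ((norm_nonneg _).trans (hM z hz))),
    fun hM z hz => (hC' w hw M hM z hz).trans
      (mul_le_mul_of_nonneg_right (le_max_right _ _) ((norm_nonneg _).trans (hM z hz)))⟩⟩

theorem IsKernel.eqOn_of_transform_eqOn (hK : S.IsKernel K) (hw : IsState w) (hw' : IsState w')
    (h : EqOn (S.transform K w') (S.transform K w) (Icc 0 1)) : EqOn w' w (Icc 0 1) := by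
  obtain ⟨C, -, hC⟩ := exists_abs_le_of_sub_volterra hK.isBddCont_kernelExt
  have hx := hw.isStateTrajectory
  have hx' := hw'.isStateTrajectory
  have hy := S.isSignal_scaledTrajectory hx
  have hy' := S.isSignal_scaledTrajectory hx'
  intro z hz
  funext i
  have hzero := hC _ (fun i => (hy' i).sub (hy i)) 0 0 (fun i z hz => by
    have hi := congrFun (h hz) i
    rw [hK.transform_eq_sub_volterra hx le_rfl hz,
      hK.transform_eq_sub_volterra hx' le_rfl hz] at hi
    rw [volterra_sub hK.isBddCont_kernelExt hy' hy, sub_sub_sub_comm, hi, sub_self, abs_zero])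
    i z hz
  rw [mul_zero, abs_nonpos_iff, ← S.scaling_mul_eq_scaledTrajectory _ hz le_rfl,
    ← S.scaling_mul_eq_scaledTrajectory _ hz le_rfl, ← mul_sub] at hzero
  exact sub_eq_zero.1 ((mul_eq_zero.1 hzero).resolve_left (S.scaling_pos i z).ne')

theorem IsKernel.exists_sub_volterra_scaling_eq (hK : S.IsKernel K) {v : ℝ → ℝ → Fin 2 → ℝ}
    (hv : IsStateTrajectory v) :
    ∃ (x : ℝ → ℝ → Fin 2 → ℝ) (y : Fin 2 → ℝ → ℝ → ℝ), (∀ i, IsSignal (y i)) ∧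
      (∀ z ∈ Icc (0 : ℝ) 1, ∀ t, 0 ≤ t → ∀ i, S.scaling i z * x z t i = y i z t) ∧
      ∀ z ∈ Icc (0 : ℝ) 1, ∀ t, 0 ≤ t → ∀ i,
        y i z t - volterra (kernelExt K) y i z t = v z t i := by
  obtain ⟨y, hy, hyv⟩ := exists_sub_volterra_eq hK.isBddCont_kernelExt fun i => hv.isSignal i
  exact ⟨fun z t i => (S.scaling i z)⁻¹ * y i z t, y, hy,
    fun z _ t _ i => mul_inv_cancel_left₀ (S.scaling_pos i z).ne' _,
    fun z hz t ht i => (hyv i z t).trans (extendTrajectory_of_mem v i hz ht)⟩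

theorem IsKernel.exists_isState_transform_eqOn (hK : S.IsKernel K) {v : ℝ → Fin 2 → ℝ}
    (hv : IsState v) : ∃ w, IsState w ∧ EqOn (S.transform K w) v (Icc 0 1) ∧
      ∀ w', IsState w' → EqOn (S.transform K w') v (Icc 0 1) → EqOn w' w (Icc 0 1) := by
  obtain ⟨x, y, hy, hxy, hyv⟩ := hK.exists_sub_volterra_scaling_eq hv.isStateTrajectory
  have hw := (isStateTrajectory_of_scaling_mul_eq hy hxy).isState le_rfl
  have hwv : EqOn (S.transform K fun z => x z 0) v (Icc 0 1) := fun z hz => funext fun i =>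
    (hK.transform_apply hy (fun z hz => hxy z hz 0 le_rfl) hz i).trans (hyv z hz 0 le_rfl i)
  exact ⟨_, hw, hwv, fun w' hw' h => hK.eqOn_of_transform_eqOn hw hw' (h.trans hwv.symm)⟩

section Converse

variable {ξ₀ : Fin n → ℝ} {x₀ xb₀ : ℝ → Fin 2 → ℝ} {u ub : ℝ → ℝ} {ξ : ℝ → Fin n → ℝ}
  {xb : ℝ → ℝ → Fin 2 → ℝ}

theorem IsKernel.isSolution_of_sub_volterra (hK : S.IsKernel K) (hq0 : S.q0 ≠ 0)
    (h : S.IsTransportSolution K ξ₀ xb₀ ub ξ xb) (hy : ∀ i, IsSignal (y i))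
    (hxy : ∀ z ∈ Icc (0 : ℝ) 1, ∀ t, 0 ≤ t → ∀ i, S.scaling i z * x z t i = y i z t)
    (hyv : ∀ z ∈ Icc (0 : ℝ) 1, ∀ t, 0 ≤ t → ∀ i,
      y i z t - volterra (kernelExt K) y i z t = xb z t i) :
    S.IsSolution ξ₀ (fun z => x z 0) (fun t => x 1 t 0 - S.q1 * x 1 t 1) ξ x := by
  have hzero : (0 : ℝ) ∈ Icc (0 : ℝ) 1 := ⟨le_rfl, zero_le_one⟩
  have hx := isStateTrajectory_of_scaling_mul_eq hy hxy
  have hy0 : ∀ t, 0 ≤ t → ∀ i, y i 0 t = xb 0 t i := fun t ht i => by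
    rw [← hyv 0 hzero t ht, volterra_zero, sub_zero]
  have hx0 : ∀ t, 0 ≤ t → ∀ i, x 0 t i = xb 0 t i := fun t ht i => by
    rw [← hy0 t ht, ← hxy 0 hzero t ht, scaling_zero, one_mul]
  refine ⟨hx, h.cont, fun _ _ => rfl, fun t ht => ?_, fun t ht => ?_, ?_,
    fun t _ => (add_sub_cancel _ _).symm⟩
  · rw [h.ode t ht]
    congr 1
    refine intervalIntegral.integral_congr fun s hs => ?_
    rw [uIcc_of_le ht] at hs
    simp only [hx0 s hs.1]
  · simp only [hx0 t ht.le]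
    exact h.bc0 t ht
  · refine (solvesTransport_coupling_iff hx hy hxy).2 fun i =>
      hK.isTransported_of_sub_volterra hy (fun i => ?_) i
    refine ((S.solvesTransport_iff _ _).1 h.pde i).congr (fun z hz t ht => ?_)
      fun z hz t ht => hyv z hz t ht i
    refine hK.boundarySource_eq hq0 hz ?_ i
    rw [hy0 t ht.le, hy0 t ht.le]
    exact h.bc0 t ht

theorem IsKernel.exists_isSolution (hK : S.IsKernel K) (hq0 : S.q0 ≠ 0)
    (h : S.IsTransportSolution K ξ₀ xb₀ ub ξ xb) :
    ∃ (x₀ : ℝ → Fin 2 → ℝ) (u : ℝ → ℝ) (x : ℝ → ℝ → Fin 2 → ℝ),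
      S.IsSolution ξ₀ x₀ u ξ x ∧ S.Corresponds K x₀ u x xb₀ ub xb := by
  have hone : (1 : ℝ) ∈ Icc (0 : ℝ) 1 := ⟨zero_le_one, le_rfl⟩
  obtain ⟨x, y, hy, hxy, hyv⟩ := hK.exists_sub_volterra_scaling_eq h.traj
  have htransform : ∀ z ∈ Icc (0 : ℝ) 1, ∀ t, 0 ≤ t → xb z t = S.transform K (fun ζ => x ζ t) z :=
    fun z hz t ht => funext fun i =>
      ((hK.transform_apply hy (fun z hz => hxy z hz t ht) hz i).trans (hyv z hz t ht i)).symm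
  refine ⟨_, _, x, hK.isSolution_of_sub_volterra hq0 h hy hxy hyv, fun z hz => ?_, fun t ht => ?_,
    htransform⟩
  · rw [← h.init z hz, htransform z hz 0 le_rfl]
  · have hresidual := hK.boundary_residual_eq hy (fun z hz => hxy z hz t ht.le)
      fun t => x 1 t 0 - S.q1 * x 1 t 1
    rw [hyv 1 hone t ht.le, hyv 1 hone t ht.le, h.bc1 t ht] at hresidual
    linarith

theorem IsKernel.eq_of_corresponds (hK : S.IsKernel K) (hx : S.IsSolution ξ₀ x₀ u ξ x)
    (hc : S.Corresponds K x₀ u x xb₀ ub xb) {x₀' : ℝ → Fin 2 → ℝ} {u' : ℝ → ℝ}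
    {x' : ℝ → ℝ → Fin 2 → ℝ} (hx' : S.IsSolution ξ₀ x₀' u' ξ x')
    (hc' : S.Corresponds K x₀' u' x' xb₀ ub xb) :
    EqOn x₀' x₀ (Icc 0 1) ∧ EqOn u' u (Ioi 0) ∧
      ∀ z ∈ Icc (0 : ℝ) 1, ∀ t : ℝ, 0 ≤ t → x' z t = x z t := by
  have hone : (1 : ℝ) ∈ Icc (0 : ℝ) 1 := ⟨zero_le_one, le_rfl⟩
  have heq : ∀ z ∈ Icc (0 : ℝ) 1, ∀ t : ℝ, 0 ≤ t → x' z t = x z t := fun z hz t ht =>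
    hK.eqOn_of_transform_eqOn (hx.traj.isState ht) (hx'.traj.isState ht)
      (fun z hz => (hc'.2.2 z hz t ht).symm.trans (hc.2.2 z hz t ht)) hz
  refine ⟨fun z hz => ?_, fun t ht => ?_, heq⟩
  · rw [← hx'.init z hz, ← hx.init z hz, heq z hz 0 le_rfl]
  · have hu := hx.bc1 t ht
    have hu' := hx'.bc1 t ht
    rw [heq 1 hone t (le_of_lt ht), hu] at hu'
    exact (add_left_cancel hu').symm

end Converse

end PDEODESystem

theorem lemma1 {n : ℕ} (S : PDEODESystem n) (hq0 : S.q0 ≠ 0) :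
    (∃ K : ℝ → ℝ → Matrix (Fin 2) (Fin 2) ℝ, S.IsKernel K) ∧
    ∀ K : ℝ → ℝ → Matrix (Fin 2) (Fin 2) ℝ, S.IsKernel K →
      -- the state transformation is a bijection of the state space, bounded in both directions
      (∀ w, IsState w → IsState (S.transform K w)) ∧
      (∀ v, IsState v → ∃ w, IsState w ∧ EqOn (S.transform K w) v (Icc 0 1) ∧
        ∀ w', IsState w' → EqOn (S.transform K w') v (Icc 0 1) → EqOn w' w (Icc 0 1)) ∧
      (∃ C : ℝ, 0 < C ∧ ∀ w, IsState w → ∀ M : ℝ,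
        ((∀ z ∈ Icc (0 : ℝ) 1, ‖w z‖ ≤ M) →
          ∀ z ∈ Icc (0 : ℝ) 1, ‖S.transform K w z‖ ≤ C * M) ∧
        ((∀ z ∈ Icc (0 : ℝ) 1, ‖S.transform K w z‖ ≤ M) →
          ∀ z ∈ Icc (0 : ℝ) 1, ‖w z‖ ≤ C * M)) ∧
      -- it maps the solutions of the original system to solutions of the transport form
      (∀ (ξ₀ : Fin n → ℝ) (x₀ : ℝ → Fin 2 → ℝ) (u : ℝ → ℝ) (ξ : ℝ → Fin n → ℝ)
        (x : ℝ → ℝ → Fin 2 → ℝ), S.IsSolution ξ₀ x₀ u ξ x →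
        S.IsTransportSolution K ξ₀ (S.transform K x₀) (S.newInput K u x) ξ
          (fun z t => S.transform K (fun ζ => x ζ t) z)) ∧
      -- every solution of the transport form arises from exactly one solution of the original system
      (∀ (ξ₀ : Fin n → ℝ) (xb₀ : ℝ → Fin 2 → ℝ) (ub : ℝ → ℝ) (ξ : ℝ → Fin n → ℝ)
        (xb : ℝ → ℝ → Fin 2 → ℝ), S.IsTransportSolution K ξ₀ xb₀ ub ξ xb →
        ∃ (x₀ : ℝ → Fin 2 → ℝ) (u : ℝ → ℝ) (x : ℝ → ℝ → Fin 2 → ℝ),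
          S.IsSolution ξ₀ x₀ u ξ x ∧ S.Corresponds K x₀ u x xb₀ ub xb ∧
          ∀ (x₀' : ℝ → Fin 2 → ℝ) (u' : ℝ → ℝ) (x' : ℝ → ℝ → Fin 2 → ℝ),
            S.IsSolution ξ₀ x₀' u' ξ x' → S.Corresponds K x₀' u' x' xb₀ ub xb →
            EqOn x₀' x₀ (Icc 0 1) ∧ EqOn u' u (Ioi 0) ∧
            ∀ z ∈ Icc (0 : ℝ) 1, ∀ t : ℝ, 0 ≤ t → x' z t = x z t) := by
  refine ⟨S.exists_isKernel, fun K hK => ⟨fun w hw => hK.isState_transform hw,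
    fun v hv => hK.exists_isState_transform_eqOn hv,
    hK.exists_norm_transform_le_and_norm_le_transform,
    fun ξ₀ x₀ u ξ x h => hK.isTransportSolution hq0 h, fun ξ₀ xb₀ ub ξ xb h => ?_⟩⟩
  obtain ⟨x₀, u, x, hx, hc⟩ := hK.exists_isSolution hq0 h
  exact ⟨x₀, u, x, hx, hc, fun x₀' u' x' hx' hc' => hK.eq_of_corresponds hx hc hx' hc'⟩
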